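/- Let $n\ge 0$ and $d\ge 1$ be integers. Put $\bar d=d$ if $d$ is odd and $\bar d=2d$ if $d$ is even, let $\zeta\in\mathbb C$ be a primitive $\bar d$-th root of unity, and $\xi=\zeta^2$. On $\mathbb C^d$ with orthonormal basis $(v_i)_{i\in\mathbb Z/d}$ let $Xv_i=v_{i+1}$ and $Zv_i=\xi^iv_i$. The Pauli group $\mathcal P_n=\mathcal P_n^{(d)}$ is the group of operators on $V=(\mathbb C^d)^{\otimes n}$ generated by $X_r$, $Z_r$ (the operators $X$, $Z$ on the $r$-th factor, $1\le r\le n$) and by the multiplication by $\zeta$. For a positive divisor $d_0$ of $d$ let $\mathcal P_1^{(d_0,\zeta)}$ be the group of operators on $\mathbb C^{d_0}$ generated by $X$, by $Z$ (formed with the primitive $d_0$-th root of unity $\xi^{d/d_0}$) and by the multiplication by $\zeta$. For $k\ge 1$, $\mathcal P_1^{(d_1,\zeta)}\times_\zeta\cdots\times_\zeta\mathcal P_1^{(d_k,\zeta)}$ is the direct product of these groups modulo the identification of the elements $\zeta$ of all the factors; it acts on $\mathbb C^{d_1}\otimes\cdots\otimes\mathbb C^{d_k}$ by $(A_1,\dots,A_k)\mapsto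 A_1\otimes\cdots\otimes A_k$. Let $\mathcal M=(\mathbb Z/d)^{2n}$ with basis $z_1,\dots,z_n,x_1,\dots,x_n$ and with the alternating form $\phi$ given by $\phi(z_i,x_j)=\delta_{ij}$, $\phi(z_i,z_j)=\phi(x_i,x_j)=0$, and let $\tau\colon\mathcal P_n\to\mathcal M$ be the homomorphism with $\tau(Z_r)=z_r$, $\tau(X_r)=x_r$, $\tau(\zeta)=0$. For $d_0\mid d$ let $S_{d_0}=\mathbb Z/d_0\oplus\mathbb Z/d_0$ with the alternating $\mathbb Z/d$-valued form such that $((1,0),(0,1))\mapsto d/d_0$. A Heisenberg extension of a finite $\mathbb Z/d$-module $M$ with an alternating form $\phi$ is a surjective homomorphism $\tau\colon G\to M$ whose kernel is cyclic of order $\bar d$ with a fixed generator $\zeta$, such that $gh=\zeta^{2\phi(\tau(g),\tau(h))}hg$ for all $g,h\in G$, and such that each $m\in M$ has a preimage of the same order as $m$. Let $H\subset\mathcal P_n$ be a commutative subgroup whose only scalar operator $\zeta^a$ is the identity. Let $N(H)$ be the normaliser of $H$ in $\mathcal P_n$, and $V^H=\{v\in V: hv=v \text{ for all } h\in H\}$.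 Then: (1) $\tau$ maps $N(H)$ to $\tau(H)^\perp$, and induces a homomorphism $\bar\tau\colon N(H)/H\to\tau(H)^\perp/\tau(H)$ which is a Heisenberg extension of $\tau(H)^\perp/\tau(H)$ with the form induced by $\phi$ (the generator of the kernel being the class of $\zeta$). (2) There are $k\ge 1$ and positive divisors $d_1,\dots,d_k$ of $d$ with an isomorphism $\tau(H)^\perp/\tau(H)\simeq S_{d_1}\oplus\cdots\oplus S_{d_k}$ (orthogonal sum) that respects the forms. (3) Let $k\ge1$, let $d_1,\dots,d_k$ be any positive divisors of $d$, and let $e\colon\tau(H)^\perp/\tau(H)\to S_{d_1}\oplus\cdots\oplus S_{d_k}$ be any isomorphism that respects the forms. There is a group isomorphism $$\Psi\colon N(H)/H\to\mathcal P_1^{(d_1,\zeta)}\times_\zeta\cdots\times_\zeta\mathcal P_1^{(d_k,\zeta)}$$ with $\Psi(\zeta)=\zeta$ that lifts $e$: if $e(\bar\tau(g))=((b_1,a_1),\dots,(b_k,a_k))$, then $\Psi(g)$ is the class of $(Z^{b_1}X^{a_1},\dots,Z^{b_k}X^{a_k})$ multiplied by a power of $\zeta$. Moreover, for every group isomorphism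 $\Psi$ between these two groups with $\Psi(\zeta)=\zeta$ there is a unitary isomorphism $$U\colon V^H\to\mathbb C^{d_1}\otimes\cdots\otimes\mathbb C^{d_k}$$ with $U(gv)=\Psi(g)\,U(v)$ for all $g\in N(H)/H$ and $v\in V^H$; that is, $U$ identifies the action of $N(H)/H$ on $V^H$ with the tensor product action of $\mathcal P_1^{(d_1,\zeta)}\times_\zeta\cdots\times_\zeta\mathcal P_1^{(d_k,\zeta)}$. -/

import Mathlib

open scoped TensorProduct

noncomputable section

namespace QuditStab

/-- `d̄ = d` for odd `d` and `d̄ = 2d` for even `d`. -/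
def dbar (d : ℕ) : ℕ := if Even d then 2 * d else d

/-- Multiplication by a non-zero complex number, as an invertible operator. -/
def scal (V : Type*) [AddCommGroup V] [Module ℂ V] : ℂˣ →* (V ≃ₗ[ℂ] V) :=
  DistribMulAction.toModuleAut ℂ V

lemma scal_apply {V : Type*} [AddCommGroup V] [Module ℂ V] (c : ℂˣ) (v : V) :
    scal V c v = (c : ℂ) • v := rfl

lemma scal_comm {V : Type*} [AddCommGroup V] [Module ℂ V] (c : ℂˣ) (g : V ≃ₗ[ℂ] V) :
    scal V c * g = g * scal V c := by
  ext v
  simp [scal_apply]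

lemma scal_injective (V : Type*) [AddCommGroup V] [Module ℂ V] [Nontrivial V] :
    Function.Injective (scal V) := by
  intro c c' h
  obtain ⟨v, hv⟩ := exists_ne (0 : V)
  have h1 : (c : ℂ) • v = (c' : ℂ) • v := by
    rw [← scal_apply, ← scal_apply, h]
  exact Units.ext (smul_left_injective ℂ hv h1)

/-! ### One qudit -/

/-- The space `ℂ^d`, with coordinates indexed by `ℤ/d`; its standard basis is
`v_i = Pi.single i 1`. -/
abbrev Qudit (d : ℕ) : Type := ZMod d → ℂ

/-- The shift operator, `X v_i = v_{i+1}`. -/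
def opX (d : ℕ) : Qudit d ≃ₗ[ℂ] Qudit d :=
  LinearEquiv.funCongrLeft ℂ ℂ (Equiv.subRight (1 : ZMod d))

/-- The clock operator, `Z v_i = ξ^i v_i`, for a `d`-th root of unity `ξ`. -/
def opZ (d : ℕ) (ξ : ℂˣ) : Qudit d ≃ₗ[ℂ] Qudit d :=
  LinearEquiv.piCongrRight fun i : ZMod d => scal ℂ (ξ ^ i.val)

lemma opX_apply (d : ℕ) (v : Qudit d) (i : ZMod d) : opX d v i = v (i - 1) := rfl

lemma opZ_apply (d : ℕ) (ξ : ℂˣ) (v : Qudit d) (i : ZMod d) :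
    opZ d ξ v i = ((ξ ^ i.val : ℂˣ) : ℂ) * v i := rfl

lemma pow_val_add {d : ℕ} [NeZero d] {ξ : ℂˣ} (hξ : ξ ^ d = 1) (a b : ZMod d) :
    ξ ^ (a + b).val = ξ ^ a.val * ξ ^ b.val := by
  rw [ZMod.val_add, ← pow_eq_pow_mod _ hξ, pow_add]

lemma pow_val_one {d : ℕ} [NeZero d] {ξ : ℂˣ} (hξ : ξ ^ d = 1) :
    ξ ^ (1 : ZMod d).val = ξ := by
  rw [ZMod.val_one_eq_one_mod, ← pow_eq_pow_mod _ hξ, pow_one]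

/-- `Z X = ξ X Z`. -/
lemma opZ_mul_opX (d : ℕ) [NeZero d] {ξ : ℂˣ} (hξ : ξ ^ d = 1) :
    opZ d ξ * opX d = scal _ ξ * (opX d * opZ d ξ) := by
  apply LinearEquiv.ext
  intro v
  funext i
  have h1 : ξ ^ i.val = ξ * ξ ^ (i - 1).val := by
    conv_lhs => rw [show i = 1 + (i - 1) by ring, pow_val_add hξ, pow_val_one hξ]
  simp only [LinearEquiv.mul_apply, scal_apply, opZ_apply, opX_apply, Pi.smul_apply, smul_eq_mul,
    h1, Units.val_mul, mul_assoc]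

lemma dbar_pow {d : ℕ} [NeZero d] {ζ : ℂˣ} (hζ : IsPrimitiveRoot ζ (dbar d)) : IsPrimitiveRoot (ζ ^ 2) d := by
  unfold dbar at hζ
  split_ifs at hζ with h
  · exact hζ.pow (by have := NeZero.pos d; omega) rfl
  · exact hζ.pow_of_coprime 2 (by
      rw [Nat.coprime_two_left]; exact Nat.not_even_iff_odd.mp h)

/-- For a divisor `d₀` of `d`, the group `P_1^{(d₀,ζ)}` of operators on `ℂ^{d₀}`: it is generated
by `X`, by `Z` and by the multiplication by `ζ`. Here `ζ` is a primitive `d̄`-th root of unity, and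
`Z` is formed with the primitive `d₀`-th root of unity `(ζ²)^{d/d₀}`. -/
def pauliOne (d d₀ : ℕ) (ζ : ℂˣ) : Subgroup (Qudit d₀ ≃ₗ[ℂ] Qudit d₀) :=
  Subgroup.closure {opX d₀, opZ d₀ ((ζ ^ 2) ^ (d / d₀)), scal _ ζ}

lemma opZ_pow (d : ℕ) (ξ : ℂˣ) (j : ℕ) : opZ d (ξ ^ j) = opZ d ξ ^ j := by
  induction j with
  | zero =>
    apply LinearEquiv.ext
    intro v
    funext i
    simp [opZ_apply]
  | succ j ih =>
    rw [pow_succ (opZ d ξ), ← ih]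
    apply LinearEquiv.ext
    intro v
    funext i
    rw [LinearEquiv.mul_apply, opZ_apply, opZ_apply, opZ_apply, ← mul_assoc, ← Units.val_mul,
      ← mul_pow, pow_succ]

/-- `P_1^{(d₀,ζ)}` is generated by the ordinary Pauli group `P_1^{(d₀)}` and by the multiplication
by `ζ`, whichever primitive root of unity `η` of order `d̄₀` is used to form `P_1^{(d₀)}`. -/
lemma pauliOne_eq {d d₀ : ℕ} [NeZero d] [NeZero d₀] (hd : d₀ ∣ d) {ζ η : ℂˣ}
    (hζ : IsPrimitiveRoot ζ (dbar d)) (hη : IsPrimitiveRoot η (dbar d₀)) :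
    pauliOne d d₀ ζ = Subgroup.closure {opX d₀, opZ d₀ (η ^ 2), scal _ η} ⊔
      Subgroup.zpowers (scal (Qudit d₀) ζ) := by
  have hdb : dbar d₀ ∣ dbar d := by
    obtain ⟨c, rfl⟩ := hd
    unfold dbar
    split_ifs with h1 h2 h2
    · exact ⟨c, by ring⟩
    · exact absurd (h1.mul_right c) h2
    · exact ⟨2 * c, by ring⟩
    · exact ⟨c, rfl⟩
  have hpos : dbar d ≠ 0 := by
    have := NeZero.pos d
    unfold dbar
    split_ifs <;> omega
  have : NeZero (dbar d) := ⟨hpos⟩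
  have hξ₀ : IsPrimitiveRoot ((ζ ^ 2) ^ (d / d₀)) d₀ :=
    (dbar_pow hζ).pow (NeZero.pos d) (Nat.div_mul_cancel hd).symm
  have hη₂ := dbar_pow hη
  have hηb : η ^ dbar d = 1 := by
    obtain ⟨c, hc⟩ := hdb
    rw [hc, pow_mul, hη.pow_eq_one, one_pow]
  obtain ⟨a, -, ha⟩ := hζ.eq_pow_of_mem_rootsOfUnity ((mem_rootsOfUnity _ _).mpr hηb)
  obtain ⟨b, -, hb⟩ := hξ₀.eq_pow_of_mem_rootsOfUnity ((mem_rootsOfUnity _ _).mpr hη₂.pow_eq_one)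
  obtain ⟨c, -, hc⟩ := hη₂.eq_pow_of_mem_rootsOfUnity ((mem_rootsOfUnity _ _).mpr hξ₀.pow_eq_one)
  apply le_antisymm
  · rw [pauliOne, Subgroup.closure_le]
    rintro x (rfl | rfl | rfl)
    · exact Subgroup.mem_sup_left (Subgroup.subset_closure (by simp))
    · rw [← hc, opZ_pow d₀ (η ^ 2) c]
      have hmem : opZ d₀ (η ^ 2) ∈ Subgroup.closure {opX d₀, opZ d₀ (η ^ 2), scal _ η} :=
        Subgroup.subset_closure (Or.inr (Or.inl rfl))
      exact Subgroup.mem_sup_left (Subgroup.pow_mem _ hmem c)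
    · exact Subgroup.mem_sup_right (Subgroup.mem_zpowers _)
  · rw [sup_le_iff, Subgroup.closure_le, Subgroup.zpowers_le]
    refine ⟨?_, Subgroup.subset_closure (by simp)⟩
    rintro x (rfl | rfl | rfl)
    · exact Subgroup.subset_closure (by simp)
    · rw [← hb, opZ_pow]
      refine Subgroup.pow_mem _ ?_ _
      exact Subgroup.subset_closure (Or.inr (Or.inl rfl))
    · rw [← ha, map_pow]
      refine Subgroup.pow_mem _ ?_ _
      exact Subgroup.subset_closure (Or.inr (Or.inr rfl))

/-! ### Several qudits -/

/-- The tensor product `ℂ^{D_1} ⊗ … ⊗ ℂ^{D_k}`. -/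
abbrev Qudits {k : ℕ} (D : Fin k → ℕ) : Type := ⨂[ℂ] i, Qudit (D i)

/-- The basis of the tensor product that consists of the products of standard basis vectors. -/
def quditsBasis {k : ℕ} (D : Fin k → ℕ) [∀ i, NeZero (D i)] :
    Module.Basis (∀ i, ZMod (D i)) ℂ (Qudits D) :=
  Basis.piTensorProduct fun i => Pi.basisFun ℂ (ZMod (D i))

/-- The standard hermitian scalar product of the tensor product: the one for which the products of
standard basis vectors are orthonormal (conjugate linear in the first variable). -/
def hermForm {k : ℕ} (D : Fin k → ℕ) [∀ i, NeZero (D i)] (v w : Qudits D) : ℂ :=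
  ∑ s : ∀ i, ZMod (D i),
    (starRingEnd ℂ) ((quditsBasis D).repr v s) * (quditsBasis D).repr w s

/-- On pure tensors, the scalar product is the product of the scalar products of the factors. -/
lemma hermForm_tprod {k : ℕ} (D : Fin k → ℕ) [∀ i, NeZero (D i)] (v w : ∀ i, Qudit (D i)) :
    hermForm D (PiTensorProduct.tprod ℂ v) (PiTensorProduct.tprod ℂ w)
      = ∏ i, ∑ s : ZMod (D i), (starRingEnd ℂ) (v i s) * w i s := by
  simp only [hermForm, quditsBasis, Basis.piTensorProduct_repr_tprod_apply, Pi.basisFun_repr,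
    map_prod, ← Finset.prod_mul_distrib]
  rw [Finset.prod_univ_sum]
  simp [Fintype.piFinset_univ]

instance {k : ℕ} (D : Fin k → ℕ) [∀ i, NeZero (D i)] : Nontrivial (Qudits D) :=
  ⟨⟨quditsBasis D 0, 0, (quditsBasis D).ne_zero 0⟩⟩

/-- The operator `A_1 ⊗ … ⊗ A_k`, as a group homomorphism. -/
def tensorHom {k : ℕ} (D : Fin k → ℕ) :
    (∀ i, Qudit (D i) ≃ₗ[ℂ] Qudit (D i)) →* (Qudits D ≃ₗ[ℂ] Qudits D) :=
  MonoidHom.mk' (fun A => PiTensorProduct.congr A) (by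
    intro A B
    apply LinearEquiv.toLinearMap_injective
    apply PiTensorProduct.ext
    ext v
    simp)

lemma tensorHom_tprod {k : ℕ} (D : Fin k → ℕ) (A : ∀ i, Qudit (D i) ≃ₗ[ℂ] Qudit (D i))
    (v : ∀ i, Qudit (D i)) :
    tensorHom D A (PiTensorProduct.tprod ℂ v) = PiTensorProduct.tprod ℂ fun i => A i (v i) :=
  PiTensorProduct.congr_tprod A v

lemma tensorHom_single_scal {k : ℕ} (D : Fin k → ℕ) (r : Fin k) (c : ℂˣ) :
    tensorHom D (Pi.mulSingle r (scal _ c)) = scal _ c := by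
  apply LinearEquiv.toLinearMap_injective
  apply PiTensorProduct.ext
  ext v
  have h : (fun i => (Pi.mulSingle r (scal (Qudit (D r)) c) :
      ∀ i, Qudit (D i) ≃ₗ[ℂ] Qudit (D i)) i (v i)) = Function.update v r ((c : ℂ) • v r) := by
    funext i
    by_cases hi : i = r
    · subst hi
      simp [scal_apply]
    · simp [hi]
  simp only [LinearMap.compMultilinearMap_apply, LinearEquiv.coe_coe, tensorHom_tprod, h,
    MultilinearMap.map_update_smul, Function.update_eq_self, scal_apply]

/-- The space `V = (ℂ^d)^{⊗ n}` of `n` qudits. -/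
abbrev NQudits (n d : ℕ) : Type := Qudits fun _ : Fin n => d

/-- `X_r = I ⊗ … ⊗ X ⊗ … ⊗ I`. -/
def opXr (n d : ℕ) (r : Fin n) : NQudits n d ≃ₗ[ℂ] NQudits n d :=
  tensorHom (fun _ : Fin n => d) (Pi.mulSingle r (opX d))

/-- `Z_r = I ⊗ … ⊗ Z ⊗ … ⊗ I`. -/
def opZr (n d : ℕ) (ξ : ℂˣ) (r : Fin n) : NQudits n d ≃ₗ[ℂ] NQudits n d :=
  tensorHom (fun _ : Fin n => d) (Pi.mulSingle r (opZ d ξ))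

/-- The `n`-qudit Pauli group `P_n = P_n^{(d)}`, generated by all `X_r` and `Z_r` (with `ξ = ζ²`)
and by the multiplication by `ζ`. -/
def pauliGroup (n d : ℕ) (ζ : ℂˣ) : Subgroup (NQudits n d ≃ₗ[ℂ] NQudits n d) :=
  Subgroup.closure (Set.range (opXr n d) ∪ Set.range (opZr n d (ζ ^ 2)) ∪ {scal _ ζ})

/-! ### The symplectic module of the Pauli group -/

/-- The module `(ℤ/d)^{2n}`; the coordinates `(m r).1` and `(m r).2` are those of the basis vectors
`z_r` and `x_r`. -/
abbrev PauliMod (n d : ℕ) : Type := Fin n → ZMod d × ZMod d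

/-- The symplectic form with `φ(z_i, x_j) = -φ(x_j, z_i) = δ_{ij}` and
`φ(z_i, z_j) = φ(x_i, x_j) = 0`. -/
def pauliForm {n d : ℕ} (m m' : PauliMod n d) : ZMod d :=
  ∑ r, ((m r).1 * (m' r).2 - (m r).2 * (m' r).1)

/-- `g Y = ξ^j Y g`. -/
def CommBy {V : Type*} [AddCommGroup V] [Module ℂ V] {d : ℕ} (ξ : ℂˣ) (j : ZMod d)
    (g Y : V ≃ₗ[ℂ] V) : Prop :=
  g * Y = scal V (ξ ^ j.val) * (Y * g)

section Comm

variable {V : Type*} [AddCommGroup V] [Module ℂ V] {d : ℕ} {ξ : ℂˣ}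

lemma CommBy.of_commute {g Y : V ≃ₗ[ℂ] V} (h : g * Y = Y * g) : CommBy ξ (0 : ZMod d) g Y := by
  simp [CommBy, h]

variable [NeZero d]

lemma CommBy.mul_left (hξ : ξ ^ d = 1) {j j' : ZMod d} {g g' Y : V ≃ₗ[ℂ] V}
    (h : CommBy ξ j g Y) (h' : CommBy ξ j' g' Y) : CommBy ξ (j + j') (g * g') Y := by
  unfold CommBy at *
  calc g * g' * Y = g * (g' * Y) := mul_assoc _ _ _
    _ = g * (scal V (ξ ^ j'.val) * (Y * g')) := by rw [h']
    _ = (g * scal V (ξ ^ j'.val)) * Y * g' := by simp only [mul_assoc]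
    _ = scal V (ξ ^ j'.val) * (g * Y) * g' := by rw [← scal_comm]; simp only [mul_assoc]
    _ = scal V (ξ ^ j'.val) * scal V (ξ ^ j.val) * (Y * (g * g')) := by
      rw [h]; simp only [mul_assoc]
    _ = _ := by rw [pow_val_add hξ, map_mul, ← map_mul, ← map_mul, mul_comm (ξ ^ j'.val)]

lemma CommBy.inv_left (hξ : ξ ^ d = 1) {j : ZMod d} {g Y : V ≃ₗ[ℂ] V}
    (h : CommBy ξ j g Y) : CommBy ξ (-j) g⁻¹ Y := by
  unfold CommBy at *
  have h1 : ξ ^ (-j).val * ξ ^ j.val = 1 := by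
    rw [← pow_val_add hξ]; simp
  have h2 : Y * g = scal V (ξ ^ (-j).val) * (g * Y) := by
    rw [h, ← mul_assoc, ← map_mul, h1, map_one, one_mul]
  calc g⁻¹ * Y = g⁻¹ * (Y * g) * g⁻¹ := by group
    _ = g⁻¹ * scal V (ξ ^ (-j).val) * (g * Y) * g⁻¹ := by rw [h2]; simp only [mul_assoc]
    _ = scal V (ξ ^ (-j).val) * (g⁻¹ * (g * Y) * g⁻¹) := by
      rw [← scal_comm]; simp only [mul_assoc]
    _ = _ := by group

lemma CommBy.unique [Nontrivial V] (hξ : IsPrimitiveRoot ξ d) {j j' : ZMod d}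
    {g Y : V ≃ₗ[ℂ] V} (h : CommBy ξ j g Y) (h' : CommBy ξ j' g Y) : j = j' := by
  unfold CommBy at *
  rw [h] at h'
  have h1 := scal_injective V (mul_right_cancel h')
  exact ZMod.val_injective d (hξ.pow_inj (ZMod.val_lt _) (ZMod.val_lt _) h1)

/-- If every `g` in `P` satisfies `g Y = ξ^j Y g` for some `j`, then `g ↦ j` is a homomorphism. -/
def commHom [Nontrivial V] (hξ : IsPrimitiveRoot ξ d) (P : Subgroup (V ≃ₗ[ℂ] V)) (Y : V ≃ₗ[ℂ] V)
    (h : ∀ g ∈ P, ∃ j : ZMod d, CommBy ξ j g Y) : P →* Multiplicative (ZMod d) :=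
  MonoidHom.mk' (fun g => Multiplicative.ofAdd (h g g.2).choose) (by
    intro g g'
    rw [← ofAdd_add]
    congr 1
    exact CommBy.unique hξ (h _ (g * g').2).choose_spec
      (CommBy.mul_left hξ.pow_eq_one (h g g.2).choose_spec (h g' g'.2).choose_spec))

lemma commHom_eq [Nontrivial V] (hξ : IsPrimitiveRoot ξ d) (P : Subgroup (V ≃ₗ[ℂ] V))
    (Y : V ≃ₗ[ℂ] V) (h : ∀ g ∈ P, ∃ j : ZMod d, CommBy ξ j g Y) (g : P) (j : ZMod d)
    (hj : CommBy ξ j (g : V ≃ₗ[ℂ] V) Y) : commHom hξ P Y h g = Multiplicative.ofAdd j :=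
  congrArg Multiplicative.ofAdd (CommBy.unique hξ (h g g.2).choose_spec hj)

end Comm

section Tau

variable {n d : ℕ} {ζ : ℂˣ}

lemma commute_X_X (r s : Fin n) : opXr n d r * opXr n d s = opXr n d s * opXr n d r := by
  unfold opXr
  rw [← map_mul, ← map_mul]
  by_cases h : r = s
  · subst h; rfl
  · rw [(Pi.mulSingle_commute h _ _).eq]

lemma commute_Z_Z (ξ : ℂˣ) (r s : Fin n) :
    opZr n d ξ r * opZr n d ξ s = opZr n d ξ s * opZr n d ξ r := by
  unfold opZr
  rw [← map_mul, ← map_mul]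
  by_cases h : r = s
  · subst h; rfl
  · rw [(Pi.mulSingle_commute h _ _).eq]

variable [NeZero d]

lemma commBy_Z_X (hξ : (ζ ^ 2) ^ d = 1) (r s : Fin n) :
    CommBy (ζ ^ 2) (if r = s then (1 : ZMod d) else 0) (opZr n d (ζ ^ 2) r) (opXr n d s) := by
  split_ifs with h
  · subst h
    unfold CommBy opZr opXr
    rw [pow_val_one hξ, ← tensorHom_single_scal _ r, ← map_mul, ← map_mul, ← map_mul,
      ← Pi.mulSingle_mul, ← Pi.mulSingle_mul, ← Pi.mulSingle_mul, opZ_mul_opX d hξ]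
  · apply CommBy.of_commute
    unfold opZr opXr
    rw [← map_mul, ← map_mul, (Pi.mulSingle_commute h _ _).eq]

lemma commBy_X_Z (hξ : (ζ ^ 2) ^ d = 1) (r s : Fin n) :
    CommBy (ζ ^ 2) (if r = s then (-1 : ZMod d) else 0) (opXr n d r) (opZr n d (ζ ^ 2) s) := by
  have h := commBy_Z_X hξ s r
  have h1 : (ζ ^ 2) ^ (if r = s then (-1 : ZMod d) else 0).val
      * (ζ ^ 2) ^ (if s = r then (1 : ZMod d) else 0).val = 1 := by
    rw [← pow_val_add hξ]
    by_cases hrs : r = s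
    · simp [hrs]
    · simp [hrs, Ne.symm hrs]
  unfold CommBy at *
  rw [h, ← mul_assoc, ← map_mul, h1, map_one, one_mul]

lemma exists_commBy (hξ : (ζ ^ 2) ^ d = 1) (Y : NQudits n d ≃ₗ[ℂ] NQudits n d)
    (hX : ∀ r, ∃ j : ZMod d, CommBy (ζ ^ 2) j (opXr n d r) Y)
    (hZ : ∀ r, ∃ j : ZMod d, CommBy (ζ ^ 2) j (opZr n d (ζ ^ 2) r) Y) :
    ∀ g ∈ pauliGroup n d ζ, ∃ j : ZMod d, CommBy (ζ ^ 2) j g Y := by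
  intro g hg
  induction hg using Subgroup.closure_induction with
  | mem x hx =>
    rcases hx with (⟨r, rfl⟩ | ⟨r, rfl⟩) | rfl
    · exact hX r
    · exact hZ r
    · exact ⟨0, CommBy.of_commute (scal_comm _ _)⟩
  | one => exact ⟨0, CommBy.of_commute (by simp)⟩
  | mul x y _ _ hx hy =>
    obtain ⟨j, hj⟩ := hx
    obtain ⟨j', hj'⟩ := hy
    exact ⟨_, hj.mul_left hξ hj'⟩
  | inv x _ hx =>
    obtain ⟨j, hj⟩ := hx
    exact ⟨_, hj.inv_left hξ⟩

lemma exists_commBy_X (hξ : (ζ ^ 2) ^ d = 1) (r : Fin n) :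
    ∀ g ∈ pauliGroup n d ζ, ∃ j : ZMod d, CommBy (ζ ^ 2) j g (opXr n d r) :=
  exists_commBy hξ _ (fun s => ⟨0, CommBy.of_commute (commute_X_X s r)⟩)
    (fun s => ⟨_, commBy_Z_X hξ s r⟩)

lemma exists_commBy_Z (hξ : (ζ ^ 2) ^ d = 1) (r : Fin n) :
    ∀ g ∈ pauliGroup n d ζ, ∃ j : ZMod d, CommBy (ζ ^ 2) j g (opZr n d (ζ ^ 2) r) :=
  exists_commBy hξ _ (fun s => ⟨_, commBy_X_Z hξ s r⟩)
    (fun s => ⟨0, CommBy.of_commute (commute_Z_Z _ s r)⟩)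

/-- The homomorphism `τ : P_n → (ℤ/d)^{2n}` with `τ(Z_r) = z_r`, `τ(X_r) = x_r`, `τ(ζ) = 0`
(see the three lemmas below). The `z_r`-coordinate of `τ(g)` is read off from the commutation of `g`
with `X_r`, and the `x_r`-coordinate from its commutation with `Z_r`. -/
def tau (hζ : IsPrimitiveRoot ζ (dbar d)) :
    pauliGroup n d ζ →* Multiplicative (PauliMod n d) :=
  MonoidHom.mk' (fun g => Multiplicative.ofAdd fun r =>
      (Multiplicative.toAdd (commHom (dbar_pow hζ) (pauliGroup n d ζ) (opXr n d r)
          (exists_commBy_X (dbar_pow hζ).pow_eq_one r) g),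
        - Multiplicative.toAdd (commHom (dbar_pow hζ) (pauliGroup n d ζ) (opZr n d (ζ ^ 2) r)
          (exists_commBy_Z (dbar_pow hζ).pow_eq_one r) g))) (by
    intro g g'
    rw [← ofAdd_add]
    congr 1
    funext r
    simp only [Pi.add_apply, MonoidHom.map_mul, toAdd_mul, Prod.mk_add_mk, neg_add])

/-- The operator `Z_r` as an element of the Pauli group. -/
def pauliZ (n d : ℕ) (ζ : ℂˣ) (r : Fin n) : pauliGroup n d ζ :=
  ⟨opZr n d (ζ ^ 2) r, Subgroup.subset_closure (Or.inl (Or.inr ⟨r, rfl⟩))⟩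

/-- The operator `X_r` as an element of the Pauli group. -/
def pauliX (n d : ℕ) (ζ : ℂˣ) (r : Fin n) : pauliGroup n d ζ :=
  ⟨opXr n d r, Subgroup.subset_closure (Or.inl (Or.inl ⟨r, rfl⟩))⟩

/-- The multiplication by `ζ` as an element of the Pauli group. -/
def pauliZeta (n d : ℕ) (ζ : ℂˣ) : pauliGroup n d ζ :=
  ⟨scal _ ζ, Subgroup.subset_closure (Or.inr rfl)⟩

lemma tau_eq (hζ : IsPrimitiveRoot ζ (dbar d)) (g : pauliGroup n d ζ) (m : PauliMod n d)
    (hX : ∀ r, CommBy (ζ ^ 2) (m r).1 (g : NQudits n d ≃ₗ[ℂ] NQudits n d) (opXr n d r))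
    (hZ : ∀ r, CommBy (ζ ^ 2) (-(m r).2) (g : NQudits n d ≃ₗ[ℂ] NQudits n d)
      (opZr n d (ζ ^ 2) r)) :
    tau hζ g = Multiplicative.ofAdd m := by
  refine congrArg Multiplicative.ofAdd (funext fun r => ?_)
  rw [commHom_eq _ _ _ _ g _ (hX r), commHom_eq _ _ _ _ g _ (hZ r)]
  simp

lemma tau_pauliZ (hζ : IsPrimitiveRoot ζ (dbar d)) (r : Fin n) :
    tau hζ (pauliZ n d ζ r) = Multiplicative.ofAdd (Pi.single r (1, 0)) := by
  apply tau_eq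
  · intro s
    have h := commBy_Z_X (dbar_pow hζ).pow_eq_one r s
    by_cases hrs : r = s
    · subst hrs; simpa [pauliZ] using h
    · simpa [pauliZ, hrs, Ne.symm hrs] using h
  · intro s
    have h : CommBy (ζ ^ 2) (0 : ZMod d) _ _ :=
      CommBy.of_commute (commute_Z_Z (n := n) (d := d) (ζ ^ 2) r s)
    by_cases hrs : r = s
    · subst hrs; simpa [pauliZ] using h
    · simpa [pauliZ, hrs, Ne.symm hrs] using h

lemma tau_pauliX (hζ : IsPrimitiveRoot ζ (dbar d)) (r : Fin n) :
    tau hζ (pauliX n d ζ r) = Multiplicative.ofAdd (Pi.single r (0, 1)) := by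
  apply tau_eq
  · intro s
    have h : CommBy (ζ ^ 2) (0 : ZMod d) _ _ :=
      CommBy.of_commute (commute_X_X (n := n) (d := d) r s)
    by_cases hrs : r = s
    · subst hrs; simpa [pauliX] using h
    · simpa [pauliX, hrs, Ne.symm hrs] using h
  · intro s
    have h := commBy_X_Z (dbar_pow hζ).pow_eq_one r s
    by_cases hrs : r = s
    · subst hrs; simpa [pauliX] using h
    · simpa [pauliX, hrs, Ne.symm hrs] using h

lemma tau_pauliZeta (hζ : IsPrimitiveRoot ζ (dbar d)) : tau hζ (pauliZeta n d ζ) = 1 :=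
  tau_eq hζ _ 0 (fun _ => CommBy.of_commute (scal_comm _ _))
    (fun r => by
      have h : CommBy (ζ ^ 2) (0 : ZMod d) (scal (NQudits n d) ζ) (opZr n d (ζ ^ 2) r) :=
        CommBy.of_commute (scal_comm _ _)
      simpa [pauliZeta] using h)

end Tau

/-! ### The reduction `τ(H)^⊥/τ(H)` -/

/-- The image `τ(H)`. -/
def tauImage {n d : ℕ} [NeZero d] {ζ : ℂˣ} (hζ : IsPrimitiveRoot ζ (dbar d))
    (H : Subgroup (pauliGroup n d ζ)) : AddSubgroup (PauliMod n d) :=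
  Subgroup.toAddSubgroup' (H.map (tau hζ))

lemma pauliForm_add_left {n d : ℕ} (a b c : PauliMod n d) :
    pauliForm (a + b) c = pauliForm a c + pauliForm b c := by
  simp only [pauliForm, Pi.add_apply, Prod.fst_add, Prod.snd_add, ← Finset.sum_add_distrib]
  exact Finset.sum_congr rfl fun _ _ => by ring

lemma pauliForm_swap {n d : ℕ} (a b : PauliMod n d) : pauliForm a b = -pauliForm b a := by
  simp only [pauliForm, ← Finset.sum_neg_distrib]
  exact Finset.sum_congr rfl fun _ _ => by ring

/-- The orthogonal complement `N^⊥`. -/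
def perp {n d : ℕ} (N : AddSubgroup (PauliMod n d)) : AddSubgroup (PauliMod n d) where
  carrier := {m | ∀ x ∈ N, pauliForm m x = 0}
  zero_mem' := fun x _ => by simp [pauliForm]
  add_mem' := fun {a b} ha hb x hx => by rw [pauliForm_add_left, ha x hx, hb x hx, add_zero]
  neg_mem' := fun {a} ha x hx => by
    have h := pauliForm_add_left a (-a) x
    rw [add_neg_cancel, ha x hx, zero_add] at h
    rw [← h]
    simp [pauliForm]

/-- The quotient `N^⊥/N` (for an isotropic subgroup `N`). -/
abbrev Red {n d : ℕ} (N : AddSubgroup (PauliMod n d)) : Type :=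
  ↥(perp N) ⧸ N.addSubgroupOf (perp N)

/-- The form on `N^⊥/N` that is induced by the symplectic form. -/
def redForm {n d : ℕ} (N : AddSubgroup (PauliMod n d)) (x y : Red N) : ZMod d :=
  Quotient.liftOn₂' x y (fun a b => pauliForm (a : PauliMod n d) (b : PauliMod n d)) (by
    intro a b a' b' ha hb
    rw [QuotientAddGroup.leftRel_apply, AddSubgroup.mem_addSubgroupOf] at ha hb
    have h1 : pauliForm ((a' : PauliMod n d)) (b : PauliMod n d) = pauliForm (a : PauliMod n d) b := by
      have : (a' : PauliMod n d) = a + ((-a + a' : ↥(perp N)) : PauliMod n d) := by simp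
      rw [this, pauliForm_add_left,
        pauliForm_swap ((-a + a' : ↥(perp N)) : PauliMod n d) (b : PauliMod n d), b.2 _ ha]
      simp
    have h2 : pauliForm ((a' : PauliMod n d)) (b' : PauliMod n d)
        = pauliForm (a' : PauliMod n d) b := by
      have : (b' : PauliMod n d) = b + ((-b + b' : ↥(perp N)) : PauliMod n d) := by simp
      rw [pauliForm_swap, this, pauliForm_add_left,
        pauliForm_swap ((-b + b' : ↥(perp N)) : PauliMod n d) (a' : PauliMod n d), a'.2 _ hb,
        pauliForm_swap (b : PauliMod n d)]
      simp
    rw [h2, h1])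

/-! ### Elementary symplectic modules and Heisenberg extensions -/

/-- The orthogonal sum `S_{D_1} ⊕ … ⊕ S_{D_k}` of elementary symplectic modules,
`S_{d₀} = ℤ/d₀ ⊕ ℤ/d₀`. -/
abbrev SympSum {k : ℕ} (D : Fin k → ℕ) : Type := ∀ i, ZMod (D i) × ZMod (D i)

/-- For divisors `D_i` of `d`, the `ℤ/d`-valued form on `S_{D_1} ⊕ … ⊕ S_{D_k}` for which the
summands are orthogonal and `(1,0)`, `(0,1)` in `S_{D_i}` pair to `d/D_i`. -/
def sympSumForm (d : ℕ) {k : ℕ} (D : Fin k → ℕ) (x y : SympSum D) : ZMod d :=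
  ∑ i, ((d / D i : ℕ) : ZMod d) *
    ((((x i).1 * (y i).2 - (x i).2 * (y i).1 : ZMod (D i)).val : ℕ) : ZMod d)

/-- `e` is an isomorphism of the symplectic modules `N^⊥/N` and `S_{D_1} ⊕ … ⊕ S_{D_k}`. -/
def IsSymplecticIso {n d k : ℕ} {N : AddSubgroup (PauliMod n d)} {D : Fin k → ℕ}
    (e : Red N ≃+ SympSum D) : Prop :=
  ∀ x y : Red N, sympSumForm d D (e x) (e y) = redForm N x y

/-- `τ : G → M` is a Heisenberg extension of `(M, φ)`, where the kernel of `τ` is identified with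
the group of `d̄`-th roots of unity by means of its generator `z`. -/
structure IsHeisenbergExtension (d : ℕ) {G M : Type*} [Group G] [AddCommGroup M]
    (φ : M → M → ZMod d) (z : G) (τ : G →* Multiplicative M) : Prop where
  surjective : Function.Surjective τ
  ker_eq : τ.ker = Subgroup.zpowers z
  orderOf_zeta : orderOf z = dbar d
  commutator : ∀ g h : G,
    g * h = (z ^ 2) ^ (φ (Multiplicative.toAdd (τ g)) (Multiplicative.toAdd (τ h))).val * (h * g)
  exists_lift : ∀ m : M, ∃ g : G, τ g = Multiplicative.ofAdd m ∧ orderOf g = addOrderOf m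

/-! ### The group `N(H)/H` and its action on `V^H` -/

section Stab

variable {n d : ℕ} {ζ : ℂˣ}

/-- The stabiliser space `V^H`. -/
def stabSpace (H : Subgroup (pauliGroup n d ζ)) : Submodule ℂ (NQudits n d) where
  carrier := {v | ∀ h ∈ H, (h : NQudits n d ≃ₗ[ℂ] NQudits n d) v = v}
  zero_mem' := fun h _ => map_zero _
  add_mem' := fun {v w} hv hw h hh => by rw [map_add, hv h hh, hw h hh]
  smul_mem' := fun c v hv h hh => by rw [map_smul, hv h hh]

/-- The normaliser `N(H)` of `H` in the Pauli group. -/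
abbrev normGrp (H : Subgroup (pauliGroup n d ζ)) : Subgroup (pauliGroup n d ζ) :=
  Subgroup.normalizer (H : Set (pauliGroup n d ζ))

/-- The group `N(H)/H`. -/
abbrev NormQuot (H : Subgroup (pauliGroup n d ζ)) : Type :=
  ↥(normGrp H) ⧸ H.subgroupOf (normGrp H)

lemma norm_apply_mem (H : Subgroup (pauliGroup n d ζ)) (g : normGrp H) {v : NQudits n d}
    (hv : v ∈ stabSpace H) :
    ((g : pauliGroup n d ζ) : NQudits n d ≃ₗ[ℂ] NQudits n d) v ∈ stabSpace H := by
  intro h hh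
  have h1 : (g : pauliGroup n d ζ)⁻¹ * h * (g : pauliGroup n d ζ) ∈ H := by
    have := (Subgroup.mem_normalizer_iff.mp (inv_mem g.2) h).mp hh
    simpa using this
  have h2 := congrArg ((g : pauliGroup n d ζ) : NQudits n d ≃ₗ[ℂ] NQudits n d) (hv _ h1)
  rw [← LinearEquiv.mul_apply, ← Subgroup.coe_mul] at h2
  rw [← LinearEquiv.mul_apply, ← Subgroup.coe_mul]
  have h3 : h * (g : pauliGroup n d ζ)
      = (g : pauliGroup n d ζ) * ((g : pauliGroup n d ζ)⁻¹ * h * (g : pauliGroup n d ζ)) := by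
    group
  rw [h3]
  exact h2

/-- The action of `N(H)` on `V^H`. -/
def normAct (H : Subgroup (pauliGroup n d ζ)) : normGrp H →* Module.End ℂ (stabSpace H) where
  toFun g := ((g : pauliGroup n d ζ) : NQudits n d ≃ₗ[ℂ] NQudits n d).toLinearMap.restrict
    fun _ hv => norm_apply_mem H g hv
  map_one' := by ext v; rfl
  map_mul' g g' := by ext v; rfl

/-- The action of `N(H)/H` on `V^H`. -/
def quotAct (H : Subgroup (pauliGroup n d ζ)) : NormQuot H →* Module.End ℂ (stabSpace H) :=
  QuotientGroup.lift _ (normAct H) (by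
    intro g hg
    rw [Subgroup.mem_subgroupOf] at hg
    rw [MonoidHom.mem_ker]
    ext v
    exact v.2 _ hg)

lemma pauliZeta_mem_norm (H : Subgroup (pauliGroup n d ζ)) : pauliZeta n d ζ ∈ normGrp H := by
  rw [Subgroup.mem_normalizer_iff]
  intro h
  have : pauliZeta n d ζ * h = h * pauliZeta n d ζ := Subtype.ext (scal_comm _ _)
  rw [this, mul_inv_cancel_right]

/-- The class of `ζ` in `N(H)/H`. -/
def quotZeta (H : Subgroup (pauliGroup n d ζ)) : NormQuot H :=
  QuotientGroup.mk ⟨pauliZeta n d ζ, pauliZeta_mem_norm H⟩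

/-- `τH : N(H)/H → τ(H)^⊥/τ(H)` is the homomorphism induced by `τ`; in particular, `τ` maps `N(H)`
to `τ(H)^⊥`. -/
def IsInducedByTau [NeZero d] (hζ : IsPrimitiveRoot ζ (dbar d)) (H : Subgroup (pauliGroup n d ζ))
    (τH : NormQuot H →* Multiplicative (Red (tauImage hζ H))) : Prop :=
  ∀ g : normGrp H, ∃ m : perp (tauImage hζ H),
    tau hζ (g : pauliGroup n d ζ) = Multiplicative.ofAdd (m : PauliMod n d) ∧
      τH (QuotientGroup.mk g) = Multiplicative.ofAdd (m : Red (tauImage hζ H))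

end Stab

/-! ### The `ζ`-product of one-qudit Pauli groups -/

section ZetaProd

variable (d : ℕ) {k : ℕ} (D : Fin k → ℕ) (ζ : ℂˣ)

/-- The element `ζ` of `P_1^{(d₀,ζ)}`. -/
def oneZeta (d₀ : ℕ) : pauliOne d d₀ ζ :=
  ⟨scal _ ζ, Subgroup.subset_closure (by simp)⟩

/-- The element `X` of `P_1^{(d₀,ζ)}`. -/
def oneX (d₀ : ℕ) : pauliOne d d₀ ζ :=
  ⟨opX d₀, Subgroup.subset_closure (by simp)⟩

/-- The element `Z` of `P_1^{(d₀,ζ)}`. -/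
def oneZ (d₀ : ℕ) : pauliOne d d₀ ζ :=
  ⟨opZ d₀ ((ζ ^ 2) ^ (d / d₀)), Subgroup.subset_closure (by simp)⟩

/-- The relations that identify the elements `ζ` of all the factors. -/
def zetaRel : Subgroup (∀ i, pauliOne d (D i) ζ) :=
  Subgroup.normalClosure {x | ∃ i j : Fin k,
    x = Pi.mulSingle i (oneZeta d ζ (D i)) * (Pi.mulSingle j (oneZeta d ζ (D j)))⁻¹}

instance : (zetaRel d D ζ).Normal := Subgroup.normalClosure_normal

/-- The `ζ`-product `P_1^{(D_1,ζ)} ×_ζ … ×_ζ P_1^{(D_k,ζ)}` (for `k ≥ 1`): the direct product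
with the elements `ζ` of all the factors identified. -/
abbrev ZetaProd : Type := (∀ i, pauliOne d (D i) ζ) ⧸ zetaRel d D ζ

/-- The action `(A_1, …, A_k) ↦ A_1 ⊗ … ⊗ A_k` of the direct product. -/
def prodAct : (∀ i, pauliOne d (D i) ζ) →* Module.End ℂ (Qudits D) :=
  (LinearEquiv.automorphismGroup.toLinearMapMonoidHom (R := ℂ) (M := Qudits D)).comp
    ((tensorHom D).comp
      (MonoidHom.piMap fun i => (pauliOne d (D i) ζ).subtype))

lemma prodAct_apply (A : ∀ i, pauliOne d (D i) ζ) (v : Qudits D) :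
    prodAct d D ζ A v
      = tensorHom D (fun i => (A i : Qudit (D i) ≃ₗ[ℂ] Qudit (D i))) v := rfl

lemma prodAct_zeta (i : Fin k) :
    prodAct d D ζ (Pi.mulSingle i (oneZeta d ζ (D i))) = (scal (Qudits D) ζ).toLinearMap := by
  ext1
  ext v
  have h : (fun j => ((Pi.mulSingle i (oneZeta d ζ (D i)) : ∀ j, pauliOne d (D j) ζ) j :
      Qudit (D j) ≃ₗ[ℂ] Qudit (D j))) = Pi.mulSingle i (scal _ ζ) := by
    funext j
    by_cases hj : j = i
    · subst hj; simp [oneZeta]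
    · simp [hj]
  simp only [LinearMap.compMultilinearMap_apply, prodAct_apply, h, tensorHom_single_scal]
  rfl

/-- The tensor product action of the `ζ`-product on `ℂ^{D_1} ⊗ … ⊗ ℂ^{D_k}`. -/
def zetaProdAct : ZetaProd d D ζ →* Module.End ℂ (Qudits D) :=
  QuotientGroup.lift _ (prodAct d D ζ) (by
    refine Subgroup.normalClosure_le_normal ?_
    rintro x ⟨i, j, rfl⟩
    have h : prodAct d D ζ (Pi.mulSingle i (oneZeta d ζ (D i)))
        = prodAct d D ζ (Pi.mulSingle j (oneZeta d ζ (D j))) := by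
      rw [prodAct_zeta, prodAct_zeta]
    rw [SetLike.mem_coe, MonoidHom.mem_ker, map_mul, h, ← map_mul, mul_inv_cancel, map_one])

/-- The element `ζ` of the `ζ`-product; it does not depend on the factor `i` in which it is
taken. -/
def prodZeta (i : Fin k) : ZetaProd d D ζ :=
  QuotientGroup.mk (Pi.mulSingle i (oneZeta d ζ (D i)))

/-- The class in the `ζ`-product of the family of the operators `Z^b X^a` on `ℂ^{D_i}`,
`(b, a) = m_i ∈ S_{D_i}`. -/
def prodWeyl (m : SympSum D) : ZetaProd d D ζ :=
  QuotientGroup.mk fun i => oneZ d ζ (D i) ^ (m i).1.val * oneX d ζ (D i) ^ (m i).2.val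

end ZetaProd

end QuditStab

end

open QuditStab

/-! The map `tau` has kernel generated by `ζ`, and two Pauli operators commute up to `ζ` to the
power twice the symplectic form of their images. Conjugating `h ∈ H` by a Pauli operator thus
multiplies `h` by a scalar. If the operator normalises `H`, that scalar lies in `H` and is 1. Hence
`N(H)` is the preimage of `τ(H)^⊥` (`mem_normGrp_iff`), and `τ` descends to `N(H)/H` with kernel
generated by `ζ`. A lift of a class of order `r` can be multiplied by a power of `ζ` so that its
order becomes `r` (`isHeisenbergExtension_redTau`).

The induced form is non-degenerate because `N^⊥⊥ = N` (`perp_perp`, by counting with characters).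
Splitting off hyperbolic pairs of maximal order then gives the decomposition
(`exists_symplectic_decomposition`).

A Heisenberg extension is determined by its form: given lifts of a basis, of the right orders, in
two extensions, the subgroup of the product generated by the pairs of lifts and by the pair of
central generators is the graph of an isomorphism (`exists_mulEquiv_of_extensions`). The `ζ`-product
is such an extension of the sum of the `S_{D_i}`, so every symplectic isomorphism lifts.

For the unitary map, Pauli operators with non-zero image under `τ` have trace zero, so `dim V^H ·
|H| = d ^ n` and `dim V^H = ∏ D_i` (`finrank_stabSpace_eq`). Given `Ψ`, let `L` be the group of
elements of `N(H)` whose image under `Ψ` fixes the vacuum `e_0`. It contains no non-trivial scalar,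
so the same dimension formula gives a unit vector `w₀` fixed by `L` (`exists_vacuum`). Sending `X^s
e_0` to the action of `Ψ⁻¹(X^s)` on `w₀` is equivariant. It is isometric because the `Z`-type
operators separate the basis vectors, and bijective by dimension (`exists_unitary_intertwiner`). -/

noncomputable section

namespace QuditStab

/-! ### Central extensions by cyclic groups and their uniqueness -/

section Extensions

variable {G M ι : Type*} [Group G] [AddCommGroup M]

/-- In a group generated by a central element `z` and by lifts `u i` of independent elements of
the same orders, with all commutators powers of `z`, the kernel is generated by `z`. -/
lemma ker_eq_zpowers_of_generators [Fintype ι] {z : G} {τ : G →* Multiplicative M}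
    (hz : ∀ g : G, z * g = g * z) (hcomm : ∀ g h : G, ∃ k : ℤ, g * h = z ^ k * (h * g))
    {u : ι → G} {D : ι → ℕ} (hu : ∀ i, u i ^ D i = 1)
    (hgen : Subgroup.closure (insert z (Set.range u)) = ⊤) (hτz : τ z = 1)
    (hind : ∀ c : ι → ℤ, ∑ i, c i • Multiplicative.toAdd (τ (u i)) = 0 → ∀ i, (D i : ℤ) ∣ c i) :
    τ.ker = Subgroup.zpowers z := by
  apply le_antisymm
  · have hN : (Subgroup.zpowers z).Normal := by
      refine ⟨fun x hx g => ?_⟩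
      obtain ⟨k, rfl⟩ := hx
      have hc : Commute z g := hz g
      have : g * z ^ k * g⁻¹ = z ^ k := by rw [← (hc.zpow_left k).eq]; group
      exact ⟨k, this.symm⟩
    -- Modulo the central element `z` the group is abelian, so each class is a product of powers of
    -- the classes of the `u i`. For a class killed by `τ`, independence makes the exponents
    -- divisible by `D i`, and the class is trivial.
    let _ : CommGroup (G ⧸ Subgroup.zpowers z) :=
      { (inferInstance : Group (G ⧸ Subgroup.zpowers z)) with
        mul_comm := by
          intro a b
          induction a using QuotientGroup.induction_on with | H a => ?_
          induction b using QuotientGroup.induction_on with | H b => ?_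
          obtain ⟨k, hk⟩ := hcomm a b
          have h1 : ((z ^ k : G) : G ⧸ Subgroup.zpowers z) = 1 :=
            (QuotientGroup.eq_one_iff (z ^ k)).mpr (Subgroup.zpow_mem_zpowers z k)
          change ((a * b : G) : G ⧸ Subgroup.zpowers z) = ((b * a : G) : G ⧸ Subgroup.zpowers z)
          rw [hk, QuotientGroup.mk_mul, h1, one_mul] }
    let π : G →* G ⧸ Subgroup.zpowers z := QuotientGroup.mk' _
    have hπz : π z = 1 := (QuotientGroup.eq_one_iff z).mpr (Subgroup.mem_zpowers z)
    let τ' : G ⧸ Subgroup.zpowers z →* Multiplicative M := QuotientGroup.lift _ τ (by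
      rintro x ⟨k, rfl⟩
      simp [MonoidHom.mem_ker, hτz])
    have hsurj : Subgroup.closure (Set.range (π ∘ u)) = ⊤ := by
      have h1 : Subgroup.closure (π '' insert z (Set.range u)) = ⊤ := by
        rw [← MonoidHom.map_closure, hgen]
        exact Subgroup.map_top_of_surjective _ (QuotientGroup.mk'_surjective _)
      rw [eq_top_iff, ← h1, Subgroup.closure_le]
      rintro _ ⟨y, rfl | ⟨i, rfl⟩, rfl⟩
      · rw [hπz]; exact one_mem _
      · exact Subgroup.subset_closure ⟨i, rfl⟩
    intro g hg
    have hmem : π g ∈ Subgroup.closure (Set.range (π ∘ u)) := hsurj ▸ Subgroup.mem_top _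
    obtain ⟨c, hc⟩ := Subgroup.exists_of_mem_closure_range _ _ hmem
    have h0 : ∑ i, c i • Multiplicative.toAdd (τ (u i)) = 0 := by
      have h2 : τ' (π g) = 1 := hg
      rw [hc, map_prod] at h2
      have h3 := congrArg Multiplicative.toAdd h2
      rw [toAdd_prod, toAdd_one] at h3
      rw [← h3]
      refine Finset.sum_congr rfl fun i _ => ?_
      rw [map_zpow, toAdd_zpow]
      rfl
    have h1 : π g = 1 := by
      rw [hc]
      refine Finset.prod_eq_one fun i _ => ?_
      obtain ⟨b, hb⟩ := hind c h0 i
      rw [hb, zpow_mul, zpow_natCast, Function.comp_apply, ← map_pow, hu i, map_one, one_zpow]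
    exact (QuotientGroup.eq_one_iff g).mp h1
  · rw [Subgroup.zpowers_le]
    exact hτz

/-- A lift of `m` that is killed by the order of `m` has the same order as `m`. -/
lemma orderOf_eq_addOrderOf {τ : G →* Multiplicative M} {g : G} {m : M}
    (h : τ g = Multiplicative.ofAdd m) (hg : g ^ addOrderOf m = 1) :
    orderOf g = addOrderOf m := by
  refine Nat.dvd_antisymm (orderOf_dvd_of_pow_eq_one hg) ?_
  rw [← orderOf_ofAdd_eq_addOrderOf, ← h]
  exact orderOf_map_dvd τ g

/-- Two central extensions of `M` by cyclic groups of the same order with the same commutator form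
are isomorphic if a basis of `M` has lifts of the same orders in both. -/
theorem exists_mulEquiv_of_extensions {G' : Type*} [Group G'] [Fintype ι] {d : ℕ}
    {φ : M → M → ZMod d} {z : G} {z' : G'} {τ : G →* Multiplicative M}
    {τ' : G' →* Multiplicative M}
    (hker : τ.ker = Subgroup.zpowers z) (hker' : τ'.ker = Subgroup.zpowers z')
    (hord : orderOf z = orderOf z')
    (hz : ∀ g : G, z * g = g * z) (hz' : ∀ g : G', z' * g = g * z')
    (hcomm : ∀ g h : G, g * h =
      (z ^ 2) ^ (φ (Multiplicative.toAdd (τ g)) (Multiplicative.toAdd (τ h))).val * (h * g))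
    (hcomm' : ∀ g h : G', g * h =
      (z' ^ 2) ^ (φ (Multiplicative.toAdd (τ' g)) (Multiplicative.toAdd (τ' h))).val * (h * g))
    {u : ι → G} {u' : ι → G'} {D : ι → ℕ} (hu : ∀ i, u i ^ D i = 1) (hu' : ∀ i, u' i ^ D i = 1)
    (huu' : ∀ i, τ (u i) = τ' (u' i))
    (hind : ∀ c : ι → ℤ, ∑ i, c i • Multiplicative.toAdd (τ (u i)) = 0 → ∀ i, (D i : ℤ) ∣ c i)
    (hgen : Subgroup.closure (Set.range fun i => τ (u i)) = ⊤) :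
    ∃ Ψ : G ≃* G', Ψ z = z' ∧ ∀ g, τ' (Ψ g) = τ g := by
  have hτz : τ z = 1 := by
    rw [← MonoidHom.mem_ker, hker]; exact Subgroup.mem_zpowers z
  have hτz' : τ' z' = 1 := by
    rw [← MonoidHom.mem_ker, hker']; exact Subgroup.mem_zpowers z'
  -- `K` will be the graph of the isomorphism: both projections of `K` turn out to be bijective.
  let S : Set (G × G') := insert (z, z') (Set.range fun i => (u i, u' i))
  let K : Subgroup (G × G') := Subgroup.closure S
  have hK : ∀ k ∈ K, τ k.1 = τ' k.2 := by
    have : K ≤ (τ.comp (MonoidHom.fst G G')).eqLocus (τ'.comp (MonoidHom.snd G G')) := by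
      rw [Subgroup.closure_le]
      rintro _ (rfl | ⟨i, rfl⟩)
      · exact hτz.trans hτz'.symm
      · exact huu' i
    exact this
  have hzK : (z, z') ∈ K := Subgroup.subset_closure (Set.mem_insert _ _)
  have huK : ∀ i, (u i, u' i) ∈ K := fun i => Subgroup.subset_closure (Or.inr ⟨i, rfl⟩)
  -- `K` is again generated by a central element and independent lifts of the same orders, so its
  -- elements over 0 are powers of `(z, z')`. As `z` and `z'` have equal orders, both projections
  -- are injective.
  have hkerK : ((τ.comp (MonoidHom.fst G G')).comp K.subtype).ker
      = Subgroup.zpowers (⟨(z, z'), hzK⟩ : K) := by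
    refine ker_eq_zpowers_of_generators (u := fun i => (⟨(u i, u' i), huK i⟩ : K)) (D := D)
      ?_ ?_ ?_ ?_ hτz hind
    · rintro ⟨⟨g, g'⟩, hg⟩
      exact Subtype.ext (Prod.ext (hz g) (hz' g'))
    · rintro ⟨⟨g, g'⟩, hg⟩ ⟨⟨h, h'⟩, hh⟩
      refine ⟨(2 * (φ (Multiplicative.toAdd (τ g)) (Multiplicative.toAdd (τ h))).val : ℕ), ?_⟩
      rw [zpow_natCast, pow_mul]
      refine Subtype.ext (Prod.ext (hcomm g h) ?_)
      have h1 : τ g = τ' g' := hK _ hg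
      have h2 : τ h = τ' h' := hK _ hh
      rw [h1, h2]
      exact hcomm' g' h'
    · intro i
      exact Subtype.ext (Prod.ext (hu i) (hu' i))
    · have : (insert (⟨(z, z'), hzK⟩ : K) (Set.range fun i => (⟨(u i, u' i), huK i⟩ : K)))
          = K.subtype ⁻¹' S := by
        ext ⟨k, hk⟩
        simp [S, Subtype.ext_iff]
      rw [this]
      exact Subgroup.closure_closure_coe_preimage
  have hinj : ∀ k ∈ K, k.1 = 1 → k.2 = 1 := by
    intro k hk h1
    have hmem : (⟨k, hk⟩ : K) ∈ ((τ.comp (MonoidHom.fst G G')).comp K.subtype).ker := by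
      simp [MonoidHom.mem_ker, h1]
    rw [hkerK] at hmem
    obtain ⟨c, hc⟩ := hmem
    have hc' : (z, z') ^ c = k := congrArg Subtype.val hc
    rw [← hc'] at h1 ⊢
    change z ^ c = 1 at h1
    change z' ^ c = 1
    rwa [← orderOf_dvd_iff_zpow_eq_one, ← hord, orderOf_dvd_iff_zpow_eq_one]
  have hinj' : ∀ k ∈ K, k.2 = 1 → k.1 = 1 := by
    intro k hk h1
    have hmem : (⟨k, hk⟩ : K) ∈ ((τ.comp (MonoidHom.fst G G')).comp K.subtype).ker := by
      change τ k.1 = 1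
      rw [hK k hk, h1, map_one]
    rw [hkerK] at hmem
    obtain ⟨c, hc⟩ := hmem
    have hc' : (z, z') ^ c = k := congrArg Subtype.val hc
    rw [← hc'] at h1 ⊢
    change z' ^ c = 1 at h1
    change z ^ c = 1
    rwa [← orderOf_dvd_iff_zpow_eq_one, hord, orderOf_dvd_iff_zpow_eq_one]
  -- `K` covers `M`, and it contains `(z, z')`, whose components generate the two kernels; so both
  -- projections are surjective.
  have himg : ∀ m : Multiplicative M, ∃ k ∈ K, τ k.1 = m := by
    intro m
    have : (⊤ : Subgroup (Multiplicative M)) ≤ K.map (τ.comp (MonoidHom.fst G G')) := by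
      rw [← hgen, Subgroup.closure_le]
      rintro _ ⟨i, rfl⟩
      exact ⟨_, huK i, rfl⟩
    exact this (Subgroup.mem_top m)
  have hsurj : ∀ g, ∃ k ∈ K, k.1 = g := by
    intro g
    obtain ⟨k, hk, hkg⟩ := himg (τ g)
    have : g * k.1⁻¹ ∈ τ.ker := by rw [MonoidHom.mem_ker, map_mul, map_inv, hkg, mul_inv_cancel]
    rw [hker] at this
    obtain ⟨c, hc⟩ := this
    refine ⟨(z, z') ^ c * k, mul_mem (zpow_mem hzK c) hk, ?_⟩
    change z ^ c * k.1 = g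
    rw [show z ^ c = g * k.1⁻¹ from hc, inv_mul_cancel_right]
  have hsurj' : ∀ g, ∃ k ∈ K, k.2 = g := by
    intro g
    obtain ⟨k, hk, hkg⟩ := himg (τ' g)
    rw [hK k hk] at hkg
    have : g * k.2⁻¹ ∈ τ'.ker := by rw [MonoidHom.mem_ker, map_mul, map_inv, hkg, mul_inv_cancel]
    rw [hker'] at this
    obtain ⟨c, hc⟩ := this
    refine ⟨(z, z') ^ c * k, mul_mem (zpow_mem hzK c) hk, ?_⟩
    change z' ^ c * k.2 = g
    rw [show z' ^ c = g * k.2⁻¹ from hc, inv_mul_cancel_right]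
  let e : K ≃* G := MulEquiv.ofBijective ((MonoidHom.fst G G').comp K.subtype) (by
    refine ⟨(injective_iff_map_eq_one _).mpr fun k hk => ?_, fun g => ?_⟩
    · exact Subtype.ext (Prod.ext hk (hinj k.1 k.2 hk))
    · obtain ⟨k, hk, h⟩ := hsurj g
      exact ⟨⟨k, hk⟩, h⟩)
  let e' : K ≃* G' := MulEquiv.ofBijective ((MonoidHom.snd G G').comp K.subtype) (by
    refine ⟨(injective_iff_map_eq_one _).mpr fun k hk => ?_, fun g => ?_⟩
    · exact Subtype.ext (Prod.ext (hinj' k.1 k.2 hk) hk)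
    · obtain ⟨k, hk, h⟩ := hsurj' g
      exact ⟨⟨k, hk⟩, h⟩)
  refine ⟨e.symm.trans e', ?_, fun g => ?_⟩
  · have : e.symm z = ⟨(z, z'), hzK⟩ := by
      rw [MulEquiv.symm_apply_eq]; rfl
    rw [MulEquiv.trans_apply, this]
    rfl
  · obtain ⟨k, rfl⟩ := e.surjective g
    rw [MulEquiv.trans_apply, MulEquiv.symm_apply_apply]
    exact (hK k.1 k.2).symm

end Extensions

/-! ### Non-degenerate alternating forms on finite abelian groups -/

section Symplectic

variable {d : ℕ}

/-- Multiplication by `d / D` kills `D` in `ZMod d`, so it only sees residues mod `D`. This frees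
`sympSumForm` from canonical representatives. -/
lemma divisor_mul_val_intCast {D : ℕ} [NeZero D] (hD : D ∣ d) (j : ℤ) :
    ((d / D : ℕ) : ZMod d) * (((j : ZMod D).val : ℕ) : ZMod d)
      = ((d / D : ℕ) : ZMod d) * (j : ZMod d) := by
  have h1 : (((j : ZMod D).val : ℕ) : ℤ) = j % D := ZMod.val_intCast j
  have h2 : ((((j : ZMod D).val : ℕ) : ℤ) : ZMod d) = ((j % D : ℤ) : ZMod d) := by rw [h1]
  rw [Int.cast_natCast] at h2
  have h3 : ((d / D : ℕ) : ZMod d) * (D : ZMod d) = 0 := by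
    rw [← Nat.cast_mul, Nat.div_mul_cancel hD, ZMod.natCast_self]
  have h4 : (j : ZMod d) = ((D * (j / D) + j % D : ℤ) : ZMod d) := by
    rw [Int.mul_ediv_add_emod]
  rw [h2, h4]
  push_cast
  rw [mul_add, ← mul_assoc, h3, zero_mul, zero_add]

lemma divisor_mul_eq_zero_iff [NeZero d] {D : ℕ} (hD : D ∣ d) (j : ℤ) :
    ((d / D : ℕ) : ZMod d) * (j : ZMod d) = 0 ↔ (D : ℤ) ∣ j := by
  obtain ⟨c, rfl⟩ := hD
  have hpos := NeZero.pos (D * c)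
  have hD0 : 0 < D := Nat.pos_of_mul_pos_right hpos
  have hc : (c : ℤ) ≠ 0 := by
    have := Nat.pos_of_mul_pos_left hpos
    omega
  rw [Nat.mul_div_cancel_left c hD0,
    show ((c : ℕ) : ZMod (D * c)) * (j : ZMod (D * c)) = ((c * j : ℤ) : ZMod (D * c)) by push_cast; rfl,
    ZMod.intCast_zmod_eq_zero_iff_dvd]
  push_cast
  rw [mul_comm (D : ℤ), mul_dvd_mul_iff_left hc]

/-- With `d = D * e`, divisibility of `D * i` by `d` means `e ∣ i`. The resulting `j` are the
coefficients needed to split off a hyperbolic pair. -/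
lemma exists_eq_divisor_mul [NeZero d] {D : ℕ} (hD : D ∣ d) {c : ZMod d} (hc : D • c = 0) :
    ∃ j : ℤ, c = ((d / D : ℕ) : ZMod d) * (j : ZMod d) := by
  obtain ⟨i, rfl⟩ := ZMod.intCast_surjective c
  obtain ⟨e, rfl⟩ := hD
  have hpos := NeZero.pos (D * e)
  have hD0 : 0 < D := Nat.pos_of_mul_pos_right hpos
  have h1 : (((D : ℤ) * i : ℤ) : ZMod (D * e)) = 0 := by
    rw [nsmul_eq_mul] at hc
    exact_mod_cast hc
  rw [ZMod.intCast_zmod_eq_zero_iff_dvd] at h1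
  push_cast at h1
  rw [mul_dvd_mul_iff_left (by omega)] at h1
  obtain ⟨j, rfl⟩ := h1
  refine ⟨j, ?_⟩
  rw [Nat.mul_div_cancel_left e hD0]
  push_cast
  rfl

lemma sympSumForm_intCast {k : ℕ} {D : Fin k → ℕ} [∀ i, NeZero (D i)] (hD : ∀ i, D i ∣ d)
    (b a b' a' : Fin k → ℤ) :
    sympSumForm d D (fun i => ((b i : ZMod (D i)), (a i : ZMod (D i))))
        (fun i => ((b' i : ZMod (D i)), (a' i : ZMod (D i))))
      = ∑ i, ((d / D i : ℕ) : ZMod d) * ((b i * a' i - a i * b' i : ℤ) : ZMod d) := by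
  refine Finset.sum_congr rfl fun i _ => ?_
  rw [← divisor_mul_val_intCast (hD i)]
  push_cast
  rfl

lemma sympSum_exists_intCast {k : ℕ} {D : Fin k → ℕ} (p : SympSum D) :
    ∃ b a : Fin k → ℤ, p = fun i => ((b i : ZMod (D i)), (a i : ZMod (D i))) := by
  choose b hb using fun i => ZMod.intCast_surjective (p i).1
  choose a ha using fun i => ZMod.intCast_surjective (p i).2
  exact ⟨b, a, funext fun i => Prod.ext (hb i).symm (ha i).symm⟩

variable {M : Type*} [AddCommGroup M]

lemma map_swap_of_alternating {φ : M →+ M →+ ZMod d} (halt : ∀ x, φ x x = 0) (x y : M) :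
    φ x y = -φ y x := by
  have h := halt (x + y)
  simp only [map_add, AddMonoidHom.add_apply, halt, zero_add, add_zero] at h
  exact eq_neg_of_add_eq_zero_right h

/-- A hyperbolic pair of maximal order in a subgroup on which the form is non-degenerate. -/
lemma exists_hyperbolic_pair [NeZero d] [Finite M] (φ : M →+ M →+ ZMod d)
    (S : AddSubgroup M) (hS : ∀ x ∈ S, (∀ y ∈ S, φ x y = 0) → x = 0) :
    ∃ r : ℕ, 0 < r ∧ r ∣ d ∧ (∀ s ∈ S, r • s = 0) ∧ (r = 1 → S = ⊥) ∧
      ∃ x ∈ S, ∃ y ∈ S, φ x y = ((d / r : ℕ) : ZMod d) := by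
  -- An element whose order is the exponent `r` of `S`: all of `S` is then killed by the order of
  -- `x`.
  obtain ⟨⟨x, hx⟩, hxr⟩ := AddMonoid.exists_addOrderOf_eq_exponent
    (AddMonoid.ExponentExists.of_finite (G := S))
  set r := AddMonoid.exponent S with hr
  have hr0 : 0 < r := AddMonoid.ExponentExists.of_finite.exponent_pos
  have hkill : ∀ s ∈ S, r • s = 0 := fun s hs =>
    congrArg Subtype.val (AddMonoid.exponent_nsmul_eq_zero (⟨s, hs⟩ : S))
  have hxr' : addOrderOf x = r := by rw [← hxr, AddSubgroup.addOrderOf_mk]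
  -- `a` generates the group of integers whose residues are values of `φ x` on `S`. So `|a|` divides
  -- `d` and is itself a value; it remains to see that `d / |a|` is the order of `x`.
  obtain ⟨a, ha⟩ := Int.subgroup_cyclic ((S.map (φ x)).comap (Int.castAddHom (ZMod d)))
  set A := (S.map (φ x)).comap (Int.castAddHom (ZMod d))
  have hmemA : ∀ j : ℤ, j ∈ A ↔ a ∣ j := fun j => by
    rw [ha, ← AddSubgroup.zmultiples_eq_closure, Int.mem_zmultiples_iff]
  have hrd : r ∣ d := by
    rw [← hxr']
    apply addOrderOf_dvd_of_nsmul_eq_zero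
    refine hS _ (nsmul_mem hx d) fun y _ => ?_
    rw [map_nsmul, AddMonoidHom.nsmul_apply, nsmul_eq_mul, ZMod.natCast_self, zero_mul]
  refine ⟨r, hr0, hrd, hkill, ?_, x, hx, ?_⟩
  · intro h1
    rw [eq_bot_iff]
    intro s hs
    have := hkill s hs
    rwa [h1, one_smul] at this
  have had : (a.natAbs : ℤ) ∣ d := by
    rw [Int.natAbs_dvd, ← hmemA]
    change ((d : ℤ) : ZMod d) ∈ S.map (φ x)
    rw [Int.cast_natCast, ZMod.natCast_self]
    exact zero_mem _
  obtain ⟨c, hc⟩ := Int.natCast_dvd_natCast.mp had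
  have hd0 := NeZero.pos d
  have hg0 : 0 < a.natAbs := by
    rcases Nat.eq_zero_or_pos a.natAbs with h | h
    · rw [h, zero_mul] at hc; omega
    · exact h
  have hgA : (a.natAbs : ℤ) ∈ A := by rw [hmemA, Int.dvd_natAbs]
  obtain ⟨y, hy, hxy⟩ := hgA
  change φ x y = ((a.natAbs : ℤ) : ZMod d) at hxy
  -- All values of `φ x` on `S` are multiples of `|a|` and `c * |a| = d`, so `c • x` is orthogonal
  -- to `S` and vanishes by non-degeneracy.
  have h1 : r ∣ c := by
    rw [← hxr']
    apply addOrderOf_dvd_of_nsmul_eq_zero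
    refine hS _ (nsmul_mem hx c) fun s hs => ?_
    obtain ⟨j, hj⟩ := ZMod.intCast_surjective (φ x s)
    have : j ∈ A := ⟨s, hs, hj.symm⟩
    rw [hmemA, ← Int.natAbs_dvd] at this
    obtain ⟨i, rfl⟩ := this
    rw [map_nsmul, AddMonoidHom.nsmul_apply, ← hj, nsmul_eq_mul]
    push_cast [-Int.natCast_natAbs]
    rw [← mul_assoc, ← Nat.cast_mul, mul_comm c, ← hc, ZMod.natCast_self, zero_mul]
  -- Conversely `r • y = 0` gives `d ∣ r * |a|`, where `d = |a| * c`.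
  have h2 : c ∣ r := by
    have h3 : ((r * a.natAbs : ℕ) : ZMod d) = 0 := by
      have := congrArg (φ x) (hkill y hy)
      rw [map_nsmul, hxy, map_zero, nsmul_eq_mul, Int.cast_natCast] at this
      exact_mod_cast this
    rw [ZMod.natCast_eq_zero_iff] at h3
    rw [mul_comm r] at h3
    conv at h3 => lhs; rw [hc]
    exact (Nat.mul_dvd_mul_iff_left hg0).mp h3
  have h4 : r = c := Nat.dvd_antisymm h1 h2
  refine ⟨y, hy, ?_⟩
  have h5 : d / r = a.natAbs := by
    rw [h4]
    exact Nat.div_eq_of_eq_mul_left (h4 ▸ hr0) hc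
  rw [hxy, h5, Int.cast_natCast]

/-- A symplectic basis of a subgroup on which the alternating form is non-degenerate. -/
lemma exists_symplectic_basis [NeZero d] [Finite M] (φ : M →+ M →+ ZMod d)
    (halt : ∀ x, φ x x = 0) (S : AddSubgroup M)
    (hS : ∀ x ∈ S, (∀ y ∈ S, φ x y = 0) → x = 0) :
    ∃ (k : ℕ) (D : Fin k → ℕ) (x y : Fin k → M), 0 < k ∧ (∀ i, 0 < D i ∧ D i ∣ d) ∧
      (∀ i, D i • x i = 0) ∧ (∀ i, D i • y i = 0) ∧
      (∀ i j, φ (x i) (x j) = 0) ∧ (∀ i j, φ (y i) (y j) = 0) ∧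
      (∀ i j, φ (x i) (y j) = if i = j then ((d / D i : ℕ) : ZMod d) else 0) ∧
      AddSubgroup.closure (Set.range x ∪ Set.range y) = S := by
  induction S using WellFoundedLT.induction with | ind S ih => ?_
  obtain ⟨r, hr0, hrd, hkill, hr1, x₀, hx₀, y₀, hy₀, hxy⟩ := exists_hyperbolic_pair φ S hS
  by_cases h1 : r = 1
  -- Here `S` is trivial; one summand with `D = 1` keeps `k` positive, and `d / 1` vanishes in `ZMod
  -- d`.
  · refine ⟨1, fun _ => 1, fun _ => 0, fun _ => 0, one_pos, fun _ => ⟨one_pos, one_dvd d⟩,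
      by simp, by simp, by simp, by simp, fun i j => ?_, ?_⟩
    · rw [if_pos (Subsingleton.elim i j), Nat.div_one, ZMod.natCast_self, map_zero]
    · rw [hr1 h1]
      simp
  have hyx : φ y₀ x₀ = -((d / r : ℕ) : ZMod d) := by rw [map_swap_of_alternating halt, hxy]
  let S' : AddSubgroup M := S ⊓ ((φ x₀).ker ⊓ (φ y₀).ker)
  have hlt : S' < S := by
    refine lt_of_le_of_ne inf_le_left fun h => ?_
    have hmem : x₀ ∈ S' := h ▸ hx₀
    have h0 : φ y₀ x₀ = 0 := hmem.2.2
    rw [hyx, neg_eq_zero] at h0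
    have h2 := (divisor_mul_eq_zero_iff hrd 1).mp (by rw [h0, zero_mul])
    exact h1 (by exact_mod_cast Int.eq_one_of_dvd_one (by omega) h2)
  -- Orthogonal projection along the hyperbolic pair. As `r` kills `S`, both pairings of `s` with
  -- the pair are multiples of `d / r`, and these multiples are the coefficients.
  have hdec : ∀ s ∈ S, ∃ α β : ℤ, s + α • x₀ - β • y₀ ∈ S' := by
    intro s hs
    obtain ⟨α, hα⟩ := exists_eq_divisor_mul (d := d) hrd (c := φ y₀ s)
      (by rw [← map_nsmul, hkill s hs, map_zero])
    obtain ⟨β, hβ⟩ := exists_eq_divisor_mul (d := d) hrd (c := φ x₀ s)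
      (by rw [← map_nsmul, hkill s hs, map_zero])
    have hmem : s + α • x₀ - β • y₀ ∈ S :=
      sub_mem (add_mem hs (zsmul_mem hx₀ α)) (zsmul_mem hy₀ β)
    refine ⟨α, β, hmem, ?_, ?_⟩
    · change φ x₀ _ = 0
      rw [map_sub, map_add, map_zsmul, map_zsmul, halt, hβ, hxy, zsmul_eq_mul, zsmul_eq_mul]
      ring
    · change φ y₀ _ = 0
      rw [map_sub, map_add, map_zsmul, map_zsmul, halt, hα, hyx, zsmul_eq_mul, zsmul_eq_mul]
      ring
  -- An element of `S'` pairs with `s` as it does with the projection of `s`, so non-degeneracy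
  -- passes to `S'`.
  have hS' : ∀ x ∈ S', (∀ y ∈ S', φ x y = 0) → x = 0 := by
    intro t ht hort
    refine hS t ht.1 fun s hs => ?_
    obtain ⟨α, β, hs'⟩ := hdec s hs
    have h2 := hort _ hs'
    have h3 : φ t x₀ = 0 := by
      rw [map_swap_of_alternating halt, show φ x₀ t = 0 from ht.2.1, neg_zero]
    have h4 : φ t y₀ = 0 := by
      rw [map_swap_of_alternating halt, show φ y₀ t = 0 from ht.2.2, neg_zero]
    rwa [map_sub, map_add, map_zsmul, map_zsmul, h3, h4, smul_zero, smul_zero, add_zero,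
      sub_zero] at h2
  obtain ⟨k, D, x, y, -, hD, hDx, hDy, hxx, hyy, hxy', hcl⟩ := ih S' hlt hS'
  have hxS : ∀ i, x i ∈ S' := fun i => hcl ▸ AddSubgroup.subset_closure (G := M) (Or.inl ⟨i, rfl⟩)
  have hyS : ∀ i, y i ∈ S' := fun i => hcl ▸ AddSubgroup.subset_closure (Or.inr ⟨i, rfl⟩)
  have hzero : ∀ u v, φ u v = 0 → φ v u = 0 := fun u v h => by
    rw [map_swap_of_alternating halt, h, neg_zero]
  refine ⟨k + 1, Fin.cons r D, Fin.cons x₀ x, Fin.cons y₀ y, Nat.succ_pos k, ?_, ?_, ?_, ?_, ?_,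
    ?_, ?_⟩
  · exact Fin.cases ⟨hr0, hrd⟩ hD
  · exact Fin.cases (hkill x₀ hx₀) hDx
  · exact Fin.cases (hkill y₀ hy₀) hDy
  · refine Fin.cases (Fin.cases (halt x₀) fun j => (hxS j).2.1) fun i => Fin.cases ?_ fun j => hxx i j
    exact hzero _ _ (hxS i).2.1
  · refine Fin.cases (Fin.cases (halt y₀) fun j => (hyS j).2.2) fun i => Fin.cases ?_ fun j => hyy i j
    exact hzero _ _ (hyS i).2.2
  · refine Fin.cases (Fin.cases ?_ fun j => ?_) fun i => Fin.cases ?_ fun j => ?_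
    · simpa using hxy
    · rw [if_neg (Fin.succ_ne_zero j).symm]
      exact (hyS j).2.1
    · rw [if_neg (Fin.succ_ne_zero i)]
      exact hzero _ _ (hxS i).2.2
    · simpa using hxy' i j
  · apply le_antisymm
    · rw [AddSubgroup.closure_le]
      rintro _ (⟨i, rfl⟩ | ⟨i, rfl⟩)
      · exact Fin.cases (motive := fun i => Fin.cons (α := fun _ => M) x₀ x i ∈ S) hx₀
          (fun i => (hxS i).1) i
      · exact Fin.cases (motive := fun i => Fin.cons (α := fun _ => M) y₀ y i ∈ S) hy₀
          (fun i => (hyS i).1) i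
    · intro s hs
      obtain ⟨α, β, hs'⟩ := hdec s hs
      have hle : S' ≤ AddSubgroup.closure (Set.range (Fin.cons x₀ x : Fin (k + 1) → M)
          ∪ Set.range (Fin.cons y₀ y : Fin (k + 1) → M)) := by
        rw [← hcl]
        refine AddSubgroup.closure_mono (G := M) (Set.union_subset_union ?_ ?_)
        · rintro _ ⟨i, rfl⟩; exact ⟨i.succ, rfl⟩
        · rintro _ ⟨i, rfl⟩; exact ⟨i.succ, rfl⟩
      have hx₁ : x₀ ∈ AddSubgroup.closure (Set.range (Fin.cons x₀ x : Fin (k + 1) → M)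
          ∪ Set.range (Fin.cons y₀ y : Fin (k + 1) → M)) :=
        AddSubgroup.subset_closure (Or.inl ⟨0, rfl⟩)
      have hy₁ : y₀ ∈ AddSubgroup.closure (Set.range (Fin.cons x₀ x : Fin (k + 1) → M)
          ∪ Set.range (Fin.cons y₀ y : Fin (k + 1) → M)) :=
        AddSubgroup.subset_closure (Or.inr ⟨0, rfl⟩)
      have h5 : s = (s + α • x₀ - β • y₀) - α • x₀ + β • y₀ := by abel
      rw [h5]
      exact add_mem (sub_mem (hle hs') (zsmul_mem hx₁ α)) (zsmul_mem hy₁ β)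

/-- A finite group with a non-degenerate alternating `ℤ/d`-valued form is an orthogonal sum of
elementary symplectic modules. -/
theorem exists_symplectic_decomposition [NeZero d] [Finite M] (φ : M →+ M →+ ZMod d)
    (halt : ∀ x, φ x x = 0) (hnd : ∀ x, (∀ y, φ x y = 0) → x = 0) :
    ∃ (k : ℕ) (D : Fin k → ℕ), 0 < k ∧ (∀ i, 0 < D i ∧ D i ∣ d) ∧
      ∃ e : M ≃+ SympSum D, ∀ x y, sympSumForm d D (e x) (e y) = φ x y := by
  obtain ⟨k, D, x, y, hk, hD, hDx, hDy, hxx, hyy, hxy, hcl⟩ :=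
    exists_symplectic_basis φ halt ⊤ fun x _ h => hnd x fun y => h y trivial
  have hD0 : ∀ i, NeZero (D i) := fun i => ⟨(hD i).1.ne'⟩
  have hDd : ∀ i, D i ∣ d := fun i => (hD i).2
  let f : SympSum D →+ M := ∑ i,
    ((ZMod.lift (D i) ⟨zmultiplesHom M (x i), by simpa using hDx i⟩).coprod
      (ZMod.lift (D i) ⟨zmultiplesHom M (y i), by simpa using hDy i⟩)).comp
      (Pi.evalAddMonoidHom _ i)
  have hf : ∀ b a : Fin k → ℤ, f (fun i => ((b i : ZMod (D i)), (a i : ZMod (D i))))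
      = ∑ i, (b i • x i + a i • y i) := by
    intro b a
    simp [f, AddMonoidHom.finsetSum_apply]
  have hyx : ∀ i j, φ (y i) (x j) = if i = j then -((d / D i : ℕ) : ZMod d) else 0 := by
    intro i j
    rw [map_swap_of_alternating halt, hxy]
    by_cases h : i = j
    · subst h; simp
    · simp [h, Ne.symm h]
  have hform : ∀ p q, sympSumForm d D p q = φ (f p) (f q) := by
    intro p q
    obtain ⟨b, a, rfl⟩ := sympSum_exists_intCast p
    obtain ⟨b', a', rfl⟩ := sympSum_exists_intCast q
    rw [sympSumForm_intCast hDd, hf, hf]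
    simp only [map_sum, AddMonoidHom.finsetSum_apply, map_add, AddMonoidHom.add_apply, map_zsmul,
      AddMonoidHom.zsmul_apply, hxx, hyy, hxy, hyx, smul_zero, zero_add, add_zero, smul_ite]
    refine Finset.sum_congr rfl fun i _ => ?_
    rw [Finset.sum_ite_eq', Finset.sum_ite_eq']
    simp only [Finset.mem_univ, if_true, zsmul_eq_mul]
    push_cast
    ring
  -- The standard form is non-degenerate: pairing with the basis vectors shows that `D i` divides
  -- both coefficients in each summand. Since `f` respects the forms, its kernel is zero.
  have hinj : Function.Injective f := by
    rw [injective_iff_map_eq_zero]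
    intro p hp
    have h0 : ∀ q, sympSumForm d D p q = 0 := fun q => by rw [hform, hp, map_zero]; rfl
    obtain ⟨b, a, rfl⟩ := sympSum_exists_intCast p
    funext i
    have h1 := h0 (fun j => (((0 : ℤ) : ZMod (D j)), (((Pi.single i 1 : Fin k → ℤ) j : ℤ) : ZMod (D j))))
    have h2 := h0 (fun j => ((((Pi.single i 1 : Fin k → ℤ) j : ℤ) : ZMod (D j)), ((0 : ℤ) : ZMod (D j))))
    rw [sympSumForm_intCast hDd b a (fun _ => 0) (Pi.single i 1)] at h1
    rw [sympSumForm_intCast hDd b a (Pi.single i 1) (fun _ => 0)] at h2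
    rw [Finset.sum_eq_single i (fun j _ hj => by simp [hj]) (by simp), Pi.single_eq_same,
      divisor_mul_eq_zero_iff (hDd i)] at h1 h2
    refine Prod.ext ((ZMod.intCast_zmod_eq_zero_iff_dvd _ _).mpr ?_)
      ((ZMod.intCast_zmod_eq_zero_iff_dvd _ _).mpr ?_)
    · simpa using h1
    · simpa using h2
  have hsurj : Function.Surjective f := by
    intro m
    have hm : m ∈ AddSubgroup.closure (Set.range (Sum.elim x y)) := by
      rw [Set.Sum.elim_range, hcl]; trivial
    obtain ⟨c, rfl⟩ := AddSubgroup.exists_of_mem_closure_range _ _ hm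
    refine ⟨_, (hf (fun i => c (Sum.inl i)) (fun i => c (Sum.inr i))).trans ?_⟩
    rw [Fintype.sum_sum_type, Finset.sum_add_distrib]
    rfl
  let e : SympSum D ≃+ M := AddEquiv.ofBijective f ⟨hinj, hsurj⟩
  refine ⟨k, D, hk, hD, e.symm, fun m m' => ?_⟩
  rw [hform]
  exact congrArg₂ (fun u v => φ u v) (e.apply_symm_apply m) (e.apply_symm_apply m')

end Symplectic

/-! ### Powers of products with central commutators -/

section Lifts

variable {G : Type*} [Group G]

/-- Reordering takes `N * (N + 1) / 2` exchanges, each contributing `c ^ (2 * f)`. Since commutators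
are even powers of `c`, the total factor is an `(N + 1)`-th power and can be absorbed into the base
`A * B`. -/
lemma pow_mul_pow_of_commutator {A B c : G} (hcA : Commute c A) (hcB : Commute c B) {f : ℕ}
    (h : A * B = (c ^ 2) ^ f * (B * A)) (N : ℕ) :
    A ^ (N + 1) * B ^ (N + 1) = (c ^ (f * N)) ^ (N + 1) * (A * B) ^ (N + 1) := by
  have hcAB : Commute c (A * B) := hcA.mul_right hcB
  have hs : SemiconjBy A (A * B) ((c ^ 2) ^ f * (A * B)) := by
    change A * (A * B) = (c ^ 2) ^ f * (A * B) * A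
    conv_lhs => rw [h]
    rw [← mul_assoc, ← (((hcA.pow_left 2).pow_left f)).eq]
    simp only [mul_assoc]
  induction N with
  | zero => simp
  | succ N ih =>
    have h1 : A * (A * B) ^ (N + 1) = (c ^ 2) ^ (f * (N + 1)) * ((A * B) ^ (N + 1) * A) := by
      rw [(hs.pow_right (N + 1)).eq, (((hcAB.pow_left 2).pow_left f)).mul_pow, ← pow_mul, mul_assoc]
    have h2 : A * (c ^ (f * N)) ^ (N + 1) = (c ^ (f * N)) ^ (N + 1) * A :=
      (((hcA.pow_left (f * N)).pow_left (N + 1))).eq.symm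
    calc A ^ (N + 1 + 1) * B ^ (N + 1 + 1)
        = A * (A ^ (N + 1) * B ^ (N + 1)) * B := by
          rw [pow_succ' A, pow_succ B]; simp only [mul_assoc]
      _ = (A * (c ^ (f * N)) ^ (N + 1)) * (A * B) ^ (N + 1) * B := by
          rw [ih]; simp only [mul_assoc]
      _ = (c ^ (f * N)) ^ (N + 1) * (A * (A * B) ^ (N + 1)) * B := by
          rw [h2]; simp only [mul_assoc]
      _ = ((c ^ (f * N)) ^ (N + 1) * (c ^ 2) ^ (f * (N + 1))) * ((A * B) ^ (N + 1) * (A * B)) := by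
          rw [h1]; simp only [mul_assoc]
      _ = _ := by
          rw [← pow_succ, ← pow_mul, ← pow_mul, ← pow_mul, ← pow_add]
          congr 2
          ring

/-- Take the product of the `w r ^ (b r).val` in the abelian subgroup that the `w r` generate: if `N
• b = 0`, all exponents of its `N`-th power are multiples of `d`. It is applied to the `Z`-type and
the `X`-type operators separately. -/
lemma exists_lift_of_commuting {M : Type*} [AddCommGroup M] {n d : ℕ} [NeZero d]
    (τ : G →* Multiplicative M) {w : Fin n → G} (hw : ∀ r s, w r * w s = w s * w r)
    (hd : ∀ r, w r ^ d = 1) (b : Fin n → ZMod d) :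
    ∃ A : G, Multiplicative.toAdd (τ A) = ∑ r, (b r).val • Multiplicative.toAdd (τ (w r)) ∧
      ∀ N : ℕ, N • b = 0 → A ^ N = 1 := by
  let K := Subgroup.closure (Set.range w)
  have hK : IsMulCommutative K := Subgroup.isMulCommutative_closure (by
    rintro _ ⟨r, rfl⟩ _ ⟨s, rfl⟩
    exact hw r s)
  let _ : CommGroup K := { (inferInstance : Group K) with mul_comm := hK.is_comm.comm }
  let v : Fin n → K := fun r => ⟨w r, Subgroup.subset_closure ⟨r, rfl⟩⟩
  refine ⟨((∏ r, v r ^ (b r).val : K) : G), ?_, fun N hN => ?_⟩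
  · change Multiplicative.toAdd ((τ.comp K.subtype) (∏ r, v r ^ (b r).val)) = _
    rw [map_prod, toAdd_prod]
    refine Finset.sum_congr rfl fun r _ => ?_
    rw [map_pow, toAdd_pow]
    rfl
  · have h1 : (∏ r, v r ^ (b r).val) ^ N = 1 := by
      rw [← Finset.prod_pow]
      refine Finset.prod_eq_one fun r _ => ?_
      have h2 : ((b r).val * N : ℕ) = (0 : ZMod d) := by
        have := congrFun hN r
        rw [Pi.smul_apply, nsmul_eq_mul] at this
        push_cast
        rw [ZMod.natCast_zmod_val, mul_comm]
        exact this
      obtain ⟨e, he⟩ := (ZMod.natCast_eq_zero_iff _ _).mp h2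
      rw [← pow_mul, he, pow_mul]
      have h3 : v r ^ d = 1 := Subtype.ext (hd r)
      rw [h3, one_pow]
    exact congrArg Subtype.val h1

end Lifts

/-! ### Groups generated by Pauli operators and a scalar -/

section Generated

variable {V : Type*} [AddCommGroup V] [Module ℂ V] {n d : ℕ} {ξ : ℂˣ}

lemma CommBy.symm [NeZero d] (hξ : ξ ^ d = 1) {j : ZMod d} {g Y : V ≃ₗ[ℂ] V}
    (h : CommBy ξ j g Y) : CommBy ξ (-j) Y g := by
  unfold CommBy at *
  rw [h, ← mul_assoc, ← map_mul, ← pow_val_add hξ]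
  simp

lemma pauliForm_single_left {m : PauliMod n d} (r : Fin n) (p : ZMod d × ZMod d) :
    pauliForm (Pi.single r p) m = p.1 * (m r).2 - p.2 * (m r).1 := by
  unfold pauliForm
  rw [Finset.sum_eq_single r (fun s _ hs => by simp [hs]) (by simp), Pi.single_eq_same]

lemma pauliForm_single_right {m : PauliMod n d} (r : Fin n) (p : ZMod d × ZMod d) :
    pauliForm m (Pi.single r p) = (m r).1 * p.2 - (m r).2 * p.1 := by
  rw [pauliForm_swap, pauliForm_single_left]
  ring

lemma pauliForm_add_right (a b c : PauliMod n d) :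
    pauliForm a (b + c) = pauliForm a b + pauliForm a c := by
  rw [pauliForm_swap, pauliForm_add_left, pauliForm_swap b, pauliForm_swap c]
  ring

lemma le_perp_perp (N : AddSubgroup (PauliMod n d)) : N ≤ perp (perp N) := by
  intro x hx y hy
  rw [pauliForm_swap, hy x hx, neg_zero]

lemma eq_zero_of_pauliForm_eq_zero {m : PauliMod n d} (h : ∀ x, pauliForm m x = 0) : m = 0 := by
  funext r
  have h1 := h (Pi.single r (0, 1))
  have h2 := h (Pi.single r (1, 0))
  rw [pauliForm_single_right] at h1 h2
  exact Prod.ext (by simpa using h1) (by simpa using h2)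

/-- `P` is generated by Pauli operators `x r`, `z r` and by a scalar `c = ζ`; the homomorphism `τ`
reads off how the elements of `P` commute with these operators. -/
structure IsPauliGenerated (ζ : ℂˣ) (P : Subgroup (V ≃ₗ[ℂ] V)) (x z : Fin n → P) (c : P)
    (τ : P →* Multiplicative (PauliMod n d)) : Prop where
  closure_eq : Subgroup.closure (insert c (Set.range (Sum.elim z x))) = ⊤
  coe_c : (c : V ≃ₗ[ℂ] V) = scal V ζ
  x_pow : ∀ r, x r ^ d = 1
  z_pow : ∀ r, z r ^ d = 1
  τ_c : τ c = 1
  τ_x : ∀ r, τ (x r) = Multiplicative.ofAdd (Pi.single r (0, 1))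
  τ_z : ∀ r, τ (z r) = Multiplicative.ofAdd (Pi.single r (1, 0))
  commBy_x : ∀ g r, CommBy ξ (Multiplicative.toAdd (τ g) r).1 (g : V ≃ₗ[ℂ] V) (x r : V ≃ₗ[ℂ] V)
  commBy_z : ∀ g r, CommBy ξ (-(Multiplicative.toAdd (τ g) r).2) (g : V ≃ₗ[ℂ] V)
    (z r : V ≃ₗ[ℂ] V)

namespace IsPauliGenerated

variable {ζ : ℂˣ} {P : Subgroup (V ≃ₗ[ℂ] V)} {x z : Fin n → P} {c : P}
  {τ : P →* Multiplicative (PauliMod n d)}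

lemma c_comm (h : IsPauliGenerated (ξ := ξ) ζ P x z c τ) (g : P) : c * g = g * c :=
  Subtype.ext (by rw [Subgroup.coe_mul, Subgroup.coe_mul, h.coe_c, scal_comm])

variable [NeZero d]

/-- Induction on `g` over the generators. For a generator, the commutation relation of `k` with it
is reversed; products and inverses follow from additivity of the form. -/
lemma commBy (h : IsPauliGenerated (ξ := ξ) ζ P x z c τ) (hξ : ξ ^ d = 1) (g k : P) :
    CommBy ξ (pauliForm (Multiplicative.toAdd (τ g)) (Multiplicative.toAdd (τ k)))
      (g : V ≃ₗ[ℂ] V) (k : V ≃ₗ[ℂ] V) := by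
  have hg : g ∈ Subgroup.closure (insert c (Set.range (Sum.elim z x))) :=
    h.closure_eq ▸ Subgroup.mem_top g
  have hzero : pauliForm (0 : PauliMod n d) (Multiplicative.toAdd (τ k)) = 0 := by
    simp [pauliForm]
  induction hg using Subgroup.closure_induction with
  | mem g hg =>
    rcases hg with rfl | ⟨r | r, rfl⟩
    · rw [h.τ_c, toAdd_one, hzero, h.coe_c]
      exact CommBy.of_commute (scal_comm _ _)
    · have := (h.commBy_z k r).symm hξ
      rw [Sum.elim_inl, h.τ_z, toAdd_ofAdd, pauliForm_single_left]
      simpa using this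
    · have := (h.commBy_x k r).symm hξ
      rw [Sum.elim_inr, h.τ_x, toAdd_ofAdd, pauliForm_single_left]
      simpa using this
  | one =>
    rw [map_one, toAdd_one, hzero]
    exact CommBy.of_commute (by simp)
  | mul a b _ _ ha hb =>
    rw [map_mul, toAdd_mul, pauliForm_add_left]
    exact ha.mul_left hξ hb
  | inv a _ ha =>
    have h1 : pauliForm (-Multiplicative.toAdd (τ a)) (Multiplicative.toAdd (τ k))
        = -pauliForm (Multiplicative.toAdd (τ a)) (Multiplicative.toAdd (τ k)) := by
      rw [eq_neg_iff_add_eq_zero, ← pauliForm_add_left, neg_add_cancel, hzero]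
    rw [map_inv, toAdd_inv, h1]
    exact ha.inv_left hξ

lemma commutator (h : IsPauliGenerated (ξ := ξ) ζ P x z c τ) (hξ : ξ ^ d = 1) {a : ℕ}
    (hζξ : ξ = ζ ^ a) (g k : P) :
    g * k = (c ^ a) ^ (pauliForm (Multiplicative.toAdd (τ g)) (Multiplicative.toAdd (τ k))).val
      * (k * g) := by
  have h1 := h.commBy hξ g k
  unfold CommBy at h1
  refine Subtype.ext ?_
  rw [Subgroup.coe_mul, h1, hζξ, map_pow, map_pow, ← h.coe_c]
  rfl

lemma ker_eq (h : IsPauliGenerated (ξ := ξ) ζ P x z c τ) (hξ : ξ ^ d = 1) {a : ℕ}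
    (hζξ : ξ = ζ ^ a) : τ.ker = Subgroup.zpowers c := by
  refine ker_eq_zpowers_of_generators (u := Sum.elim z x) (D := fun _ => d) h.c_comm
    (fun g k => ⟨_, (h.commutator hξ hζξ g k).trans
      (by rw [← pow_mul, ← zpow_natCast])⟩) ?_ h.closure_eq h.τ_c ?_
  · rintro (r | r)
    · exact h.z_pow r
    · exact h.x_pow r
  · intro e he
    simp only [Fintype.sum_sum_type, Sum.elim_inl, Sum.elim_inr, h.τ_x, h.τ_z, toAdd_ofAdd] at he
    rintro (r | r)
    · have := congrArg Prod.fst (congrFun he r)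
      simp [Pi.single_apply, Finset.sum_apply] at this
      rwa [ZMod.intCast_zmod_eq_zero_iff_dvd] at this
    · have := congrArg Prod.snd (congrFun he r)
      simp [Pi.single_apply, Finset.sum_apply] at this
      rwa [ZMod.intCast_zmod_eq_zero_iff_dvd] at this

/-- Every element of the symplectic module has a lift of the same order. -/
lemma exists_lift (h : IsPauliGenerated (ξ := ζ ^ 2) ζ P x z c τ) (hξ : (ζ ^ 2) ^ d = 1)
    (hxx : ∀ r s, x r * x s = x s * x r) (hzz : ∀ r s, z r * z s = z s * z r)
    (m : PauliMod n d) :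
    ∃ g : P, τ g = Multiplicative.ofAdd m ∧ orderOf g = addOrderOf m := by
  obtain ⟨A, hA, hAN⟩ := exists_lift_of_commuting τ hzz h.z_pow fun r => (m r).1
  obtain ⟨B, hB, hBN⟩ := exists_lift_of_commuting τ hxx h.x_pow fun r => (m r).2
  have hτ : Multiplicative.toAdd (τ A) + Multiplicative.toAdd (τ B) = m := by
    rw [hA, hB]
    funext r
    simp only [h.τ_x, h.τ_z, toAdd_ofAdd]
    simp only [← Pi.single_smul, Finset.univ_sum_single, Pi.add_apply, Prod.smul_mk, smul_zero,
      nsmul_one, ZMod.natCast_zmod_val, Prod.mk_add_mk, add_zero, zero_add]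
  -- `A` and `B` lift the two halves of `m`, so the order `N + 1` of `m` kills both, but not
  -- necessarily `A * B`.
  obtain ⟨N, hN⟩ : ∃ N, addOrderOf m = N + 1 := Nat.exists_eq_add_one.mpr (addOrderOf_pos m)
  have hNm : (N + 1) • m = 0 := hN ▸ addOrderOf_nsmul_eq_zero m
  have h1 := h.commutator hξ rfl A B
  have h2 := pow_mul_pow_of_commutator (h.c_comm A) (h.c_comm B) h1 N
  rw [hAN _ (funext fun r => congrArg Prod.fst (congrFun hNm r)),
    hBN _ (funext fun r => congrArg Prod.snd (congrFun hNm r)), one_mul] at h2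
  set f := (pauliForm (Multiplicative.toAdd (τ A)) (Multiplicative.toAdd (τ B))).val
  -- The scalar `c ^ (f * N)` corrects this: the `(N + 1)`-th power becomes `A ^ (N + 1) * B ^ (N +
  -- 1) = 1`.
  have h3 : τ (c ^ (f * N) * (A * B)) = Multiplicative.ofAdd m := by
    rw [map_mul, map_mul, map_pow, h.τ_c, one_pow, one_mul, ← hτ]
    rfl
  refine ⟨_, h3, orderOf_eq_addOrderOf h3 ?_⟩
  have h4 : Commute (c ^ (f * N)) (A * B) :=
    Commute.pow_left (Commute.mul_right (h.c_comm A) (h.c_comm B)) _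
  rw [hN, h4.mul_pow, ← h2]

end IsPauliGenerated

/-- An operator that commutes with an invertible one up to a non-trivial scalar has trace zero. -/
lemma CommBy.trace_eq_zero [NeZero d] (hξ : IsPrimitiveRoot ξ d) {j : ZMod d}
    (hj : j ≠ 0) {g Y : V ≃ₗ[ℂ] V} (h : CommBy ξ j g Y) :
    LinearMap.trace ℂ V (g : V →ₗ[ℂ] V) = 0 := by
  -- Cyclicity of the trace turns the commutation relation into `tr g = ξ ^ j · tr g`.
  have h1 : LinearMap.trace ℂ V ((g * Y * Y⁻¹ : V ≃ₗ[ℂ] V) : V →ₗ[ℂ] V)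
      = ((ξ ^ j.val : ℂˣ) : ℂ) * LinearMap.trace ℂ V (g : V →ₗ[ℂ] V) := by
    have h2 : ((g * Y * Y⁻¹ : V ≃ₗ[ℂ] V) : V →ₗ[ℂ] V)
        = ((ξ ^ j.val : ℂˣ) : ℂ) • ((Y : V →ₗ[ℂ] V) * ((g * Y⁻¹ : V ≃ₗ[ℂ] V) : V →ₗ[ℂ] V)) := by
      unfold CommBy at h
      rw [h]
      rfl
    have h3 : ((g * Y⁻¹ : V ≃ₗ[ℂ] V) : V →ₗ[ℂ] V) * (Y : V →ₗ[ℂ] V) = (g : V →ₗ[ℂ] V) := by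
      ext v
      exact congrArg g (Y.symm_apply_apply v)
    rw [h2, map_smul, smul_eq_mul, LinearMap.trace_mul_comm, h3]
  rw [mul_inv_cancel_right] at h1
  have h4 : ((ξ ^ j.val : ℂˣ) : ℂ) ≠ 1 := by
    intro h5
    have h6 : ξ ^ j.val = 1 := Units.ext h5
    rw [hξ.pow_eq_one_iff_dvd] at h6
    exact hj ((ZMod.val_eq_zero j).mp (Nat.eq_zero_of_dvd_of_lt h6 (ZMod.val_lt j)))
  have h5 : (((ξ ^ j.val : ℂˣ) : ℂ) - 1) * LinearMap.trace ℂ V (g : V →ₗ[ℂ] V) = 0 := by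
    rw [sub_mul, ← h1, one_mul, sub_self]
  exact (mul_eq_zero.mp h5).resolve_left (sub_ne_zero.mpr h4)

end Generated

lemma opX_pow_apply (d j : ℕ) (v : Qudit d) (i : ZMod d) : (opX d ^ j) v i = v (i - j) := by
  induction j generalizing i with
  | zero => simp
  | succ j ih =>
    rw [pow_succ', LinearEquiv.mul_apply, opX_apply, ih]
    push_cast
    congr 1
    ring

lemma opX_pow_self (d : ℕ) : opX d ^ d = 1 := by
  apply LinearEquiv.ext
  intro v
  funext i
  rw [opX_pow_apply]
  simp

lemma opZ_pow_self {d : ℕ} {ξ : ℂˣ} (hξ : ξ ^ d = 1) : opZ d ξ ^ d = 1 := by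
  rw [← opZ_pow, hξ]
  apply LinearEquiv.ext
  intro v
  funext i
  simp [opZ_apply]

/-! ### The Pauli group as a Heisenberg extension of `PauliMod n d` -/

section PauliGroup

variable {n d : ℕ} [NeZero d] {ζ : ℂˣ}

lemma isPauliGenerated_pauliGroup (hζ : IsPrimitiveRoot ζ (dbar d)) :
    IsPauliGenerated (ξ := ζ ^ 2) ζ (pauliGroup n d ζ) (pauliX n d ζ) (pauliZ n d ζ)
      (pauliZeta n d ζ) (tau hζ) where
  closure_eq := by
    have : insert (pauliZeta n d ζ) (Set.range (Sum.elim (pauliZ n d ζ) (pauliX n d ζ)))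
        = (pauliGroup n d ζ).subtype ⁻¹'
          (Set.range (opXr n d) ∪ Set.range (opZr n d (ζ ^ 2)) ∪ {scal _ ζ}) := by
      ext ⟨k, hk⟩
      simp [Subtype.ext_iff, pauliX, pauliZ, pauliZeta, or_comm, or_assoc]
    rw [this]
    exact Subgroup.closure_closure_coe_preimage
  coe_c := rfl
  x_pow r := Subtype.ext (by
    change opXr n d r ^ d = 1
    rw [opXr, ← map_pow, ← Pi.mulSingle_pow, opX_pow_self, Pi.mulSingle_one, map_one])
  z_pow r := Subtype.ext (by
    change opZr n d (ζ ^ 2) r ^ d = 1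
    rw [opZr, ← map_pow, ← Pi.mulSingle_pow, opZ_pow_self (dbar_pow hζ).pow_eq_one,
      Pi.mulSingle_one, map_one])
  τ_c := tau_pauliZeta hζ
  τ_x := tau_pauliX hζ
  τ_z := tau_pauliZ hζ
  commBy_x g r := (exists_commBy_X (dbar_pow hζ).pow_eq_one r g g.2).choose_spec
  commBy_z g r := by
    have h := (exists_commBy_Z (dbar_pow hζ).pow_eq_one r g g.2).choose_spec
    rw [← neg_neg (Exists.choose _)] at h
    exact h

lemma tau_exists_lift (hζ : IsPrimitiveRoot ζ (dbar d)) (m : PauliMod n d) :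
    ∃ g : pauliGroup n d ζ, tau hζ g = Multiplicative.ofAdd m ∧ orderOf g = addOrderOf m :=
  (isPauliGenerated_pauliGroup hζ).exists_lift (dbar_pow hζ).pow_eq_one
    (fun r s => Subtype.ext (commute_X_X r s)) (fun r s => Subtype.ext (commute_Z_Z _ r s)) m

lemma tau_ker (hζ : IsPrimitiveRoot ζ (dbar d)) :
    (tau (n := n) hζ).ker = Subgroup.zpowers (pauliZeta n d ζ) :=
  (isPauliGenerated_pauliGroup hζ).ker_eq (dbar_pow hζ).pow_eq_one rfl

lemma pauli_commutator (hζ : IsPrimitiveRoot ζ (dbar d)) (g h : pauliGroup n d ζ) :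
    g * h = (pauliZeta n d ζ ^ 2) ^
      (pauliForm (Multiplicative.toAdd (tau hζ g)) (Multiplicative.toAdd (tau hζ h))).val
        * (h * g) :=
  (isPauliGenerated_pauliGroup hζ).commutator (dbar_pow hζ).pow_eq_one rfl g h

lemma dbar_pos : 0 < dbar d := by
  have := NeZero.pos d
  unfold dbar
  split_ifs <;> omega

lemma orderOf_pauliZeta (hζ : IsPrimitiveRoot ζ (dbar d)) :
    orderOf (pauliZeta n d ζ) = dbar d := by
  rw [hζ.eq_orderOf, ← Subgroup.orderOf_coe]
  exact orderOf_injective (scal (NQudits n d)) (scal_injective _) ζ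

lemma pauliZeta_sq_pow_eq_one_iff (hζ : IsPrimitiveRoot ζ (dbar d)) (j : ZMod d) :
    (pauliZeta n d ζ ^ 2) ^ j.val = 1 ↔ j = 0 := by
  have h1 : (pauliZeta n d ζ ^ 2) ^ j.val = 1 ↔ (ζ ^ 2) ^ j.val = 1 := by
    rw [← pow_mul, ← pow_mul, ← orderOf_dvd_iff_pow_eq_one, orderOf_pauliZeta hζ,
      hζ.pow_eq_one_iff_dvd]
  rw [h1, (dbar_pow hζ).pow_eq_one_iff_dvd]
  refine ⟨fun h => (ZMod.val_eq_zero j).mp (Nat.eq_zero_of_dvd_of_lt h (ZMod.val_lt j)), ?_⟩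
  rintro rfl
  simp

/-- A non-zero coordinate of `τ(g)` says that `g` commutes with some `X_r` or `Z_r` only up to a
non-trivial scalar. -/
lemma trace_eq_zero_of_tau_ne (hζ : IsPrimitiveRoot ζ (dbar d)) {g : pauliGroup n d ζ}
    (hg : tau hζ g ≠ 1) :
    LinearMap.trace ℂ (NQudits n d)
      ((g : NQudits n d ≃ₗ[ℂ] NQudits n d) : NQudits n d →ₗ[ℂ] NQudits n d) = 0 := by
  have hP := isPauliGenerated_pauliGroup (n := n) hζ
  by_contra htr
  refine hg (funext fun r => ?_)
  refine Prod.ext ?_ ?_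
  · by_contra h
    exact htr ((hP.commBy_x g r).trace_eq_zero (dbar_pow hζ) h)
  · by_contra h
    exact htr ((hP.commBy_z g r).trace_eq_zero (dbar_pow hζ) (neg_ne_zero.mpr h))

instance {k : ℕ} (D : Fin k → ℕ) [∀ i, NeZero (D i)] : FiniteDimensional ℂ (Qudits D) :=
  (quditsBasis D).finiteDimensional_of_finite

lemma finrank_qudits {k : ℕ} (D : Fin k → ℕ) [∀ i, NeZero (D i)] :
    Module.finrank ℂ (Qudits D) = ∏ i, D i := by
  rw [Module.finrank_eq_card_basis (quditsBasis D), Fintype.card_pi]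
  simp [ZMod.card]

/-! ### The double complement -/

-- Orthogonality of characters: `x ↦ χ(φ(m, x))` is a character of `N`, trivial exactly for `m ∈
-- N^⊥` because `χ` is injective.
open Classical in
lemma sum_stdAddChar_pauliForm (N : AddSubgroup (PauliMod n d)) (m : PauliMod n d) :
    ∑ x : N, ZMod.stdAddChar (pauliForm m x) = if m ∈ perp N then (Nat.card N : ℂ) else 0 := by
  let ψ : AddChar N ℂ := (ZMod.stdAddChar (N := d)).compAddMonoidHom
    (AddMonoidHom.mk' (fun x : N => pauliForm m x) fun x y => pauliForm_add_right m x y)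
  have h1 : ψ = 0 ↔ m ∈ perp N := by
    rw [AddChar.eq_zero_iff]
    refine ⟨fun h x hx => ?_, fun h x => ?_⟩
    · have := h ⟨x, hx⟩
      exact ZMod.injective_stdAddChar (this.trans (AddChar.map_zero_eq_one _).symm)
    · change ZMod.stdAddChar (pauliForm m x) = 1
      rw [h x x.2, AddChar.map_zero_eq_one]
  have h2 := ψ.sum_eq_ite
  rw [Nat.card_eq_fintype_card]
  simp only [h1] at h2
  exact h2

/-- Evaluate the sum of `χ(φ(m, x))` over all `m` and all `x ∈ N` in both orders. Summing over `x`
first counts `N^⊥`; summing over `m` first leaves only `x = 0`, by non-degeneracy. -/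
lemma card_mul_card_perp (N : AddSubgroup (PauliMod n d)) :
    Nat.card N * Nat.card (perp N) = (d ^ n) ^ 2 := by
  classical
  have hS : ∑ m : PauliMod n d, ∑ x : N, ZMod.stdAddChar (pauliForm m x)
      = (Nat.card N * Nat.card (perp N) : ℂ) := by
    simp only [sum_stdAddChar_pauliForm]
    rw [← Finset.sum_filter, Finset.sum_const, nsmul_eq_mul, mul_comm, Nat.card_eq_fintype_card
      (α := perp N), ← Fintype.card_subtype]
  have hS' : ∑ x : N, ∑ m : PauliMod n d, ZMod.stdAddChar (pauliForm m x)
      = ((d ^ n) ^ 2 : ℂ) := by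
    have h1 : ∀ x : N, ∑ m : PauliMod n d, ZMod.stdAddChar (pauliForm m x)
        = if x = 0 then ((d ^ n) ^ 2 : ℂ) else 0 := by
      intro x
      have h2 := sum_stdAddChar_pauliForm (⊤ : AddSubgroup (PauliMod n d)) (-(x : PauliMod n d))
      have h3 : ∀ m : PauliMod n d, pauliForm (-(x : PauliMod n d)) m = pauliForm m x := by
        intro m
        rw [pauliForm_swap, neg_eq_iff_add_eq_zero, ← pauliForm_add_right]
        simp [pauliForm]
      have h4 : -(x : PauliMod n d) ∈ perp (⊤ : AddSubgroup (PauliMod n d)) ↔ x = 0 := by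
        constructor
        · intro h
          have := eq_zero_of_pauliForm_eq_zero fun y => h y trivial
          exact Subtype.ext (neg_eq_zero.mp this)
        · rintro rfl
          simp
      simp only [h3, h4] at h2
      rw [← Equiv.sum_comp (AddSubgroup.topEquiv (G := PauliMod n d)).toEquiv]
      refine h2.trans ?_
      rw [AddSubgroup.card_top, Nat.card_eq_fintype_card, Fintype.card_pi]
      simp only [Fintype.card_prod, ZMod.card, Finset.prod_const, Finset.card_univ,
        Fintype.card_fin]
      push_cast
      rw [← pow_two, ← pow_mul, ← pow_mul, mul_comm]
    simp [h1]
  rw [Finset.sum_comm, hS'] at hS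
  exact_mod_cast hS.symm

/-- One inclusion is formal; the cardinality formula for `N` and for `N^⊥` makes it an equality. -/
lemma perp_perp (N : AddSubgroup (PauliMod n d)) : perp (perp N) = N := by
  have h1 := card_mul_card_perp N
  have h2 := card_mul_card_perp (perp N)
  have h3 : Nat.card (perp (perp N)) = Nat.card N := by
    rw [← h1, mul_comm] at h2
    exact Nat.eq_of_mul_eq_mul_right Nat.card_pos h2
  refine (SetLike.coe_injective (Set.eq_of_subset_of_ncard_le (le_perp_perp N) ?_
    (Set.toFinite _))).symm
  exact h3.le

end PauliGroup

/-- The dimension of the space of fixed vectors, if only the identity has non-zero trace. -/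
lemma finrank_fixed_mul_card {V G : Type*} [AddCommGroup V] [Module ℂ V] [FiniteDimensional ℂ V]
    [Group G] [Finite G] (ρ : G →* Module.End ℂ V)
    (htr : ∀ g, g ≠ 1 → LinearMap.trace ℂ V (ρ g) = 0) (W : Submodule ℂ V)
    (hW : ∀ v, v ∈ W ↔ ∀ g, ρ g v = v) :
    Module.finrank ℂ W * Nat.card G = Module.finrank ℂ V := by
  have := Fintype.ofFinite G
  have hcard : (Fintype.card G : ℂ) ≠ 0 := Nat.cast_ne_zero.mpr Fintype.card_ne_zero
  have : Invertible (Fintype.card G : ℂ) := invertibleOfNonzero hcard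
  have hinv : Representation.invariants ρ = W := by
    ext v
    exact (hW v).symm
  -- Averaging over `G` projects onto the fixed vectors, so its trace is their dimension, and only
  -- `g = 1` contributes to that trace.
  have h1 := (Representation.isProj_averageMap ρ).trace
  have h2 : LinearMap.trace ℂ V (Representation.averageMap ρ)
      = (Fintype.card G : ℂ)⁻¹ * ∑ g : G, LinearMap.trace ℂ V (ρ g) := by
    simp [Representation.averageMap, GroupAlgebra.average, map_sum]
  rw [h2, Finset.sum_eq_single 1 (fun g _ hg => htr g hg) (by simp), map_one,
    LinearMap.trace_one, hinv, eq_comm] at h1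
  have h4 : (Module.finrank ℂ W * Nat.card G : ℂ) = Module.finrank ℂ V := by
    rw [h1, Nat.card_eq_fintype_card]
    field_simp
  exact_mod_cast h4

lemma quotZeta_zpow {n d : ℕ} {ζ : ℂˣ} {H : Subgroup (pauliGroup n d ζ)} (a : ℤ) :
    quotZeta H ^ a = QuotientGroup.mk
      (⟨pauliZeta n d ζ, pauliZeta_mem_norm H⟩ ^ a : normGrp H) := rfl

lemma quotZeta_zpow_eq_one_iff {n d : ℕ} {ζ : ℂˣ} {H : Subgroup (pauliGroup n d ζ)} (a : ℤ) :
    quotZeta H ^ a = 1 ↔ pauliZeta n d ζ ^ a ∈ H := by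
  rw [quotZeta_zpow, QuotientGroup.eq_one_iff, Subgroup.mem_subgroupOf]
  rfl

lemma redForm_self {n d : ℕ} (N : AddSubgroup (PauliMod n d)) (x : Red N) :
    redForm N x x = 0 := by
  induction x using QuotientAddGroup.induction_on with | H x => ?_
  change pauliForm (x : PauliMod n d) x = 0
  refine Finset.sum_eq_zero fun r _ => ?_
  ring

/-! ### The normaliser, the extension `N(H)/H` and the dimension of `V^H` -/

section Stabiliser

variable {n d : ℕ} [NeZero d] {ζ : ℂˣ} (hζ : IsPrimitiveRoot ζ (dbar d))
  {H : Subgroup (pauliGroup n d ζ)}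
  (hscal : ∀ a : ℤ, pauliZeta n d ζ ^ a ∈ H → pauliZeta n d ζ ^ a = 1)

include hscal in
lemma eq_one_of_tau_eq_one {h : pauliGroup n d ζ} (hh : h ∈ H) (hτ : tau hζ h = 1) : h = 1 := by
  rw [← MonoidHom.mem_ker, tau_ker hζ] at hτ
  obtain ⟨a, rfl⟩ := hτ
  exact hscal a hh

include hscal in
lemma tau_injOn : Function.Injective fun h : H => tau hζ (h : pauliGroup n d ζ) := by
  change Function.Injective ((tau hζ).comp H.subtype)
  rw [injective_iff_map_eq_one]
  exact fun h hh => Subtype.ext (eq_one_of_tau_eq_one hζ hscal h.2 hh)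

include hscal in
lemma card_tauImage : Nat.card (tauImage hζ H) = Nat.card H := by
  have h1 : Nat.card H = Nat.card (Set.range fun h : H => tau hζ (h : pauliGroup n d ζ)) :=
    Nat.card_congr (Equiv.ofInjective _ (tau_injOn hζ hscal))
  rw [h1]
  refine Nat.card_congr (Equiv.setCongr ?_)
  ext m
  exact ⟨fun ⟨h, hh, hm⟩ => ⟨⟨h, hh⟩, hm⟩, fun ⟨h, hm⟩ => ⟨h.1, h.2, hm⟩⟩

include hζ hscal in
/-- The dimension of the stabiliser space. -/
lemma finrank_stabSpace : Module.finrank ℂ (stabSpace H) * Nat.card H = d ^ n := by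
  have hfin : Finite H := Finite.of_injective _ (tau_injOn hζ hscal)
  let ρ : H →* Module.End ℂ (NQudits n d) :=
    (LinearEquiv.automorphismGroup.toLinearMapMonoidHom (R := ℂ) (M := NQudits n d)).comp
      ((pauliGroup n d ζ).subtype.comp H.subtype)
  have h1 := finrank_fixed_mul_card ρ
    (fun g hg => trace_eq_zero_of_tau_ne hζ fun h =>
        hg (Subtype.ext (eq_one_of_tau_eq_one hζ hscal g.2 h)))
    (stabSpace H) fun v => ⟨fun h g => h g g.2, fun h g hg => h ⟨g, hg⟩⟩
  rw [h1, finrank_qudits]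
  simp

variable (hcomm : ∀ g ∈ H, ∀ h ∈ H, g * h = h * g)

include hcomm in
lemma tauImage_le_perp : tauImage hζ H ≤ perp (tauImage hζ H) := by
  rintro _ ⟨g, hg, rfl⟩ _ ⟨h, hh, rfl⟩
  have h1 := pauli_commutator hζ g h
  rw [hcomm g hg h hh, right_eq_mul, pauliZeta_sq_pow_eq_one_iff hζ] at h1
  exact h1

-- Conjugation by `g` multiplies each `h ∈ H` by a power of `ζ`. For `g` in the normaliser this
-- scalar lies in `H`, hence is 1; so normalising `H` amounts to centralising it.
include hscal in
lemma mem_normGrp_iff (g : pauliGroup n d ζ) :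
    g ∈ normGrp H ↔ Multiplicative.toAdd (tau hζ g) ∈ perp (tauImage hζ H) := by
  have hconj : ∀ h, g * h * g⁻¹ = (pauliZeta n d ζ ^ 2) ^
      (pauliForm (Multiplicative.toAdd (tau hζ g)) (Multiplicative.toAdd (tau hζ h))).val * h := by
    intro h
    rw [pauli_commutator hζ g h, mul_assoc, mul_assoc, mul_inv_cancel, mul_one]
  constructor
  · rintro hg _ ⟨h, hh, rfl⟩
    have h1 := (Subgroup.mem_normalizer_iff.mp hg h).mp hh
    change g * h * g⁻¹ ∈ H at h1
    rw [hconj] at h1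
    have h2 := (Subgroup.mul_mem_cancel_right H hh).mp h1
    rw [← pow_mul, ← zpow_natCast] at h2
    have h3 := hscal _ h2
    rw [zpow_natCast, pow_mul, pauliZeta_sq_pow_eq_one_iff hζ] at h3
    exact h3
  · intro hg
    have hfix : ∀ h ∈ H, g * h * g⁻¹ = h := by
      intro h hh
      have h0 : pauliForm (Multiplicative.toAdd (tau hζ g)) (Multiplicative.toAdd (tau hζ h)) = 0 :=
        hg _ ⟨h, hh, rfl⟩
      rw [hconj, h0, ZMod.val_zero, pow_zero, one_mul]
    rw [Subgroup.mem_normalizer_iff]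
    intro h
    refine ⟨fun hh => (hfix h hh).symm ▸ hh, fun hh => ?_⟩
    have h1 := hfix _ hh
    have h2 : g * h * g⁻¹ = h := mul_left_cancel (mul_right_cancel h1)
    rwa [h2] at hh

/-- The homomorphism `N(H) → τ(H)^⊥/τ(H)` induced by `τ`. -/
def normTau : normGrp H →* Multiplicative (Red (tauImage hζ H)) :=
  MonoidHom.mk' (fun g => Multiplicative.ofAdd
      (QuotientAddGroup.mk ⟨Multiplicative.toAdd (tau hζ g), (mem_normGrp_iff hζ hscal g).mp g.2⟩))
    (by
      intro g h
      rw [← ofAdd_add, ← QuotientAddGroup.mk_add]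
      congr 3
      exact map_mul (tau hζ) (g : pauliGroup n d ζ) h)

/-- The homomorphism `N(H)/H → τ(H)^⊥/τ(H)` induced by `τ`. -/
def redTau : NormQuot H →* Multiplicative (Red (tauImage hζ H)) :=
  QuotientGroup.lift _ (normTau hζ hscal) (by
    intro g hg
    rw [Subgroup.mem_subgroupOf] at hg
    rw [MonoidHom.mem_ker]
    exact (QuotientAddGroup.eq_zero_iff _).mpr
      (AddSubgroup.mem_addSubgroupOf.mpr ⟨_, hg, rfl⟩))

lemma redTau_mk (g : normGrp H) : redTau hζ hscal (QuotientGroup.mk g) = Multiplicative.ofAdd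
    ((⟨Multiplicative.toAdd (tau hζ g), (mem_normGrp_iff hζ hscal g).mp g.2⟩ :
      perp (tauImage hζ H)) : Red (tauImage hζ H)) := rfl

lemma isInducedByTau_redTau : IsInducedByTau hζ H (redTau hζ hscal) :=
  fun g => ⟨⟨_, (mem_normGrp_iff hζ hscal g).mp g.2⟩, rfl, rfl⟩

include hζ hscal in
lemma orderOf_quotZeta : orderOf (quotZeta H) = dbar d := by
  rw [← orderOf_pauliZeta (n := n) hζ]
  have h : ∀ a : ℕ, quotZeta H ^ a = 1 ↔ pauliZeta n d ζ ^ a = 1 := by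
    intro a
    rw [← zpow_natCast, quotZeta_zpow_eq_one_iff, ← zpow_natCast]
    exact ⟨hscal a, fun h => h ▸ one_mem H⟩
  apply Nat.dvd_antisymm
  · exact orderOf_dvd_of_pow_eq_one ((h _).mpr (pow_orderOf_eq_one _))
  · exact orderOf_dvd_of_pow_eq_one ((h _).mp (pow_orderOf_eq_one _))

/-- If `τ(g) = τ(h)` with `h ∈ H`, then `g * h⁻¹` lies in the kernel of `τ` and is a power of `ζ`.
-/
lemma ker_redTau : (redTau hζ hscal).ker = Subgroup.zpowers (quotZeta H) := by
  apply le_antisymm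
  · intro g hg
    induction g using QuotientGroup.induction_on with | H g => ?_
    obtain ⟨h, hh, hgh⟩ :=
      AddSubgroup.mem_addSubgroupOf.mp ((QuotientAddGroup.eq_zero_iff _).mp hg)
    have h1 : (g : pauliGroup n d ζ) * h⁻¹ ∈ (tau hζ).ker := by
      rw [MonoidHom.mem_ker, map_mul, map_inv, mul_inv_eq_one]
      exact hgh.symm
    rw [tau_ker hζ] at h1
    obtain ⟨a, ha⟩ := h1
    refine ⟨a, ?_⟩
    change quotZeta H ^ a = _
    rw [quotZeta_zpow, QuotientGroup.eq, Subgroup.mem_subgroupOf]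
    change (pauliZeta n d ζ ^ a)⁻¹ * (g : pauliGroup n d ζ) ∈ H
    have h2 : Commute (pauliZeta n d ζ) h := (isPauliGenerated_pauliGroup hζ).c_comm h
    have h3 : (g : pauliGroup n d ζ) = pauliZeta n d ζ ^ a * h := by
      rw [show pauliZeta n d ζ ^ a = _ from ha, inv_mul_cancel_right]
    rw [h3, inv_mul_cancel_left]
    exact hh
  · rw [Subgroup.zpowers_le, MonoidHom.mem_ker]
    refine (QuotientAddGroup.eq_zero_iff _).mpr (AddSubgroup.mem_addSubgroupOf.mpr ?_)
    change Multiplicative.toAdd (tau hζ (pauliZeta n d ζ)) ∈ _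
    rw [tau_pauliZeta hζ]
    exact zero_mem _

lemma normQuot_commutator (g h : normGrp H) :
    (QuotientGroup.mk g * QuotientGroup.mk h : NormQuot H) = (quotZeta H ^ 2) ^
      (redForm (tauImage hζ H) (Multiplicative.toAdd (redTau hζ hscal (QuotientGroup.mk g)))
        (Multiplicative.toAdd (redTau hζ hscal (QuotientGroup.mk h)))).val
      * (QuotientGroup.mk h * QuotientGroup.mk g) := by
  have h1 : redForm (tauImage hζ H) (Multiplicative.toAdd (redTau hζ hscal (QuotientGroup.mk g)))
        (Multiplicative.toAdd (redTau hζ hscal (QuotientGroup.mk h)))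
      = pauliForm (Multiplicative.toAdd (tau hζ (g : pauliGroup n d ζ)))
          (Multiplicative.toAdd (tau hζ (h : pauliGroup n d ζ))) := by
    rw [redTau_mk, redTau_mk, toAdd_ofAdd, toAdd_ofAdd]
    rfl
  rw [h1]
  have h2 := pauli_commutator hζ (g : pauliGroup n d ζ) h
  generalize (pauliForm (Multiplicative.toAdd (tau hζ (g : pauliGroup n d ζ)))
    (Multiplicative.toAdd (tau hζ (h : pauliGroup n d ζ)))).val = j at h2 ⊢
  have h3 : g * h = ((⟨pauliZeta n d ζ, pauliZeta_mem_norm H⟩ : normGrp H) ^ 2) ^ j * (h * g) :=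
    Subtype.ext h2
  rw [← QuotientGroup.mk_mul, h3]
  rfl

/-- `N(H)/H` is a Heisenberg extension of `τ(H)^⊥/τ(H)`. -/
lemma isHeisenbergExtension_redTau :
    IsHeisenbergExtension d (redForm (tauImage hζ H)) (quotZeta H) (redTau hζ hscal) := by
  have hlift : ∀ m : Red (tauImage hζ H), ∃ g : NormQuot H,
      redTau hζ hscal g = Multiplicative.ofAdd m ∧ orderOf g = addOrderOf m := by
    intro m
    induction m using QuotientAddGroup.induction_on with | H m => ?_
    obtain ⟨g, hg, hord⟩ := tau_exists_lift hζ (m : PauliMod n d)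
    have hgN : g ∈ normGrp H := by
      rw [mem_normGrp_iff hζ hscal, hg]
      exact m.2
    have hτ : redTau hζ hscal (QuotientGroup.mk ⟨g, hgN⟩) = Multiplicative.ofAdd (m : Red _) := by
      rw [redTau_mk]
      congr 3
    set r := addOrderOf (m : Red (tauImage hζ H)) with hr
    set s := addOrderOf (m : PauliMod n d) with hs
    have hs0 : 0 < s := addOrderOf_pos _
    have hrs : r ∣ s := by
      refine addOrderOf_dvd_of_nsmul_eq_zero ?_
      rw [← QuotientAddGroup.mk_nsmul]
      have : s • m = 0 := Subtype.ext (addOrderOf_nsmul_eq_zero (m : PauliMod n d))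
      rw [this]
      rfl
    have hsd : s ∣ dbar d := by
      refine (addOrderOf_dvd_of_nsmul_eq_zero ?_ : s ∣ d).trans ?_
      · funext i
        exact Prod.ext (by simp) (by simp)
      · unfold dbar
        split_ifs
        · exact Dvd.intro_left 2 rfl
        · exact dvd_rfl
    -- The lift `g` has the order `s` of `m` before reduction, which may exceed the order `r` of its
    -- class. Its `r`-th power in `N(H)/H` is at least some `ζ ^ c`.
    have hker : (QuotientGroup.mk ⟨g, hgN⟩ : NormQuot H) ^ r ∈ (redTau hζ hscal).ker := by
      rw [MonoidHom.mem_ker, map_pow, hτ, ← ofAdd_nsmul, hr, addOrderOf_nsmul_eq_zero]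
      rfl
    rw [ker_redTau] at hker
    obtain ⟨c, hc⟩ := hker
    change quotZeta H ^ c = _ at hc
    obtain ⟨t, ht⟩ := hrs
    have hct : quotZeta H ^ (c * t) = 1 := by
      rw [zpow_mul, hc, zpow_natCast, ← pow_mul, ← ht, ← QuotientGroup.mk_pow]
      have : (⟨g, hgN⟩ : normGrp H) ^ s = 1 :=
        Subtype.ext (show g ^ s = 1 by rw [← hord, pow_orderOf_eq_one])
      rw [this]
      rfl
    rw [← orderOf_dvd_iff_zpow_eq_one, orderOf_quotZeta hζ hscal] at hct
    -- From `s = r * t` follows `ζ ^ (c * t) = 1`, so `r * t = s ∣ dbar d ∣ c * t`. Hence `ζ ^ c`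
    -- has an `r`-th root among the powers of `ζ`, by which the lift can be divided.
    have hrc : (r : ℤ) ∣ c := by
      have h1 : ((r * t : ℕ) : ℤ) ∣ c * t := by
        rw [← ht]
        exact (Int.natCast_dvd_natCast.mpr hsd).trans hct
      have ht0 : (t : ℤ) ≠ 0 := by
        rintro h
        rw [Int.natCast_eq_zero.mp h] at ht
        omega
      push_cast at h1
      exact (mul_dvd_mul_iff_right ht0).mp h1
    obtain ⟨e, rfl⟩ := hrc
    have hz : Commute (quotZeta H) (QuotientGroup.mk ⟨g, hgN⟩ : NormQuot H) :=
      congrArg (QuotientGroup.mk (s := H.subgroupOf (normGrp H)))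
        (show (⟨pauliZeta n d ζ, pauliZeta_mem_norm H⟩ : normGrp H) * ⟨g, hgN⟩
          = ⟨g, hgN⟩ * ⟨pauliZeta n d ζ, pauliZeta_mem_norm H⟩ from
          Subtype.ext ((isPauliGenerated_pauliGroup hζ).c_comm g))
    have hτ' : redTau hζ hscal (quotZeta H ^ (-e) * QuotientGroup.mk ⟨g, hgN⟩)
        = Multiplicative.ofAdd (m : Red (tauImage hζ H)) := by
      have h1 : quotZeta H ^ (-e) ∈ (redTau hζ hscal).ker := by
        rw [ker_redTau]; exact ⟨-e, rfl⟩
      rw [map_mul, MonoidHom.mem_ker.mp h1, one_mul, hτ]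
    refine ⟨_, hτ', orderOf_eq_addOrderOf hτ' ?_⟩
    rw [(hz.zpow_left (-e)).mul_pow, ← hr, ← hc, ← zpow_natCast, ← zpow_mul, ← zpow_add]
    simp [mul_comm]
  refine ⟨fun m => ?_, ker_redTau hζ hscal, orderOf_quotZeta hζ hscal, ?_, hlift⟩
  · obtain ⟨g, hg, -⟩ := hlift (Multiplicative.toAdd m)
    exact ⟨g, hg⟩
  · intro g h
    induction g using QuotientGroup.induction_on with | H g => ?_
    induction h using QuotientGroup.induction_on with | H h => ?_
    exact normQuot_commutator hζ hscal g h

/-- The form on `N^⊥/N` as a biadditive map. -/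
def redFormHom (N : AddSubgroup (PauliMod n d)) : Red N →+ Red N →+ ZMod d :=
  AddMonoidHom.mk' (fun x => AddMonoidHom.mk' (redForm N x) (by
      intro y z
      induction x using QuotientAddGroup.induction_on
      induction y using QuotientAddGroup.induction_on
      induction z using QuotientAddGroup.induction_on
      exact pauliForm_add_right _ _ _)) (by
    intro x y
    refine AddMonoidHom.ext fun z => ?_
    induction x using QuotientAddGroup.induction_on
    induction y using QuotientAddGroup.induction_on
    induction z using QuotientAddGroup.induction_on
    exact pauliForm_add_left _ _ _)

/-- The radical of the form on `N^⊥` is `N^⊥ ∩ N^⊥⊥`, and `perp_perp` identifies `N^⊥⊥` with `N`. -/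
lemma redForm_nondegenerate (N : AddSubgroup (PauliMod n d)) (x : Red N)
    (hx : ∀ y, redForm N x y = 0) : x = 0 := by
  induction x using QuotientAddGroup.induction_on with | H x => ?_
  have h : (x : PauliMod n d) ∈ perp (perp N) := fun y hy => hx (QuotientAddGroup.mk ⟨y, hy⟩)
  rw [perp_perp] at h
  exact (QuotientAddGroup.eq_zero_iff x).mpr (AddSubgroup.mem_addSubgroupOf.mpr h)

lemma exists_red_decomposition (N : AddSubgroup (PauliMod n d)) :
    ∃ (k : ℕ) (D : Fin k → ℕ), 0 < k ∧ (∀ i, 0 < D i ∧ D i ∣ d) ∧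
      ∃ e : Red N ≃+ SympSum D, IsSymplecticIso e :=
  exists_symplectic_decomposition (redFormHom N) (redForm_self N) (redForm_nondegenerate N)

include hcomm hscal in
/-- The dimension of `V^H` in terms of a symplectic decomposition of `τ(H)^⊥/τ(H)`. -/
lemma finrank_stabSpace_eq {k : ℕ} {D : Fin k → ℕ} [∀ i, NeZero (D i)]
    (e : Red (tauImage hζ H) ≃+ SympSum D) :
    Module.finrank ℂ (stabSpace H) = ∏ i, D i := by
  have hfin : Finite H := Finite.of_injective _ (tau_injOn hζ hscal)
  have h1 : Nat.card (Red (tauImage hζ H)) = (∏ i, D i) ^ 2 := by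
    rw [Nat.card_congr e.toEquiv, Nat.card_eq_fintype_card, Fintype.card_pi]
    simp [ZMod.card, Finset.prod_mul_distrib, pow_two]
  have h2 := AddSubgroup.card_eq_card_quotient_mul_card_addSubgroup
    ((tauImage hζ H).addSubgroupOf (perp (tauImage hζ H)))
  have h3 : Nat.card ((tauImage hζ H).addSubgroupOf (perp (tauImage hζ H))) = Nat.card H := by
    rw [← card_tauImage hζ hscal]
    exact Nat.card_congr
      (AddSubgroup.addSubgroupOfEquivOfLe (tauImage_le_perp hζ hcomm)).toEquiv
  -- Here `|N^⊥| = (∏ D_i)² · |H|` for `N = τ(H)`, so `|N| · |N^⊥| = d ^ (2n)` compares the squares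
  -- of `(∏ D_i) · |H|` and `dim V^H · |H|`.
  have h4 := card_mul_card_perp (tauImage hζ H)
  rw [h2, h1, h3, card_tauImage hζ hscal, ← finrank_stabSpace hζ hscal] at h4
  have h5 : ((∏ i, D i) * Nat.card H) ^ 2
      = (Module.finrank ℂ (stabSpace H) * Nat.card H) ^ 2 := by
    rw [← h4]; ring
  exact (Nat.eq_of_mul_eq_mul_right Nat.card_pos (Nat.pow_left_injective two_ne_zero h5)).symm

end Stabiliser

/-! ### The one-qudit groups with the enlarged scalar group -/

section OneQudit

variable {d d₀ : ℕ} {ζ : ℂˣ}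

lemma commBy_opZ_opX [NeZero d₀] {ξ : ℂˣ} (hξ : ξ ^ d₀ = 1) :
    CommBy ξ (1 : ZMod d₀) (opZ d₀ ξ) (opX d₀) := by
  unfold CommBy
  rw [pow_val_one hξ, opZ_mul_opX d₀ hξ]

lemma exists_commBy_pauliOne [NeZero d₀] (hξ : ((ζ ^ 2) ^ (d / d₀)) ^ d₀ = 1)
    (Y : Qudit d₀ ≃ₗ[ℂ] Qudit d₀)
    (hX : ∃ j : ZMod d₀, CommBy ((ζ ^ 2) ^ (d / d₀)) j (opX d₀) Y)
    (hZ : ∃ j : ZMod d₀, CommBy ((ζ ^ 2) ^ (d / d₀)) j (opZ d₀ ((ζ ^ 2) ^ (d / d₀))) Y) :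
    ∀ g ∈ pauliOne d d₀ ζ, ∃ j : ZMod d₀, CommBy ((ζ ^ 2) ^ (d / d₀)) j g Y := by
  intro g hg
  induction hg using Subgroup.closure_induction with
  | mem x hx =>
    rcases hx with rfl | rfl | rfl
    · exact hX
    · exact hZ
    · exact ⟨0, CommBy.of_commute (scal_comm _ _)⟩
  | one => exact ⟨0, CommBy.of_commute (by simp)⟩
  | mul x y _ _ hx hy =>
    obtain ⟨j, hj⟩ := hx
    obtain ⟨j', hj'⟩ := hy
    exact ⟨_, hj.mul_left hξ hj'⟩
  | inv x _ hx =>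
    obtain ⟨j, hj⟩ := hx
    exact ⟨_, hj.inv_left hξ⟩

lemma exists_commBy_opX [NeZero d₀] (hξ : ((ζ ^ 2) ^ (d / d₀)) ^ d₀ = 1) :
    ∀ g ∈ pauliOne d d₀ ζ, ∃ j : ZMod d₀, CommBy ((ζ ^ 2) ^ (d / d₀)) j g (opX d₀) :=
  exists_commBy_pauliOne hξ _ ⟨0, CommBy.of_commute rfl⟩ ⟨1, commBy_opZ_opX hξ⟩

lemma exists_commBy_opZ [NeZero d₀] (hξ : ((ζ ^ 2) ^ (d / d₀)) ^ d₀ = 1) :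
    ∀ g ∈ pauliOne d d₀ ζ, ∃ j : ZMod d₀,
      CommBy ((ζ ^ 2) ^ (d / d₀)) j g (opZ d₀ ((ζ ^ 2) ^ (d / d₀))) :=
  exists_commBy_pauliOne hξ _ ⟨_, (commBy_opZ_opX hξ).symm hξ⟩ ⟨0, CommBy.of_commute rfl⟩

instance : Nontrivial (Qudit d₀) := inferInstanceAs (Nontrivial (ZMod d₀ → ℂ))

/-- The homomorphism `τ` of a one-qudit Pauli group, `τ(Z) = (1,0)`, `τ(X) = (0,1)`,
`τ(ζ) = 0`. -/
def oneTau [NeZero d₀] (hξ : IsPrimitiveRoot ((ζ ^ 2) ^ (d / d₀)) d₀) :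
    pauliOne d d₀ ζ →* Multiplicative (PauliMod 1 d₀) :=
  MonoidHom.mk' (fun g => Multiplicative.ofAdd fun _ =>
      (Multiplicative.toAdd (commHom hξ (pauliOne d d₀ ζ) (opX d₀)
          (exists_commBy_opX hξ.pow_eq_one) g),
        -Multiplicative.toAdd (commHom hξ (pauliOne d d₀ ζ) (opZ d₀ ((ζ ^ 2) ^ (d / d₀)))
          (exists_commBy_opZ hξ.pow_eq_one) g))) (by
    intro g g'
    rw [← ofAdd_add]
    congr 1
    funext r
    simp only [Pi.add_apply, MonoidHom.map_mul, toAdd_mul, Prod.mk_add_mk, neg_add])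

lemma oneTau_eq [NeZero d₀] (hξ : IsPrimitiveRoot ((ζ ^ 2) ^ (d / d₀)) d₀)
    (g : pauliOne d d₀ ζ) (m : PauliMod 1 d₀)
    (hX : CommBy ((ζ ^ 2) ^ (d / d₀)) (m 0).1 (g : Qudit d₀ ≃ₗ[ℂ] Qudit d₀) (opX d₀))
    (hZ : CommBy ((ζ ^ 2) ^ (d / d₀)) (-(m 0).2) (g : Qudit d₀ ≃ₗ[ℂ] Qudit d₀)
      (opZ d₀ ((ζ ^ 2) ^ (d / d₀)))) :
    oneTau hξ g = Multiplicative.ofAdd m := by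
  refine congrArg Multiplicative.ofAdd (funext fun r => ?_)
  rw [Subsingleton.elim r 0, commHom_eq _ _ _ _ g _ hX, commHom_eq _ _ _ _ g _ hZ]
  simp

/-- The commutation root is `(ζ²)^(d/d₀)` while the scalars are powers of `ζ` itself;
`IsPauliGenerated` keeps `ξ` and `ζ` apart for this case. -/
lemma isPauliGenerated_pauliOne [NeZero d₀] (hξ : IsPrimitiveRoot ((ζ ^ 2) ^ (d / d₀)) d₀) :
    IsPauliGenerated (ξ := (ζ ^ 2) ^ (d / d₀)) ζ (pauliOne d d₀ ζ) (fun _ => oneX d ζ d₀)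
      (fun _ => oneZ d ζ d₀) (oneZeta d ζ d₀) (oneTau hξ) where
  closure_eq := by
    have : insert (oneZeta d ζ d₀) (Set.range (Sum.elim (fun _ : Fin 1 => oneZ d ζ d₀)
          (fun _ : Fin 1 => oneX d ζ d₀)))
        = (pauliOne d d₀ ζ).subtype ⁻¹' {opX d₀, opZ d₀ ((ζ ^ 2) ^ (d / d₀)), scal _ ζ} := by
      ext ⟨g, hg⟩
      simp only [Set.Sum.elim_range, Set.range_const, Set.mem_insert_iff, Set.mem_union,
        Set.mem_singleton_iff, Set.mem_preimage, Subtype.ext_iff, oneX, oneZ, oneZeta,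
        Subgroup.coe_subtype]
      tauto
    rw [this]
    exact Subgroup.closure_closure_coe_preimage
  coe_c := rfl
  x_pow _ := Subtype.ext (opX_pow_self d₀)
  z_pow _ := Subtype.ext (opZ_pow_self hξ.pow_eq_one)
  τ_c := oneTau_eq hξ _ 0 (CommBy.of_commute (scal_comm _ _)) (by
    rw [Pi.zero_apply, Prod.snd_zero, neg_zero]
    exact CommBy.of_commute (scal_comm _ _))
  τ_x r := by
    rw [Subsingleton.elim r 0]
    refine oneTau_eq hξ _ _ (CommBy.of_commute rfl) ?_
    exact (commBy_opZ_opX hξ.pow_eq_one).symm hξ.pow_eq_one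
  τ_z r := by
    rw [Subsingleton.elim r 0]
    refine oneTau_eq hξ _ _ (commBy_opZ_opX hξ.pow_eq_one) ?_
    rw [Pi.single_eq_same, neg_zero]
    exact CommBy.of_commute rfl
  commBy_x g _ := (exists_commBy_opX hξ.pow_eq_one g g.2).choose_spec
  commBy_z g _ := by
    have h := (exists_commBy_opZ hξ.pow_eq_one g g.2).choose_spec
    rw [← neg_neg (Exists.choose _)] at h
    exact h

end OneQudit

lemma eq_one_of_smul_eq {V : Type*} [AddCommGroup V] [Module ℂ V] {v : V} (hv : v ≠ 0) {c : ℂˣ}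
    (h : (c : ℂ) • v = v) : c = 1 :=
  Units.ext (smul_left_injective ℂ hv (h.trans (one_smul ℂ v).symm))

/-! ### The `ζ`-product as a Heisenberg extension -/

section ZetaProduct

variable {d k : ℕ} {D : Fin k → ℕ} {ζ : ℂˣ}

lemma prodZeta_eq (i j : Fin k) : prodZeta d D ζ i = prodZeta d D ζ j := by
  have h : Pi.mulSingle i (oneZeta d ζ (D i)) * (Pi.mulSingle j (oneZeta d ζ (D j)))⁻¹
      ∈ zetaRel d D ζ := Subgroup.subset_normalClosure ⟨i, j, rfl⟩
  have h1 := (QuotientGroup.eq_one_iff _).mpr h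
  rw [QuotientGroup.mk_mul, QuotientGroup.mk_inv, mul_inv_eq_one] at h1
  exact h1

/-- Since the elements `ζ` of all factors are identified, scalars in different factors can be
collected, one factor at a time, into the factor `i₀`. -/
lemma mk_zeta_zpow (i₀ : Fin k) (c : Fin k → ℤ) :
    (QuotientGroup.mk fun i => oneZeta d ζ (D i) ^ c i : ZetaProd d D ζ)
      = prodZeta d D ζ i₀ ^ ∑ i, c i := by
  have h : ∀ S : Finset (Fin k),
      (QuotientGroup.mk fun i => if i ∈ S then oneZeta d ζ (D i) ^ c i else 1 : ZetaProd d D ζ)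
        = prodZeta d D ζ i₀ ^ ∑ i ∈ S, c i := by
    intro S
    induction S using Finset.induction_on with
    | empty =>
      simp only [Finset.notMem_empty, if_false, Finset.sum_empty, zpow_zero]
      rfl
    | insert a S ha ih =>
      have h1 : (fun i => if i ∈ insert a S then oneZeta d ζ (D i) ^ c i else 1)
          = Pi.mulSingle a (oneZeta d ζ (D a)) ^ c a
            * (fun i => if i ∈ S then oneZeta d ζ (D i) ^ c i else 1) := by
        funext i
        by_cases hi : i = a
        · subst hi
          simp [ha]
        · simp [hi]
      rw [h1, QuotientGroup.mk_mul, ih, Finset.sum_insert ha, zpow_add, QuotientGroup.mk_zpow,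
        prodZeta_eq i₀ a]
      rfl
  simpa using h Finset.univ

lemma oneZeta_comm {d₀ : ℕ} (g : pauliOne d d₀ ζ) : oneZeta d ζ d₀ * g = g * oneZeta d ζ d₀ :=
  Subtype.ext (scal_comm _ _)

lemma prodZeta_comm (i : Fin k) (g : ZetaProd d D ζ) :
    prodZeta d D ζ i * g = g * prodZeta d D ζ i := by
  induction g using QuotientGroup.induction_on with | H A => ?_
  refine congrArg (QuotientGroup.mk (s := zetaRel d D ζ)) (funext fun j => ?_ : Pi.mulSingle i (oneZeta d ζ (D i)) * A
    = A * Pi.mulSingle i (oneZeta d ζ (D i)))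
  by_cases hj : j = i
  · subst hj
    simpa using oneZeta_comm (A j)
  · simp [hj]

lemma zetaProdAct_prodZeta_zpow (i : Fin k) (c : ℤ) (v : Qudits D) :
    zetaProdAct d D ζ (prodZeta d D ζ i ^ c) v = ((ζ ^ c : ℂˣ) : ℂ) • v := by
  have h : tensorHom D (fun j => (((Pi.mulSingle i (oneZeta d ζ (D i)) : ∀ j, pauliOne d (D j) ζ)
      ^ c) j : Qudit (D j) ≃ₗ[ℂ] Qudit (D j))) = scal (Qudits D) (ζ ^ c) := by
    rw [map_zpow, ← tensorHom_single_scal D i, ← map_zpow]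
    congr 1
    funext j
    by_cases hj : j = i
    · subst hj; simp [oneZeta]
    · simp [hj]
  change tensorHom D (fun j => (((Pi.mulSingle i (oneZeta d ζ (D i)) : ∀ j, pauliOne d (D j) ζ)
      ^ c) j : Qudit (D j) ≃ₗ[ℂ] Qudit (D j))) v = _
  rw [h, scal_apply]

/-- The defining relations might shrink the order of `ζ`; the tensor product action, where it is the
scalar `ζ`, shows that they do not. -/
lemma orderOf_prodZeta [∀ i, NeZero (D i)] (hζ : IsPrimitiveRoot ζ (dbar d)) (i : Fin k) :
    orderOf (prodZeta d D ζ i) = dbar d := by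
  rw [hζ.eq_orderOf]
  apply Nat.dvd_antisymm
  · apply orderOf_dvd_of_pow_eq_one
    have h : oneZeta d ζ (D i) ^ orderOf ζ = 1 := Subtype.ext (by
      change scal _ ζ ^ orderOf ζ = 1
      rw [← map_pow, pow_orderOf_eq_one, map_one])
    have h1 : (Pi.mulSingle i (oneZeta d ζ (D i)) : ∀ j, pauliOne d (D j) ζ) ^ orderOf ζ = 1 := by
      rw [← Pi.mulSingle_pow, h, Pi.mulSingle_one]
    exact congrArg (QuotientGroup.mk (s := zetaRel d D ζ)) h1
  · apply orderOf_dvd_of_pow_eq_one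
    obtain ⟨v, hv⟩ := exists_ne (0 : Qudits D)
    have h := zetaProdAct_prodZeta_zpow (d := d) (ζ := ζ) i (orderOf (prodZeta d D ζ i)) v
    rw [zpow_natCast, pow_orderOf_eq_one, map_one, zpow_natCast] at h
    exact eq_one_of_smul_eq hv h.symm

/-- The homomorphism `τ` of the direct product of one-qudit Pauli groups. -/
def piTau [∀ i, NeZero (D i)] (hξ : ∀ i, IsPrimitiveRoot ((ζ ^ 2) ^ (d / D i)) (D i)) :
    (∀ i, pauliOne d (D i) ζ) →* Multiplicative (SympSum D) :=
  MonoidHom.mk' (fun A => Multiplicative.ofAdd fun i =>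
    Multiplicative.toAdd (oneTau (hξ i) (A i)) 0) (by
    intro A B
    rw [← ofAdd_add]
    congr 1
    funext i
    rw [Pi.mul_apply, map_mul]
    rfl)

lemma piTau_zeta [∀ i, NeZero (D i)] (hξ : ∀ i, IsPrimitiveRoot ((ζ ^ 2) ^ (d / D i)) (D i))
    (i : Fin k) : piTau hξ (Pi.mulSingle i (oneZeta d ζ (D i))) = 1 := by
  refine congrArg Multiplicative.ofAdd (funext fun j => ?_)
  by_cases hj : j = i
  · subst hj
    rw [Pi.mulSingle_eq_same, (isPauliGenerated_pauliOne (hξ j)).τ_c]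
    rfl
  · rw [Pi.mulSingle_eq_of_ne hj, map_one]
    rfl

/-- The homomorphism `τ` of the `ζ`-product. -/
def zetaTau [∀ i, NeZero (D i)] (hξ : ∀ i, IsPrimitiveRoot ((ζ ^ 2) ^ (d / D i)) (D i)) :
    ZetaProd d D ζ →* Multiplicative (SympSum D) :=
  QuotientGroup.lift _ (piTau hξ) (by
    refine Subgroup.normalClosure_le_normal ?_
    rintro x ⟨i, j, rfl⟩
    rw [SetLike.mem_coe, MonoidHom.mem_ker, map_mul, map_inv, piTau_zeta, piTau_zeta,
      mul_inv_cancel])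

section Tau

variable [∀ i, NeZero (D i)] (hξ : ∀ i, IsPrimitiveRoot ((ζ ^ 2) ^ (d / D i)) (D i))

lemma oneTau_weyl {d₀ : ℕ} [NeZero d₀] (hξ : IsPrimitiveRoot ((ζ ^ 2) ^ (d / d₀)) d₀)
    (p : ZMod d₀ × ZMod d₀) :
    Multiplicative.toAdd (oneTau hξ (oneZ d ζ d₀ ^ p.1.val * oneX d ζ d₀ ^ p.2.val)) 0 = p := by
  have h := isPauliGenerated_pauliOne hξ
  rw [map_mul, map_pow, map_pow, h.τ_z 0, h.τ_x 0]
  change (p.1.val • (Pi.single 0 (1, 0) : PauliMod 1 d₀)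
    + p.2.val • (Pi.single 0 (0, 1) : PauliMod 1 d₀)) 0 = p
  simp only [Pi.add_apply, Pi.smul_apply, Pi.single_eq_same, Prod.smul_mk, smul_zero,
    nsmul_one, ZMod.natCast_zmod_val, Prod.mk_add_mk, add_zero, zero_add]

lemma zetaTau_prodWeyl (m : SympSum D) :
    zetaTau hξ (prodWeyl d D ζ m) = Multiplicative.ofAdd m :=
  congrArg Multiplicative.ofAdd (funext fun i => oneTau_weyl (hξ i) (m i))

/-- A family in the kernel is a scalar in each factor, and `mk_zeta_zpow` gathers these scalars. -/
lemma ker_zetaTau (i₀ : Fin k) : (zetaTau hξ).ker = Subgroup.zpowers (prodZeta d D ζ i₀) := by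
  apply le_antisymm
  · intro g hg
    induction g using QuotientGroup.induction_on with | H A => ?_
    have h : ∀ i, ∃ c : ℤ, oneZeta d ζ (D i) ^ c = A i := by
      intro i
      have h1 : A i ∈ (oneTau (hξ i)).ker := by
        refine funext fun r => ?_
        rw [Subsingleton.elim r 0]
        exact congrFun hg i
      rw [(isPauliGenerated_pauliOne (hξ i)).ker_eq (hξ i).pow_eq_one (pow_mul ζ 2 _).symm] at h1
      exact h1
    choose c hc using h
    refine ⟨∑ i, c i, ?_⟩
    change prodZeta d D ζ i₀ ^ ∑ i, c i = _
    rw [← mk_zeta_zpow, funext hc]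
  · rw [Subgroup.zpowers_le, MonoidHom.mem_ker]
    exact piTau_zeta hξ i₀

lemma oneTau_commutator {d₀ : ℕ} [NeZero d₀] (hξ : IsPrimitiveRoot ((ζ ^ 2) ^ (d / d₀)) d₀)
    (A B : pauliOne d d₀ ζ) {p q : ZMod d₀ × ZMod d₀}
    (hp : Multiplicative.toAdd (oneTau hξ A) 0 = p)
    (hq : Multiplicative.toAdd (oneTau hξ B) 0 = q) :
    A * B = oneZeta d ζ d₀ ^ (2 * (d / d₀ * (p.1 * q.2 - p.2 * q.1).val)) * (B * A) := by
  rw [(isPauliGenerated_pauliOne hξ).commutator hξ.pow_eq_one (pow_mul ζ 2 _).symm A B, ← hp,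
    ← hq, ← mul_assoc 2, pow_mul]
  simp [pauliForm, pow_mul]

/-- The commutator in the factor `i` is a power of `ζ ^ (2 * (d / D i))`. Gathering the factors adds
the exponents to the sum defining `sympSumForm`, which matters only mod `d` because `(ζ²)^d = 1`. -/
lemma zetaTau_commutator [NeZero d] (hζ : IsPrimitiveRoot ζ (dbar d)) (i₀ : Fin k)
    (g h : ZetaProd d D ζ) :
    g * h = (prodZeta d D ζ i₀ ^ 2) ^ (sympSumForm d D (Multiplicative.toAdd (zetaTau hξ g))
      (Multiplicative.toAdd (zetaTau hξ h))).val * (h * g) := by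
  induction g using QuotientGroup.induction_on with | H A => ?_
  induction h using QuotientGroup.induction_on with | H B => ?_
  set p : SympSum D := Multiplicative.toAdd (zetaTau hξ (QuotientGroup.mk A)) with hp
  set q : SympSum D := Multiplicative.toAdd (zetaTau hξ (QuotientGroup.mk B)) with hq
  have h1 : ∀ i, A i * B i = oneZeta d ζ (D i) ^ (((2 * (d / D i *
      ((p i).1 * (q i).2 - (p i).2 * (q i).1).val) : ℕ)) : ℤ) * (B i * A i) := by
    intro i
    rw [zpow_natCast]
    exact oneTau_commutator (hξ i) (A i) (B i) rfl rfl
  have h2 : A * B = (fun i => oneZeta d ζ (D i) ^ (((2 * (d / D i *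
      ((p i).1 * (q i).2 - (p i).2 * (q i).1).val) : ℕ)) : ℤ)) * (B * A) := funext h1
  have h3 : sympSumForm d D p q = ((∑ i, d / D i *
      ((p i).1 * (q i).2 - (p i).2 * (q i).1).val : ℕ) : ZMod d) := by
    rw [sympSumForm]
    push_cast
    rfl
  have h4 : (prodZeta d D ζ i₀ ^ 2) ^ d = 1 := by
    rw [← pow_mul, ← orderOf_dvd_iff_pow_eq_one, orderOf_prodZeta hζ]
    unfold dbar
    split_ifs
    · exact dvd_rfl
    · exact Dvd.intro_left 2 rfl
  rw [← QuotientGroup.mk_mul, h2, QuotientGroup.mk_mul, mk_zeta_zpow i₀, h3, ZMod.val_natCast,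
    ← pow_eq_pow_mod _ h4, ← Nat.cast_sum, zpow_natCast, ← Finset.mul_sum, pow_mul]
  rfl

end Tau

end ZetaProduct

/-- The standard basis of `S_{D_1} ⊕ … ⊕ S_{D_k}`. -/
def sympBasis {k : ℕ} (D : Fin k → ℕ) : Fin k ⊕ Fin k → SympSum D :=
  Sum.elim (fun i => Pi.single i (1, 0)) (fun i => Pi.single i (0, 1))

lemma sum_zsmul_sympBasis {k : ℕ} {D : Fin k → ℕ} (c : Fin k ⊕ Fin k → ℤ) :
    ∑ i, c i • sympBasis D i
      = fun i => ((c (Sum.inl i) : ZMod (D i)), (c (Sum.inr i) : ZMod (D i))) := by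
  rw [Fintype.sum_sum_type]
  simp only [sympBasis, Sum.elim_inl, Sum.elim_inr, ← Pi.single_smul, Finset.univ_sum_single]
  funext i
  simp only [Pi.add_apply, Prod.smul_mk, smul_zero, zsmul_one, Prod.mk_add_mk, add_zero, zero_add]

/-- Only basis directions are allowed: for `d₀ = 2` the square of `Z X` is `-1`. -/
lemma oneWeyl_pow_eq_one {d d₀ : ℕ} {ζ : ℂˣ} [NeZero d₀] (hξ : IsPrimitiveRoot ((ζ ^ 2) ^ (d / d₀)) d₀)
    {p : ZMod d₀ × ZMod d₀} (hp : p = 0 ∨ p = (1, 0) ∨ p = (0, 1)) :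
    (oneZ d ζ d₀ ^ p.1.val * oneX d ζ d₀ ^ p.2.val) ^ d₀ = 1 := by
  have h := isPauliGenerated_pauliOne hξ
  rcases hp with rfl | rfl | rfl
  · simp
  · simp [← pow_mul, mul_comm _ d₀, pow_mul (oneZ d ζ d₀), h.z_pow 0]
  · simp [← pow_mul, mul_comm _ d₀, pow_mul (oneX d ζ d₀), h.x_pow 0]

lemma prodWeyl_sympBasis_pow {d k : ℕ} {D : Fin k → ℕ}
    [∀ i, NeZero (D i)] {ζ : ℂˣ} (hξ : ∀ i, IsPrimitiveRoot ((ζ ^ 2) ^ (d / D i)) (D i))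
    (i : Fin k ⊕ Fin k) :
    prodWeyl d D ζ (sympBasis D i) ^ Sum.elim D D i = 1 := by
  have h : ∀ j, (oneZ d ζ (D j) ^ (sympBasis D i j).1.val
      * oneX d ζ (D j) ^ (sympBasis D i j).2.val) ^ Sum.elim D D i = 1 := by
    intro j
    rcases i with i | i
    · by_cases hj : j = i
      · subst hj
        exact oneWeyl_pow_eq_one (hξ j) (Or.inr (Or.inl (by simp [sympBasis])))
      · simp [sympBasis, Pi.single_eq_of_ne hj]
    · by_cases hj : j = i
      · subst hj
        exact oneWeyl_pow_eq_one (hξ j) (Or.inr (Or.inr (by simp [sympBasis])))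
      · simp [sympBasis, Pi.single_eq_of_ne hj]
  exact congrArg (QuotientGroup.mk (s := zetaRel d D ζ)) (funext h)

/-! ### Lifting symplectic isomorphisms -/

section Lift

variable {n d k : ℕ} [NeZero d] {D : Fin k → ℕ} [∀ i, NeZero (D i)] {ζ : ℂˣ}

lemma primitiveRoot_divisor (hζ : IsPrimitiveRoot ζ (dbar d)) {d₀ : ℕ} (h : d₀ ∣ d) :
    IsPrimitiveRoot ((ζ ^ 2) ^ (d / d₀)) d₀ :=
  (dbar_pow hζ).pow (NeZero.pos d) (Nat.div_mul_cancel h).symm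

/-- A symplectic isomorphism lifts to the Heisenberg extensions. -/
lemma exists_lift_mulEquiv {M G : Type*} [Group G] [AddCommGroup M] {φ : M → M → ZMod d} {z : G}
    {τ : G →* Multiplicative M} (hG : IsHeisenbergExtension d φ z τ)
    (hz : ∀ g : G, z * g = g * z) (hζ : IsPrimitiveRoot ζ (dbar d)) (hD : ∀ i, D i ∣ d)
    (e : M ≃+ SympSum D) (he : ∀ x y, sympSumForm d D (e x) (e y) = φ x y) (i₀ : Fin k) :
    ∃ Ψ : G ≃* ZetaProd d D ζ, (∀ i, Ψ z = prodZeta d D ζ i) ∧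
      ∀ (g : G) (i : Fin k), ∃ c : ℤ,
        Ψ g = prodZeta d D ζ i ^ c * prodWeyl d D ζ (e (Multiplicative.toAdd (τ g))) := by
  have hξ : ∀ i, IsPrimitiveRoot ((ζ ^ 2) ^ (d / D i)) (D i) :=
    fun i => primitiveRoot_divisor hζ (hD i)
  let τ₁ : G →* Multiplicative (SympSum D) := (AddMonoidHom.toMultiplicative e.toAddMonoidHom).comp τ
  have hτ₁ : ∀ g, Multiplicative.toAdd (τ₁ g) = e (Multiplicative.toAdd (τ g)) := fun _ => rfl
  -- Order-preserving lifts of the basis transported by `e`; they are matched with the operators `Z`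
  -- and `X` of the factors, which have the required orders.
  choose u hu hord using fun i : Fin k ⊕ Fin k => hG.exists_lift (e.symm (sympBasis D i))
  have hτu : ∀ i, τ₁ (u i) = Multiplicative.ofAdd (sympBasis D i) := by
    intro i
    change Multiplicative.ofAdd (e (Multiplicative.toAdd (τ (u i)))) = _
    rw [hu, toAdd_ofAdd, AddEquiv.apply_symm_apply]
  have hker : τ₁.ker = Subgroup.zpowers z := by
    rw [← hG.ker_eq]
    ext g
    exact (AddEquiv.map_eq_zero_iff e : e (Multiplicative.toAdd (τ g)) = 0 ↔ _)
  have hu' : ∀ i, u i ^ Sum.elim D D i = 1 := by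
    intro i
    rw [← orderOf_dvd_iff_pow_eq_one, hord, addOrderOf_dvd_iff_nsmul_eq_zero, ← map_nsmul,
      AddEquiv.map_eq_zero_iff]
    funext j
    rcases i with i | i
    · by_cases hj : j = i
      · subst hj
        simp [sympBasis]
      · simp [sympBasis, Pi.single_eq_of_ne hj]
    · by_cases hj : j = i
      · subst hj
        simp [sympBasis]
      · simp [sympBasis, Pi.single_eq_of_ne hj]
  have hind : ∀ c : Fin k ⊕ Fin k → ℤ, ∑ i, c i • Multiplicative.toAdd (τ₁ (u i)) = 0 →
      ∀ i, ((Sum.elim D D i : ℕ) : ℤ) ∣ c i := by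
    intro c hc
    simp only [hτu, toAdd_ofAdd] at hc
    rw [sum_zsmul_sympBasis] at hc
    rintro (i | i)
    · exact (ZMod.intCast_zmod_eq_zero_iff_dvd _ _).mp (congrArg Prod.fst (congrFun hc i))
    · exact (ZMod.intCast_zmod_eq_zero_iff_dvd _ _).mp (congrArg Prod.snd (congrFun hc i))
  have hgen : Subgroup.closure (Set.range fun i => τ₁ (u i)) = ⊤ := by
    rw [eq_top_iff]
    intro m _
    obtain ⟨b, a, hm⟩ := sympSum_exists_intCast (Multiplicative.toAdd m)
    have h1 : m = ∏ i, τ₁ (u i) ^ Sum.elim b a i := by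
      refine Multiplicative.toAdd.injective ?_
      rw [toAdd_prod, hm]
      simp only [toAdd_zpow, hτu, toAdd_ofAdd]
      exact (sum_zsmul_sympBasis (Sum.elim b a)).symm
    rw [h1]
    exact Subgroup.prod_mem _ fun i _ => zpow_mem (Subgroup.subset_closure (Set.mem_range_self i)) _
  obtain ⟨Ψ, hΨz, hΨ⟩ := exists_mulEquiv_of_extensions (φ := sympSumForm d D) (τ := τ₁)
    (τ' := zetaTau hξ) (u := u) (u' := fun i => prodWeyl d D ζ (sympBasis D i))
    (D := Sum.elim D D) hker (ker_zetaTau hξ i₀)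
    (by rw [hG.orderOf_zeta, orderOf_prodZeta hζ]) hz (prodZeta_comm i₀)
    (fun g h => by rw [hτ₁, hτ₁, he]; exact hG.commutator g h)
    (zetaTau_commutator hξ hζ i₀) hu' (prodWeyl_sympBasis_pow hξ)
    (fun i => by rw [hτu, zetaTau_prodWeyl]) hind hgen
  refine ⟨Ψ, fun i => by rw [hΨz, prodZeta_eq i₀ i], fun g i => ?_⟩
  -- Both elements lie over the same vector, so they differ by a power of `ζ`.
  have h1 : Ψ g * (prodWeyl d D ζ (e (Multiplicative.toAdd (τ g))))⁻¹ ∈ (zetaTau hξ).ker := by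
    rw [MonoidHom.mem_ker, map_mul, map_inv, hΨ, zetaTau_prodWeyl, mul_inv_eq_one]
    rfl
  rw [ker_zetaTau hξ i] at h1
  obtain ⟨c, hc⟩ := h1
  exact ⟨c, by rw [show prodZeta d D ζ i ^ c = _ from hc, inv_mul_cancel_right]⟩

end Lift

/-! ### The hermitian product and unitarity of Pauli operators -/

section Herm

variable {k : ℕ} {D : Fin k → ℕ} [∀ i, NeZero (D i)]

lemma quditsBasis_apply (s : ∀ i, ZMod (D i)) :
    quditsBasis D s = PiTensorProduct.tprod ℂ fun i => (Pi.single (s i) 1 : Qudit (D i)) := by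
  rw [quditsBasis, Basis.piTensorProduct_apply]
  congr 1
  funext i
  exact Pi.basisFun_apply ℂ (ZMod (D i)) (s i)

lemma hermForm_quditsBasis (s t : ∀ i, ZMod (D i)) :
    hermForm D (quditsBasis D s) (quditsBasis D t) = if s = t then 1 else 0 := by
  classical
  simp only [hermForm, Module.Basis.repr_self, Finsupp.single_apply]
  rw [Finset.sum_eq_single s (fun r _ hr => by rw [if_neg hr.symm, map_zero, zero_mul]) (by simp)]
  simp [eq_comm]

/-- The pullback of the hermitian scalar product along a linear map, as a sesquilinear form. -/
def hermPullback {M : Type*} [AddCommMonoid M] [Module ℂ M] (f : M →ₗ[ℂ] Qudits D) :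
    M →ₗ⋆[ℂ] M →ₗ[ℂ] ℂ :=
  LinearMap.mk₂'ₛₗ (starRingEnd ℂ) (RingHom.id ℂ) (fun v w => hermForm D (f v) (f w))
    (fun v v' w => by simp [hermForm, add_mul, Finset.sum_add_distrib])
    (fun c v w => by simp [hermForm, Finset.mul_sum, mul_assoc])
    (fun v w w' => by simp [hermForm, mul_add, Finset.sum_add_distrib])
    (fun c v w => by simp [hermForm, Finset.mul_sum, mul_left_comm])

lemma hermPullback_apply {M : Type*} [AddCommMonoid M] [Module ℂ M] (f : M →ₗ[ℂ] Qudits D)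
    (v w : M) : hermPullback f v w = hermForm D (f v) (f w) := rfl

lemma hermForm_smul_smul (c c' : ℂ) (v w : Qudits D) :
    hermForm D (c • v) (c' • w) = (starRingEnd ℂ) c * c' * hermForm D v w := by
  simp only [hermForm, map_smul, Finsupp.smul_apply, smul_eq_mul, map_mul, Finset.mul_sum]
  exact Finset.sum_congr rfl fun _ _ => by ring

/-- A linear map that sends the standard basis to an orthonormal family is an isometry. -/
lemma hermForm_map_of_orthonormal {l : ℕ} {D' : Fin l → ℕ} [∀ i, NeZero (D' i)]
    (f : Qudits D →ₗ[ℂ] Qudits D')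
    (hf : ∀ s t, hermForm D' (f (quditsBasis D s)) (f (quditsBasis D t)) = if s = t then 1 else 0)
    (v w : Qudits D) : hermForm D' (f v) (f w) = hermForm D v w := by
  have h : hermPullback f = hermPullback (LinearMap.id : Qudits D →ₗ[ℂ] Qudits D) := by
    refine (quditsBasis D).ext fun s => (quditsBasis D).ext fun t => ?_
    rw [hermPullback_apply, hermPullback_apply, hf, LinearMap.id_apply, LinearMap.id_apply,
      hermForm_quditsBasis]
  rw [← hermPullback_apply f, h, hermPullback_apply, LinearMap.id_apply, LinearMap.id_apply]

lemma hermForm_self_eq (v : Qudits D) :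
    hermForm D v v = ((∑ s, ‖(quditsBasis D).repr v s‖ ^ 2 : ℝ) : ℂ) := by
  simp only [hermForm, Complex.conj_mul']
  push_cast
  rfl

lemma eq_zero_of_sum_norm_eq_zero {v : Qudits D}
    (h : ∑ s, ‖(quditsBasis D).repr v s‖ ^ 2 = 0) : v = 0 := by
  refine (quditsBasis D).ext_elem fun s => ?_
  rw [Finset.sum_eq_zero_iff_of_nonneg fun _ _ => by positivity] at h
  have := h s (Finset.mem_univ s)
  rw [sq_eq_zero_iff, norm_eq_zero] at this
  rw [this]
  simp

lemma eq_zero_of_hermForm_self {v : Qudits D} (h : hermForm D v v = 0) : v = 0 := by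
  rw [hermForm_self_eq, Complex.ofReal_eq_zero] at h
  exact eq_zero_of_sum_norm_eq_zero h

lemma exists_normalization {v : Qudits D} (hv : v ≠ 0) :
    ∃ c : ℂ, hermForm D (c • v) (c • v) = 1 := by
  set r : ℝ := ∑ s, ‖(quditsBasis D).repr v s‖ ^ 2 with hr
  have hr0 : 0 < r := lt_of_le_of_ne (Finset.sum_nonneg fun _ _ => by positivity)
    fun h => hv (eq_zero_of_sum_norm_eq_zero h.symm)
  refine ⟨((√r)⁻¹ : ℝ), ?_⟩
  rw [hermForm_smul_smul, hermForm_self_eq, ← hr, Complex.conj_ofReal, ← Complex.ofReal_mul,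
    ← Complex.ofReal_mul, ← mul_inv, Real.mul_self_sqrt hr0.le, inv_mul_cancel₀ hr0.ne',
    Complex.ofReal_one]

/-- It suffices to test the standard basis; its images are pure tensors, on which the hermitian
product factorises. -/
lemma hermForm_tensorHom (A : ∀ i, Qudit (D i) ≃ₗ[ℂ] Qudit (D i))
    (hA : ∀ i (v w : Qudit (D i)), ∑ s, (starRingEnd ℂ) (A i v s) * A i w s
      = ∑ s, (starRingEnd ℂ) (v s) * w s) (v w : Qudits D) :
    hermForm D (tensorHom D A v) (tensorHom D A w) = hermForm D v w := by
  refine hermForm_map_of_orthonormal (tensorHom D A : Qudits D →ₗ[ℂ] Qudits D) (fun s t => ?_) v w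
  rw [← hermForm_quditsBasis, quditsBasis_apply, quditsBasis_apply, LinearEquiv.coe_coe,
    tensorHom_tprod, tensorHom_tprod, hermForm_tprod, hermForm_tprod]
  exact Finset.prod_congr rfl fun i _ => hA i _ _

lemma hermForm_tensorHom_single (r : Fin k) (A : Qudit (D r) ≃ₗ[ℂ] Qudit (D r))
    (hA : ∀ v w : Qudit (D r), ∑ s, (starRingEnd ℂ) (A v s) * A w s
      = ∑ s, (starRingEnd ℂ) (v s) * w s) (v w : Qudits D) :
    hermForm D (tensorHom D (Pi.mulSingle r A) v) (tensorHom D (Pi.mulSingle r A) w)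
      = hermForm D v w := by
  refine hermForm_tensorHom _ (fun i => ?_) v w
  by_cases hi : i = r
  · subst hi
    rw [Pi.mulSingle_eq_same]
    exact hA
  · rw [Pi.mulSingle_eq_of_ne hi]
    exact fun _ _ => rfl

end Herm

lemma conj_mul_self_of_pow_eq_one {ζ : ℂˣ} {m : ℕ} (hm : m ≠ 0) (h : ζ ^ m = 1) :
    (starRingEnd ℂ) (ζ : ℂ) * (ζ : ℂ) = 1 := by
  have h1 : ‖(ζ : ℂ)‖ = 1 := Complex.norm_eq_one_of_pow_eq_one (by
    rw [← Units.val_pow_eq_pow_val, h, Units.val_one]) hm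
  rw [Complex.conj_mul', h1]
  simp

/-- On its tensor factor, `X_r` permutes the standard basis; `Z_r` and `ζ` multiply coordinates by
numbers of modulus 1. Isometries are closed under products and inverses. -/
lemma hermForm_pauliGroup {n d : ℕ} [NeZero d] {ζ : ℂˣ} (hζ : IsPrimitiveRoot ζ (dbar d))
    {g : NQudits n d ≃ₗ[ℂ] NQudits n d} (hg : g ∈ pauliGroup n d ζ) (v w : NQudits n d) :
    hermForm (fun _ : Fin n => d) (g v) (g w) = hermForm (fun _ : Fin n => d) v w := by
  induction hg using Subgroup.closure_induction generalizing v w with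
  | mem x hx =>
    rcases hx with (⟨r, rfl⟩ | ⟨r, rfl⟩) | rfl
    · refine hermForm_tensorHom_single (D := fun _ : Fin n => d) r (opX d) (fun v w => ?_) v w
      exact Equiv.sum_comp (Equiv.subRight (1 : ZMod d))
        (fun s => (starRingEnd ℂ) (v s) * w s)
    · refine hermForm_tensorHom_single (D := fun _ : Fin n => d) r (opZ d (ζ ^ 2))
        (fun v w => Finset.sum_congr rfl fun s _ => ?_) v w
      have h1 : (((ζ ^ 2) ^ s.val : ℂˣ)) ^ d = 1 := by
        rw [← pow_mul, mul_comm, pow_mul, (dbar_pow hζ).pow_eq_one, one_pow]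
      have h2 := conj_mul_self_of_pow_eq_one (NeZero.ne d) h1
      rw [opZ_apply, opZ_apply, map_mul, mul_mul_mul_comm, h2, one_mul]
    · rw [scal_apply, scal_apply, hermForm_smul_smul,
        conj_mul_self_of_pow_eq_one (dbar_pos (d := d)).ne' hζ.pow_eq_one, one_mul]
  | one => rfl
  | mul x y _ _ hx hy => rw [LinearEquiv.mul_apply, LinearEquiv.mul_apply, hx, hy]
  | inv x _ hx =>
    have h : ∀ u, x (x⁻¹ u) = u := x.apply_symm_apply
    rw [← hx, h, h]

lemma zetaProdAct_prodWeyl_tprod {d k : ℕ} {D : Fin k → ℕ} {ζ : ℂˣ} (m : SympSum D) (v : ∀ i, Qudit (D i)) :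
    zetaProdAct d D ζ (prodWeyl d D ζ m) (PiTensorProduct.tprod ℂ v)
      = PiTensorProduct.tprod ℂ fun i =>
        (opZ (D i) ((ζ ^ 2) ^ (d / D i)) ^ (m i).1.val) ((opX (D i) ^ (m i).2.val) (v i)) :=
  tensorHom_tprod D _ v

/-! ### Weyl operators acting on the vacuum vector -/

section Weyl

variable {d k : ℕ} {D : Fin k → ℕ} [∀ i, NeZero (D i)] {ζ : ℂˣ}

lemma opX_pow_single {d₀ : ℕ} (j : ℕ) (s : ZMod d₀) :
    (opX d₀ ^ j) (Pi.single s 1) = Pi.single (s + j) 1 := by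
  funext i
  rw [opX_pow_apply, Pi.single_apply, Pi.single_apply]
  exact if_congr sub_eq_iff_eq_add rfl rfl

lemma opZ_pow_single {d₀ : ℕ} (ξ : ℂˣ) (j : ℕ) (s : ZMod d₀) :
    (opZ d₀ ξ ^ j) (Pi.single s 1) = (((ξ ^ j) ^ s.val : ℂˣ) : ℂ) • (Pi.single s 1 : Qudit d₀) := by
  rw [← opZ_pow]
  funext i
  rw [opZ_apply, Pi.smul_apply, smul_eq_mul]
  by_cases h : i = s
  · rw [h]
  · rw [Pi.single_eq_of_ne h, mul_zero, mul_zero]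

lemma zetaProdAct_weylX (s : ∀ i, ZMod (D i)) :
    zetaProdAct d D ζ (prodWeyl d D ζ fun i => (0, s i)) (quditsBasis D 0)
      = quditsBasis D s := by
  rw [quditsBasis_apply, quditsBasis_apply, zetaProdAct_prodWeyl_tprod]
  congr 1
  funext i
  rw [opX_pow_single, ZMod.val_zero, pow_zero, Pi.zero_apply, zero_add, ZMod.natCast_zmod_val]
  rfl

lemma zetaProdAct_weylZ (b s : ∀ i, ZMod (D i)) :
    zetaProdAct d D ζ (prodWeyl d D ζ fun i => (b i, 0)) (quditsBasis D s)
      = ((∏ i, (((ζ ^ 2) ^ (d / D i)) ^ (b i).val) ^ (s i).val : ℂˣ) : ℂ) • quditsBasis D s := by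
  rw [quditsBasis_apply, zetaProdAct_prodWeyl_tprod, Units.coe_prod,
    ← MultilinearMap.map_smul_univ]
  congr 1
  funext i
  rw [ZMod.val_zero, pow_zero, LinearEquiv.coe_one, id, opZ_pow_single]

lemma zetaProdAct_weylZ_zero (b : ∀ i, ZMod (D i)) :
    zetaProdAct d D ζ (prodWeyl d D ζ fun i => (b i, 0)) (quditsBasis D 0) = quditsBasis D 0 := by
  rw [zetaProdAct_weylZ]
  simp

variable (hξ : ∀ i, IsPrimitiveRoot ((ζ ^ 2) ^ (d / D i)) (D i))

-- Both sides agree under `zetaTau`, up to the choice of `t` and `b`, so they differ by a power of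
-- `ζ`. The `Z`-part stands on the right, where it fixes the vacuum; the action on basis vectors is
-- thus encoded in the group alone and transfers to other representations.
include hξ in
lemma exists_mul_weylX_eq (i₀ : Fin k) (p : ZetaProd d D ζ) (s : ∀ i, ZMod (D i)) :
    ∃ (t : ∀ i, ZMod (D i)) (c : ℤ) (b : ∀ i, ZMod (D i)),
      p * prodWeyl d D ζ (fun i => (0, s i))
        = prodWeyl d D ζ (fun i => (0, t i))
          * (prodZeta d D ζ i₀ ^ c * prodWeyl d D ζ (fun i => (b i, 0))) := by
  set m : SympSum D := Multiplicative.toAdd (zetaTau hξ p) with hm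
  have hp : zetaTau hξ p = Multiplicative.ofAdd m := rfl
  have h : (prodWeyl d D ζ fun i => (0, (m i).2 + s i))⁻¹ * (p * prodWeyl d D ζ fun i => (0, s i))
      * (prodWeyl d D ζ fun i => ((m i).1, 0))⁻¹ ∈ (zetaTau hξ).ker := by
    rw [MonoidHom.mem_ker, map_mul, map_mul, map_mul, map_inv, map_inv, zetaTau_prodWeyl,
      zetaTau_prodWeyl, zetaTau_prodWeyl, hp, ← ofAdd_neg, ← ofAdd_neg, ← ofAdd_add, ← ofAdd_add,
      ← ofAdd_add, ofAdd_eq_one]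
    funext i
    refine Prod.ext ?_ ?_
    · simp
    · simp
  rw [ker_zetaTau hξ i₀] at h
  obtain ⟨c, hc⟩ := h
  refine ⟨fun i => (m i).2 + s i, c, fun i => (m i).1, ?_⟩
  rw [show prodZeta d D ζ i₀ ^ c = _ from hc, inv_mul_cancel_right, mul_inv_cancel_left]

include hξ in
/-- The basis vectors of `ℂ^{D_1} ⊗ … ⊗ ℂ^{D_k}` have different eigenvalues under the `Z`-type
operators. -/
lemma eq_zero_of_eigenvalue_relation {s t : ∀ i, ZMod (D i)} (hst : s ≠ t) {c : ℂ}
    (hc : ∀ b : ∀ i, ZMod (D i),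
      (starRingEnd ℂ) ((∏ i, (((ζ ^ 2) ^ (d / D i)) ^ (b i).val) ^ (s i).val : ℂˣ) : ℂ)
        * ((∏ i, (((ζ ^ 2) ^ (d / D i)) ^ (b i).val) ^ (t i).val : ℂˣ) : ℂ) * c = c) :
    c = 0 := by
  by_contra hc0
  refine hst (funext fun i => ?_)
  have h1 : ∀ u : ∀ i, ZMod (D i), ∏ j, (((ζ ^ 2) ^ (d / D j)) ^
      ((Pi.single i 1 : ∀ i, ZMod (D i)) j).val) ^ (u j).val
        = ((ζ ^ 2) ^ (d / D i)) ^ (u i).val := by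
    intro u
    rw [Finset.prod_eq_single i (fun j _ hj => by
      rw [Pi.single_eq_of_ne hj, ZMod.val_zero, pow_zero, one_pow]) (by simp),
      Pi.single_eq_same, pow_val_one (hξ i).pow_eq_one]
  -- Testing with `Z` on the factor `i` alone: if `c ≠ 0`, the two eigenvalues `ξ_i ^ s_i` and `ξ_i
  -- ^ t_i` coincide.
  have h2 := hc (Pi.single i 1)
  rw [h1, h1, mul_eq_right₀ hc0] at h2
  have h3 : (((ζ ^ 2) ^ (d / D i)) ^ (s i).val) ^ D i = 1 := by
    rw [← pow_mul, mul_comm, pow_mul, (hξ i).pow_eq_one, one_pow]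
  have h4 := conj_mul_self_of_pow_eq_one (NeZero.ne (D i)) h3
  have h5 := mul_left_cancel₀ (left_ne_zero_of_mul_eq_one h2) (h2.trans h4.symm)
  exact (ZMod.val_injective _ ((hξ i).pow_inj (ZMod.val_lt _) (ZMod.val_lt _) (Units.ext h5))).symm

end Weyl

lemma bijective_of_finrank_eq {V E : Type*} [AddCommGroup V] [Module ℂ V]
    [FiniteDimensional ℂ V] [AddCommGroup E] [Module ℂ E] [FiniteDimensional ℂ E]
    (W : Submodule ℂ V) (T : E →ₗ[ℂ] W) (hT : ∀ x, T x = 0 → x = 0)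
    (h : Module.finrank ℂ W = Module.finrank ℂ E) : Function.Bijective T :=
  have hinj : Function.Injective T := (injective_iff_map_eq_zero T).mpr hT
  ⟨hinj, (LinearMap.injective_iff_surjective_of_finrank_eq_finrank h.symm).mp hinj⟩

lemma quotAct_mk {n d : ℕ} {ζ : ℂˣ} {H : Subgroup (pauliGroup n d ζ)}
    (g : normGrp H) (v : stabSpace H) :
    ((quotAct H (QuotientGroup.mk g) v : stabSpace H) : NQudits n d)
      = ((g : pauliGroup n d ζ) : NQudits n d ≃ₗ[ℂ] NQudits n d) v := rfl

lemma quotAct_quotZeta_zpow {n d : ℕ} {ζ : ℂˣ} {H : Subgroup (pauliGroup n d ζ)}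
    (c : ℤ) (v : stabSpace H) :
    quotAct H (quotZeta H ^ c) v = ((ζ ^ c : ℂˣ) : ℂ) • v := by
  refine Subtype.ext ?_
  rw [quotZeta_zpow, quotAct_mk, Submodule.coe_smul, ← scal_apply, map_zpow]
  rfl

/-! ### Construction of the unitary intertwiner -/

section Intertwiner

variable {n d k : ℕ} [NeZero d] {D : Fin k → ℕ} [∀ i, NeZero (D i)] {ζ : ℂˣ}

/-- A unitary representation of the `ζ`-product of dimension `D_1 ⋯ D_k`, on which `ζ` acts as a
scalar and which has a vacuum vector, is unitarily equivalent to the tensor product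
representation. -/
theorem exists_unitary_intertwiner
    (hξ : ∀ i, IsPrimitiveRoot ((ζ ^ 2) ^ (d / D i)) (D i)) (i₀ : Fin k)
    (W : Submodule ℂ (NQudits n d)) (ρ : ZetaProd d D ζ →* Module.End ℂ W)
    (hρζ : ∀ (c : ℤ) v, ρ (prodZeta d D ζ i₀ ^ c) v = ((ζ ^ c : ℂˣ) : ℂ) • v)
    (hρ : ∀ p (v w : W), hermForm (fun _ : Fin n => d) (ρ p v : NQudits n d) (ρ p w)
      = hermForm (fun _ : Fin n => d) (v : NQudits n d) w)
    (w₀ : W) (hw₀ : hermForm (fun _ : Fin n => d) (w₀ : NQudits n d) w₀ = 1)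
    (hfix : ∀ p, zetaProdAct d D ζ p (quditsBasis D 0) = quditsBasis D 0 → ρ p w₀ = w₀)
    (hdim : Module.finrank ℂ W = ∏ i, D i) :
    ∃ U : W ≃ₗ[ℂ] Qudits D,
      (∀ v w : W, hermForm D (U v) (U w)
        = hermForm (fun _ : Fin n => d) (v : NQudits n d) (w : NQudits n d)) ∧
      ∀ p v, U (ρ p v) = zetaProdAct d D ζ p (U v) := by
  -- `w₀` takes the role of the vacuum: each basis vector is an `X`-type operator applied to `e_0`.
  let T : Qudits D →ₗ[ℂ] W :=
    (quditsBasis D).constr ℂ fun s => ρ (prodWeyl d D ζ fun i => (0, s i)) w₀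
  have hT : ∀ s, T (quditsBasis D s) = ρ (prodWeyl d D ζ fun i => (0, s i)) w₀ :=
    fun s => (quditsBasis D).constr_basis ℂ _ s
  have hTp : ∀ p x, T (zetaProdAct d D ζ p x) = ρ p (T x) := by
    intro p x
    -- The group identity `hpt` gives the same scalar and the same `t` in both representations,
    -- since the `Z`-part fixes both `e_0` and `w₀`.
    have h : T ∘ₗ zetaProdAct d D ζ p = ρ p ∘ₗ T := by
      refine (quditsBasis D).ext fun s => ?_
      obtain ⟨t, c, b, hpt⟩ := exists_mul_weylX_eq hξ i₀ p s
      have h1 : zetaProdAct d D ζ p (quditsBasis D s) = ((ζ ^ c : ℂˣ) : ℂ) • quditsBasis D t := by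
        rw [← zetaProdAct_weylX (d := d) (ζ := ζ) s, ← Module.End.mul_apply, ← map_mul, hpt,
          map_mul, map_mul, Module.End.mul_apply, Module.End.mul_apply, zetaProdAct_weylZ_zero,
          zetaProdAct_prodZeta_zpow, map_smul, zetaProdAct_weylX]
      rw [LinearMap.comp_apply, LinearMap.comp_apply, h1, map_smul, hT, hT,
        ← Module.End.mul_apply, ← map_mul, hpt, map_mul, map_mul, Module.End.mul_apply,
        Module.End.mul_apply, hfix _ (zetaProdAct_weylZ_zero b), hρζ, map_smul]
    exact LinearMap.congr_fun h x
  have horth : ∀ s t, hermForm (fun _ : Fin n => d) (T (quditsBasis D s) : NQudits n d)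
      (T (quditsBasis D t)) = if s = t then 1 else 0 := by
    intro s t
    split_ifs with hst
    · rw [hst, hT, hρ, hw₀]
    -- The images of distinct basis vectors are eigenvectors of the unitary `Z`-type operators, with
    -- eigenvalues that differ for some `b`; hence they are orthogonal.
    · refine eq_zero_of_eigenvalue_relation hξ hst fun b => ?_
      have h1 := hρ (prodWeyl d D ζ fun i => (b i, 0)) (T (quditsBasis D s)) (T (quditsBasis D t))
      rw [← hTp, ← hTp, zetaProdAct_weylZ, zetaProdAct_weylZ, map_smul, map_smul,
        Submodule.coe_smul, Submodule.coe_smul, hermForm_smul_smul] at h1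
      exact h1
  have hiso : ∀ x y, hermForm (fun _ : Fin n => d) (T x : NQudits n d) (T y) = hermForm D x y :=
    hermForm_map_of_orthonormal (W.subtype ∘ₗ T) horth
  have hker : ∀ x, T x = 0 → x = 0 := by
    intro x hx
    refine eq_zero_of_hermForm_self ?_
    rw [← hiso, hx]
    simp [hermForm]
  let e : Qudits D ≃ₗ[ℂ] W := LinearEquiv.ofBijective T
    (bijective_of_finrank_eq W T hker (hdim.trans (finrank_qudits D).symm))
  have he : ∀ v, T (e.symm v) = v := e.apply_symm_apply
  refine ⟨e.symm, fun v w => ?_, fun p v => ?_⟩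
  · rw [← hiso, he, he]
  · rw [LinearEquiv.symm_apply_eq]
    change _ = T _
    rw [hTp, he]

variable (hζ : IsPrimitiveRoot ζ (dbar d)) {H : Subgroup (pauliGroup n d ζ)}

include hζ in
lemma hermForm_quotAct (g : NormQuot H) (v w : stabSpace H) :
    hermForm (fun _ : Fin n => d) (quotAct H g v : NQudits n d) (quotAct H g w)
      = hermForm (fun _ : Fin n => d) (v : NQudits n d) w := by
  induction g using QuotientGroup.induction_on with | H g => ?_
  rw [quotAct_mk, quotAct_mk]
  exact hermForm_pauliGroup hζ (g : pauliGroup n d ζ).2 _ _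

include hζ in
/-- The stabiliser space contains a unit vector that is fixed by the elements of `N(H)/H` which
correspond to the stabiliser of the standard vacuum vector. -/
lemma exists_vacuum (i₀ : Fin k) (Ψ : NormQuot H ≃* ZetaProd d D ζ)
    (hΨ : Ψ (quotZeta H) = prodZeta d D ζ i₀) :
    ∃ w₀ : stabSpace H, hermForm (fun _ : Fin n => d) (w₀ : NQudits n d) w₀ = 1 ∧
      ∀ g, zetaProdAct d D ζ (Ψ g) (quditsBasis D 0) = quditsBasis D 0 → quotAct H g w₀ = w₀ := by
  -- The preimage in the Pauli group of the stabiliser of `e_0` under `Ψ`. It contains `H`, so its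
  -- fixed vectors lie in `V^H`.
  let L : Subgroup (pauliGroup n d ζ) := Subgroup.map (normGrp H).subtype
    { carrier := {g | zetaProdAct d D ζ (Ψ (QuotientGroup.mk g)) (quditsBasis D 0)
        = quditsBasis D 0}
      one_mem' := by
        change zetaProdAct d D ζ (Ψ 1) (quditsBasis D 0) = _
        rw [map_one, map_one, Module.End.one_apply]
      mul_mem' := by
        intro a b ha hb
        rw [Set.mem_ofPred_eq] at ha hb ⊢
        rw [QuotientGroup.mk_mul, map_mul, map_mul, Module.End.mul_apply, hb, ha]
      inv_mem' := by
        intro a ha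
        rw [Set.mem_ofPred_eq] at ha ⊢
        conv_lhs => rw [← ha]
        rw [← Module.End.mul_apply, ← map_mul, ← map_mul, ← QuotientGroup.mk_mul, inv_mul_cancel]
        change zetaProdAct d D ζ (Ψ 1) (quditsBasis D 0) = _
        rw [map_one, map_one, Module.End.one_apply] }
  have hmem : ∀ g : normGrp H, (g : pauliGroup n d ζ) ∈ L ↔
      zetaProdAct d D ζ (Ψ (QuotientGroup.mk g)) (quditsBasis D 0) = quditsBasis D 0 := by
    intro g
    constructor
    · rintro ⟨g', hg', h⟩
      rw [← Subtype.ext (show (g' : pauliGroup n d ζ) = g from h)]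
      exact hg'
    · exact fun h => ⟨g, h, rfl⟩
  have hscal : ∀ a : ℤ, pauliZeta n d ζ ^ a ∈ L → pauliZeta n d ζ ^ a = 1 := by
    intro a ha
    have h1 := (hmem (⟨pauliZeta n d ζ, pauliZeta_mem_norm H⟩ ^ a)).mp ha
    rw [← quotZeta_zpow, map_zpow, hΨ, zetaProdAct_prodZeta_zpow] at h1
    have h2 : ζ ^ a = 1 := eq_one_of_smul_eq ((quditsBasis D).ne_zero 0) h1
    refine Subtype.ext ?_
    change scal _ ζ ^ a = 1
    rw [← map_zpow, h2, map_one]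
  -- `L` meets the scalars trivially, since a scalar fixing `e_0` is 1. The dimension formula thus
  -- holds for `L`, and `d ^ n ≠ 0` excludes a zero fixed space.
  have hne : stabSpace L ≠ ⊥ := by
    intro h
    have h1 := finrank_stabSpace hζ hscal
    rw [h, finrank_bot, zero_mul] at h1
    exact (pow_pos (NeZero.pos d) n).ne h1
  obtain ⟨w, hw, hw0⟩ := Submodule.exists_mem_ne_zero_of_ne_bot hne
  obtain ⟨c, hc⟩ := exists_normalization hw0
  have hcw : c • w ∈ stabSpace L := Submodule.smul_mem _ c hw
  have hHL : ∀ h ∈ H, h ∈ L := by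
    intro h hh
    have hN : h ∈ normGrp H := Subgroup.le_normalizer hh
    refine (hmem ⟨h, hN⟩).mpr ?_
    have h1 : (QuotientGroup.mk ⟨h, hN⟩ : NormQuot H) = 1 :=
      (QuotientGroup.eq_one_iff _).mpr (Subgroup.mem_subgroupOf.mpr hh)
    rw [h1, map_one, map_one, Module.End.one_apply]
  refine ⟨⟨c • w, fun h hh => hcw h (hHL h hh)⟩, hc, fun g hg => ?_⟩
  induction g using QuotientGroup.induction_on with | H g => ?_
  refine Subtype.ext ?_
  rw [quotAct_mk]
  exact hcw _ ((hmem g).mpr hg)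

end Intertwiner

end QuditStab

end

open QuditStab
/-- `H` is a commutative subgroup of the `n`-qudit Pauli group that contains no power of `ζ` other
than the identity. -/
theorem mainTheorem1 (n d : ℕ) [NeZero d] (ζ : ℂˣ) (hζ : IsPrimitiveRoot ζ (dbar d))
    (H : Subgroup (pauliGroup n d ζ))
    (hcomm : ∀ g ∈ H, ∀ h ∈ H, g * h = h * g)
    (hscal : ∀ a : ℤ, pauliZeta n d ζ ^ a ∈ H → pauliZeta n d ζ ^ a = 1) :
    ∃ τH : NormQuot H →* Multiplicative (Red (tauImage hζ H)),
      -- `τH` is induced by `τ`, and makes `N(H)/H` a Heisenberg extension of `τ(H)^⊥/τ(H)`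
      IsInducedByTau hζ H τH ∧
      IsHeisenbergExtension d (redForm (tauImage hζ H)) (quotZeta H) τH ∧
      -- `τ(H)^⊥/τ(H)` is an orthogonal sum of elementary symplectic modules
      (∃ (k : ℕ) (D : Fin k → ℕ), 0 < k ∧ (∀ i, 0 < D i ∧ D i ∣ d) ∧
        ∃ e : Red (tauImage hζ H) ≃+ SympSum D, IsSymplecticIso e) ∧
      -- for every decomposition of this kind
      ∀ (k : ℕ) (D : Fin k → ℕ) [∀ i, NeZero (D i)], 0 < k → (∀ i, D i ∣ d) →
        ∀ e : Red (tauImage hζ H) ≃+ SympSum D, IsSymplecticIso e →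
          -- there is an isomorphism of `N(H)/H` with the `ζ`-product that fixes `ζ` and lifts `e`
          (∃ Ψ : NormQuot H ≃* ZetaProd d D ζ,
            (∀ i, Ψ (quotZeta H) = prodZeta d D ζ i) ∧
            ∀ (g : NormQuot H) (i : Fin k), ∃ c : ℤ,
              Ψ g = prodZeta d D ζ i ^ c * prodWeyl d D ζ (e (Multiplicative.toAdd (τH g)))) ∧
          -- and each isomorphism that fixes `ζ` is realised by a unitary isomorphism
          ∀ Ψ : NormQuot H ≃* ZetaProd d D ζ,
            (∀ i, Ψ (quotZeta H) = prodZeta d D ζ i) →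
            ∃ U : stabSpace H ≃ₗ[ℂ] Qudits D,
              (∀ v w : stabSpace H,
                hermForm D (U v) (U w)
                  = hermForm (fun _ : Fin n => d) (v : NQudits n d) (w : NQudits n d)) ∧
              ∀ (g : NormQuot H) (v : stabSpace H),
                U (quotAct H g v) = zetaProdAct d D ζ (Ψ g) (U v) := by
  have hG := isHeisenbergExtension_redTau hζ hscal
  refine ⟨redTau hζ hscal, isInducedByTau_redTau hζ hscal, hG, exists_red_decomposition _, ?_⟩
  intro k D hD0 hk hD e he
  have hξ : ∀ i, IsPrimitiveRoot ((ζ ^ 2) ^ (d / D i)) (D i) :=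
    fun i => primitiveRoot_divisor hζ (hD i)
  have hz : ∀ g : NormQuot H, quotZeta H * g = g * quotZeta H := by
    intro g
    induction g using QuotientGroup.induction_on with | H g => ?_
    exact congrArg (QuotientGroup.mk (s := H.subgroupOf (normGrp H)))
      (Subtype.ext (Subtype.ext (scal_comm _ _)) :
        (⟨pauliZeta n d ζ, pauliZeta_mem_norm H⟩ : normGrp H) * g = g * ⟨_, _⟩)
  refine ⟨exists_lift_mulEquiv hG hz hζ hD e he ⟨0, hk⟩, fun Ψ hΨ => ?_⟩
  obtain ⟨w₀, hw₀, hfix⟩ := exists_vacuum hζ ⟨0, hk⟩ Ψ (hΨ _)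
  -- `V^H` is made a representation of the `ζ`-product through `Ψ⁻¹`; the hypothesis on `ζ` makes it
  -- act there as the scalar `ζ`.
  obtain ⟨U, hU, hUρ⟩ := exists_unitary_intertwiner hξ ⟨0, hk⟩ (stabSpace H)
    ((quotAct H).comp Ψ.symm.toMonoidHom)
    (fun c v => by
      have h : Ψ.symm (prodZeta d D ζ ⟨0, hk⟩ ^ c) = quotZeta H ^ c := by
        rw [MulEquiv.symm_apply_eq, map_zpow, hΨ]
      exact (congrArg (fun g => quotAct H g v) h).trans (quotAct_quotZeta_zpow c v))
    (fun p => hermForm_quotAct hζ (Ψ.symm p)) w₀ hw₀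
    (fun p hp => hfix _ (by rwa [MulEquiv.coe_toMonoidHom, MulEquiv.apply_symm_apply]))
    (finrank_stabSpace_eq hζ hscal hcomm e)
  refine ⟨U, hU, fun g v => ?_⟩
  rw [← hUρ, MonoidHom.comp_apply, MulEquiv.coe_toMonoidHom, MulEquiv.symm_apply_apply]
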